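/- **Conventions.** Let $n\ge 2$, $\overline{\mathbb R^n}=\mathbb R^n\cup\{\infty\}$; closures $\overline{A}$ and boundaries $\partial A$ are taken in $\overline{\mathbb R^n}$. The chordal metric is $h(x,y)=\frac{|x-y|}{\sqrt{1+|x|^2}\sqrt{1+|y|^2}}$ for finite $x,y$ and $h(x,\infty)=\frac1{\sqrt{1+|x|^2}}$. A *domain* is a non-empty connected open set, a *continuum* is a non-empty compact connected set, and maps are continuous. Write $S(y_0,r)=\{y:|y-y_0|=r\}$, $A(y_0,r_1,r_2)=\{y: r_1<|y-y_0|<r_2\}$, $\psi(y)=y/|y|^2$. *Modulus.* For a family $\Gamma$ of curves, $M(\Gamma)=\inf_\rho\int_{\mathbb R^n}\rho^n\,dm$ over Borel $\rho:\mathbb R^n\to[0,\infty]$ with $\int_\gamma\rho\,ds\ge1$ for every rectifiable $\gamma\in\Gamma$. $\Gamma(E,F,D)$ is the family of curves $\gamma:[a,b]\to\overline{\mathbb R^n}$ with $\gamma(a)\in E$, $\gamma(b)\in F$ and $\gamma(t)\in D$ for $a<t<b$. *Weakly flat boundary.* $D$ has weakly flat boundary if for every $x_0\in\partial D$, every $P>0$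 and every neighbourhood $U$ of $x_0$ there is a neighbourhood $V\subset U$ of $x_0$ such that $M(\Gamma(E,F,D))>P$ for all continua $E,F\subset D$ each of which meets both $\partial U$ and $\partial V$. *Finitely connected at the boundary.* For every $y_0\in\partial D'$ every neighbourhood $U$ of $y_0$ contains a neighbourhood $V$ of $y_0$ such that $V\cap D'$ has finitely many connected components. *Inverse Poletsky inequality.* Let $Q:\mathbb R^n\to[0,\infty]$ be Lebesgue measurable with $Q=0$ outside $g(D)$. A map $g:D\to\mathbb R^n$ satisfies the inverse Poletsky inequality (with $Q$) at $y_0\in\overline{g(D)}\setminus\{\infty\}$ if $$M(\Gamma_g(y_0,r_1,r_2))\le\int_{A(y_0,r_1,r_2)\cap g(D)}Q(y)\,\eta^n(|y-y_0|)\,dm(y)$$ for all $0<r_1<r_2<\sup_{y\in g(D)}|y-y_0|$ and all Lebesgue measurable $\eta:(r_1,r_2)\to[0,\infty]$ with $\int_{r_1}^{r_2}\eta(r)\,dr\ge1$, where $\Gamma_g(y_0,r_1,r_2)$ is the family of curves $\gamma$ in $D$ with $g\circ\gamma\in\Gamma(S(y_0,r_1),S(y_0,r_2),A(y_0,r_1,r_2))$.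 At $y_0=\infty$ the inequality means the same inequality at $0$ for $\psi\circ g$ and $Q\circ\psi$. *Conditions on $Q$.* $Q\in FMO(y_0)$, $y_0\in\mathbb R^n$, means that $Q$ is integrable near $y_0$ and the mean over $B(y_0,\varepsilon)$ of $|Q-\overline Q_\varepsilon|$, where $\overline Q_\varepsilon$ is the mean of $Q$ over $B(y_0,\varepsilon)$, has finite upper limit as $\varepsilon\to0$. For $y_0\in\mathbb R^n$ put $q_{y_0}(r)=\frac1{\omega_{n-1}r^{n-1}}\int_{S(y_0,r)}Q\,d\mathcal H^{n-1}$, where $\omega_{n-1}$ is the area of the unit sphere. At $y_0=\infty$ each condition means the same condition at $0$ for $Q\circ\psi$. **Theorem.** Let $D\subset\mathbb R^n$, $n\ge2$, be a domain with weakly flat boundary, and let $D'\subset\mathbb R^n$ be a domain that is finitely connected at its boundary. Let $Q:\mathbb R^n\to[0,\infty]$ be Lebesgue measurable with $Q=0$ outside $D'$. Let $f_m$, $m=1,2,\dots$, be open, discrete and closed maps of $D$ onto $D'$ (closed: images of relatively closed subsets of $D$ are relatively closed in $D'$; discrete: preimages of points consist of isolated points), each satisfying the inverse Poletsky inequality with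 this $Q$ at every $y_0\in\overline{D'}$, and suppose that they converge uniformly in $D$, with respect to $h$ (in particular, it is enough that they converge uniformly in the Euclidean metric), to a map $f:D\to\mathbb R^n$ that is not constant. Assume that one of the following holds: 1. $Q\in FMO(y_0)$ for every $y_0\in\overline{D'}$; 2. for every $y_0\in\overline{D'}$ there is $\delta(y_0)>0$ such that, for all sufficiently small $\varepsilon>0$, $$\int_\varepsilon^{\delta(y_0)}\frac{dt}{t\,q_{y_0}^{1/(n-1)}(t)}<\infty,\qquad \int_0^{\delta(y_0)}\frac{dt}{t\,q_{y_0}^{1/(n-1)}(t)}=\infty .$$ Then $f$ is zero-dimensional in $D$ (no fibre contains a continuum with more than one point), and $f$ is a closed map of $D$ onto $D'$. Moreover, $f$ has a continuous extension $\overline f:\overline D\to\overline{D'}$ with $\overline f(\overline D)=\overline{D'}$, and $\overline f$ is zero-dimensional on $\overline D$. -/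

import Mathlib

open MeasureTheory Set Filter Topology Metric
open scoped ENNReal

noncomputable section

namespace InverseModulus

/-- Euclidean space `ℝⁿ`. -/
abbrev Rn (n : ℕ) : Type := EuclideanSpace ℝ (Fin n)

/-- The extended Euclidean space `ℝⁿ ∪ {∞}` with the topology of the one-point compactification. -/
abbrev RnBar (n : ℕ) : Type := OnePoint (Rn n)

/-- A subset of `ℝⁿ` regarded as a subset of the extended space. -/
def toExt {n : ℕ} (S : Set (Rn n)) : Set (RnBar n) := (fun x : Rn n => (x : RnBar n)) '' S

/-- The closure of a subset of `ℝⁿ`, taken in the extended space. -/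
def extClosure {n : ℕ} (S : Set (Rn n)) : Set (RnBar n) := closure (toExt S)

/-- The boundary of a subset of `ℝⁿ`, taken in the extended space. -/
def extBoundary {n : ℕ} (S : Set (Rn n)) : Set (RnBar n) := frontier (toExt S)

/-- A domain: a non-empty connected open set. -/
def IsDomainSet {n : ℕ} (D : Set (Rn n)) : Prop := IsOpen D ∧ IsConnected D

/-- The chordal distance between two finite points. -/
def chordalDist {n : ℕ} (x y : Rn n) : ℝ :=
  ‖x - y‖ / (Real.sqrt (1 + ‖x‖ ^ 2) * Real.sqrt (1 + ‖y‖ ^ 2))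

/-- Uniform convergence on `D` with respect to the chordal distance. -/
def ChordalTendstoUniformlyOn {n : ℕ} (f : ℕ → Rn n → Rn n) (g : Rn n → Rn n)
    (D : Set (Rn n)) : Prop :=
  ∀ ε : ℝ, 0 < ε → ∀ᶠ m in atTop, ∀ x ∈ D, chordalDist (f m x) (g x) < ε

/-- The inversion `y ↦ y / |y|²`. Its value at `0` is irrelevant in everything that follows. -/
def invert {n : ℕ} (y : Rn n) : Rn n := (‖y‖ ^ 2)⁻¹ • y

/-! ### Curves and the modulus of a family of curves -/

/-- A (closed) curve: a continuous map of a segment `[a, b]` into `ℝⁿ`. -/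
structure Curve (n : ℕ) where
  a : ℝ
  b : ℝ
  lt : a < b
  toFun : ℝ → Rn n
  cont : ContinuousOn toFun (Icc a b)

/-- The length of a curve. -/
def Curve.length {n : ℕ} (γ : Curve n) : ℝ≥0∞ := eVariationOn γ.toFun (Icc γ.a γ.b)

/-- A curve is rectifiable when its length is finite. -/
def Curve.Rectifiable {n : ℕ} (γ : Curve n) : Prop := γ.length < ⊤

/-- The integral `∫_γ ρ ds = ∫₀^ℓ ρ(γ⁰(s)) ds` along a rectifiable curve of length `ℓ`, where `γ⁰` is
the parametrization of `γ` by arc length. -/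
def Curve.lineIntegral {n : ℕ} (γ : Curve n) (ρ : Rn n → ℝ≥0∞) : ℝ≥0∞ :=
  ∫⁻ s in Icc (0 : ℝ) γ.length.toReal,
    ρ (naturalParameterization γ.toFun (Icc γ.a γ.b) γ.a s)

/-- Borel functions admissible for a family of curves. -/
def IsAdmissible {n : ℕ} (Γ : Set (Curve n)) (ρ : Rn n → ℝ≥0∞) : Prop :=
  Measurable ρ ∧ ∀ γ ∈ Γ, γ.Rectifiable → 1 ≤ γ.lineIntegral ρ

/-- The (conformal, `n`-) modulus of a family of curves in `ℝⁿ`. -/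
def modulus {n : ℕ} (Γ : Set (Curve n)) : ℝ≥0∞ :=
  ⨅ (ρ : Rn n → ℝ≥0∞) (_ : IsAdmissible Γ ρ), ∫⁻ x, ρ x ^ n

/-- The curves with initial point in `E`, terminal point in `F`, and all other points in `D`. -/
def curvesJoining {n : ℕ} (E F D : Set (Rn n)) : Set (Curve n) :=
  {γ | γ.toFun γ.a ∈ E ∧ γ.toFun γ.b ∈ F ∧ ∀ t ∈ Ioo γ.a γ.b, γ.toFun t ∈ D}

/-- The spherical ring `{y : r₁ < |y - y₀| < r₂}`. -/
def annulus {n : ℕ} (y₀ : Rn n) (r₁ r₂ : ℝ) : Set (Rn n) := {y | r₁ < ‖y - y₀‖ ∧ ‖y - y₀‖ < r₂}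

/-- The curves `γ` in `D` such that `g ∘ γ` joins `S(y₀, r₁)` to `S(y₀, r₂)` in the spherical ring
`A(y₀, r₁, r₂)`. -/
def pulledBackCurves {n : ℕ} (g : Rn n → Rn n) (D : Set (Rn n)) (y₀ : Rn n) (r₁ r₂ : ℝ) :
    Set (Curve n) :=
  {γ | (∀ t ∈ Icc γ.a γ.b, γ.toFun t ∈ D) ∧
    g (γ.toFun γ.a) ∈ sphere y₀ r₁ ∧ g (γ.toFun γ.b) ∈ sphere y₀ r₂ ∧
    ∀ t ∈ Ioo γ.a γ.b, g (γ.toFun t) ∈ annulus y₀ r₁ r₂}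

/-! ### The inverse Poletsky inequality -/

/-- The inverse Poletsky inequality at a finite point `y₀`. The condition
`∃ y ∈ g '' D, r₂ < ‖y - y₀‖` says that `r₂ < sup {|y - y₀| : y ∈ g(D)}`. -/
def InversePoletskyAtFinite {n : ℕ} (g : Rn n → Rn n) (D : Set (Rn n)) (Q : Rn n → ℝ≥0∞)
    (y₀ : Rn n) : Prop :=
  ∀ r₁ r₂ : ℝ, 0 < r₁ → r₁ < r₂ → (∃ y ∈ g '' D, r₂ < ‖y - y₀‖) →
    ∀ η : ℝ → ℝ≥0∞, AEMeasurable η (volume.restrict (Ioo r₁ r₂)) →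
      1 ≤ ∫⁻ r in Ioo r₁ r₂, η r →
        modulus (pulledBackCurves g D y₀ r₁ r₂) ≤
          ∫⁻ y in annulus y₀ r₁ r₂ ∩ g '' D, Q y * η ‖y - y₀‖ ^ n

/-- The inverse Poletsky inequality at a point of the extended space; at `∞` it is the inequality at
`0` for the map followed by the inversion, with `Q` composed with the inversion. -/
def InversePoletskyAt {n : ℕ} (g : Rn n → Rn n) (D : Set (Rn n)) (Q : Rn n → ℝ≥0∞)
    (y₀ : RnBar n) : Prop :=
  (∀ y : Rn n, y₀ = (y : RnBar n) → InversePoletskyAtFinite g D Q y) ∧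
  (y₀ = OnePoint.infty → InversePoletskyAtFinite (invert ∘ g) D (Q ∘ invert) 0)

/-! ### Conditions on `Q` -/

/-- Finite mean oscillation at a finite point. The function is required to be integrable near the
point, so that its means over small balls are finite. -/
def FMOAtFinite {n : ℕ} (φ : Rn n → ℝ≥0∞) (x₀ : Rn n) : Prop :=
  (∃ ε₀ : ℝ, 0 < ε₀ ∧ ∫⁻ x in ball x₀ ε₀, φ x < ⊤) ∧
  limsup (fun ε : ℝ => (∫⁻ x in ball x₀ ε,
    ‖(φ x).toReal - ⨍ z in ball x₀ ε, (φ z).toReal‖ₑ) / volume (ball x₀ ε)) (𝓝[>] 0) < ⊤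

/-- Finite mean oscillation at a point of the extended space (by inversion at `∞`). -/
def FMOAt {n : ℕ} (φ : Rn n → ℝ≥0∞) (x₀ : RnBar n) : Prop :=
  (∀ x : Rn n, x₀ = (x : RnBar n) → FMOAtFinite φ x) ∧
  (x₀ = OnePoint.infty → FMOAtFinite (φ ∘ invert) 0)

/-- The mean `q_{y₀}(r)` of `Q` over the sphere `S(y₀, r)`, that is, `(ω_{n-1} r^{n-1})⁻¹` times the
integral of `Q` with respect to the Hausdorff measure, `ω_{n-1}` being the measure of the unit sphere.
The normalizing constant of the Hausdorff measure cancels. -/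
def sphereMean {n : ℕ} (Q : Rn n → ℝ≥0∞) (y₀ : Rn n) (r : ℝ) : ℝ≥0∞ :=
  (∫⁻ y in sphere y₀ r, Q y ∂(Measure.hausdorffMeasure ((n : ℝ) - 1))) /
    (Measure.hausdorffMeasure ((n : ℝ) - 1) (sphere (0 : Rn n) 1) * ENNReal.ofReal r ^ (n - 1))

/-- The integral `∫_ε^δ dt / (t q_{y₀}(t)^{1/(n-1)})`, with values in `[0, ∞]`. -/
def divergenceIntegral {n : ℕ} (Q : Rn n → ℝ≥0∞) (y₀ : Rn n) (ε δ : ℝ) : ℝ≥0∞ :=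
  ∫⁻ t in Ioo ε δ, (ENNReal.ofReal t * sphereMean Q y₀ t ^ (1 / ((n : ℝ) - 1)))⁻¹

/-- The divergence condition at a finite point. -/
def DivergenceAtFinite {n : ℕ} (Q : Rn n → ℝ≥0∞) (y₀ : Rn n) : Prop :=
  ∃ δ : ℝ, 0 < δ ∧ (∀ᶠ ε in 𝓝[>] (0 : ℝ), divergenceIntegral Q y₀ ε δ < ⊤) ∧
    divergenceIntegral Q y₀ 0 δ = ⊤

/-- The divergence condition at a point of the extended space (by inversion at `∞`). -/
def DivergenceAt {n : ℕ} (Q : Rn n → ℝ≥0∞) (y₀ : RnBar n) : Prop :=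
  (∀ y : Rn n, y₀ = (y : RnBar n) → DivergenceAtFinite Q y) ∧
  (y₀ = OnePoint.infty → DivergenceAtFinite (Q ∘ invert) 0)

/-! ### Boundary conditions on domains -/

/-- `D` is finitely connected at its boundary: every boundary point has arbitrarily small
neighbourhoods `V` such that `V ∩ D` has finitely many connected components. -/
def FinitelyConnectedAtBoundary {n : ℕ} (D : Set (Rn n)) : Prop :=
  ∀ x₀ ∈ extBoundary D, ∀ U ∈ 𝓝 x₀, ∃ V ∈ 𝓝 x₀, V ⊆ U ∧
    Finite (ConnectedComponents (V ∩ toExt D : Set (RnBar n)))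

/-- A continuum: a non-empty compact connected set. -/
def IsContinuumSet {X : Type*} [TopologicalSpace X] (K : Set X) : Prop :=
  IsCompact K ∧ IsConnected K

/-- `D` has weakly flat boundary. -/
def WeaklyFlatBoundary {n : ℕ} (D : Set (Rn n)) : Prop :=
  ∀ x₀ ∈ extBoundary D, ∀ P : ℝ, 0 < P → ∀ U ∈ 𝓝 x₀, ∃ V ∈ 𝓝 x₀, V ⊆ U ∧
    ∀ E F : Set (Rn n), IsContinuumSet E → IsContinuumSet F → E ⊆ D → F ⊆ D →
      (toExt E ∩ frontier U).Nonempty → (toExt E ∩ frontier V).Nonempty →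
      (toExt F ∩ frontier U).Nonempty → (toExt F ∩ frontier V).Nonempty →
        ENNReal.ofReal P < modulus (curvesJoining E F D)

/-! ### Classes of maps -/

/-- Open maps of an open set `D`. -/
def IsOpenOn {n : ℕ} (f : Rn n → Rn n) (D : Set (Rn n)) : Prop :=
  ∀ U ⊆ D, IsOpen U → IsOpen (f '' U)

/-- Discrete maps: the preimage in `D` of every point consists of isolated points. -/
def IsDiscreteOn {n : ℕ} (f : Rn n → Rn n) (D : Set (Rn n)) : Prop :=
  ∀ y : Rn n, DiscreteTopology (D ∩ f ⁻¹' {y} : Set (Rn n))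

/-- Closed maps of `D` onto `D'`: the image of every relatively closed subset of `D` is relatively
closed in `D'`. -/
def IsClosedOnto {n : ℕ} (f : Rn n → Rn n) (D D' : Set (Rn n)) : Prop :=
  f '' D = D' ∧
    ∀ C : Set (Rn n), IsClosed C → ∃ C' : Set (Rn n), IsClosed C' ∧ f '' (D ∩ C) = D' ∩ C'

/-- Zero-dimensional (light) maps of `S`: no fibre contains a continuum other than a point. -/
def IsLightOn {X Y : Type*} [TopologicalSpace X] (f : X → Y) (S : Set X) : Prop :=
  ∀ y : Y, ∀ K : Set X, IsContinuumSet K → K ⊆ S ∩ f ⁻¹' {y} → K.Subsingleton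

end InverseModulus

end

namespace InverseModulus

/-! ### Arc length and line integrals -/

/-! The theorem comes from playing two estimates of the modulus of curve families against each
other.

Upper bound. Under either condition on `Q` there are, on arbitrarily thin-centred rings about a
point `y₀` of the closure of `D'`, weights of integral at least one whose `Q`-weighted integrals are
as small as desired (`RingIntegralsVanish`). The inverse Poletsky inequality then makes the family
of curves joining `E` to `F` in `D` small whenever `E` is mapped very near `y₀` and `F` stays away
from it. The required nearness depends on `Q` and not on the map, so uniform convergence transfers
the estimate from one `fm m` to `f` (`IsPoletskyLimit.exists_nhds_modulus_le`).

Lower bound. Inside a ball contained in `D`, the curves joining a path of definite size issuing from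
the centre to a set of definite volume have modulus bounded below (`exists_modulus_lower_bound`, a
potential estimate). At the boundary of `D`, weak flatness makes the modulus large for two continua
that both come close to the boundary point and both leave a fixed neighbourhood.

Consequences. Connected open sets through `x₀` that are mapped near `f x₀` must be small unless `f`
is constant near `x₀`. Hence a nondegenerate continuum in a fibre forces local constancy, which
spreads over `D`; thus `f` is light. If `f x₀` were a boundary point of `D'`, finite connectedness
and properness of `fm m` would yield a connected set through `x₀`, mapped near `f x₀`, that is not
relatively compact in `D` (`exists_isPreconnected`); but such sets are small. So `f` maps into `D'`;
it inherits properness from the `fm m`, and surjectivity and closedness follow.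

At a boundary point of `D`, two distinct cluster values would give two continua coming near the
point and reaching a fixed compact set, with images far apart: weak flatness and the upper bound
contradict each other, so the limit exists. The same clash, with local connectedness of `D` at its
boundary (also a consequence of weak flatness), excludes a boundary continuum in a fibre of the
extension. -/

/-- The variation of a continuous function of bounded variation is a continuous function of the
end point. -/
theorem continuousOn_variationOnFromTo {E : Type*} [PseudoMetricSpace E] {f : ℝ → E} {s : Set ℝ}
    (hbv : BoundedVariationOn f s) (hf : ContinuousOn f s) {a : ℝ} (ha : a ∈ s) :
    ContinuousOn (variationOnFromTo f s a) s := by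
  intro x hx
  have hloc := hbv.locallyBoundedVariationOn
  -- By additivity the base point may be moved to `x` itself; there the claim is that the variation
  -- over short intervals on either side of `x` tends to zero.
  have key : ContinuousWithinAt (variationOnFromTo f s x) s x := by
    have h1 := hbv.tendsto_eVariationOn_Icc_zero_left (x := x)
      ((hf x hx).mono inter_subset_left)
    have h2 := hbv.tendsto_eVariationOn_Icc_zero_right x
      ((hf x hx).mono inter_subset_left)
    have h3 := (ENNReal.tendsto_toReal ENNReal.zero_ne_top).comp (h1.add h2 |>.trans
      (by rw [add_zero]))
    rw [ContinuousWithinAt, variationOnFromTo.self]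
    refine squeeze_zero_norm (fun y => ?_) h3
    have hfin : ∀ t ⊆ s, eVariationOn f t ≠ ⊤ := fun t ht => hbv.mono ht
    simp only [Function.comp, Real.norm_eq_abs]
    rw [ENNReal.toReal_add (hfin _ inter_subset_left) (hfin _ inter_subset_left)]
    rcases le_total x y with h | h
    · rw [variationOnFromTo.eq_of_le f s h, abs_of_nonneg ENNReal.toReal_nonneg]
      exact le_add_of_nonneg_left ENNReal.toReal_nonneg
    · rw [variationOnFromTo.eq_of_ge f s h, abs_neg, abs_of_nonneg ENNReal.toReal_nonneg]
      exact le_add_of_nonneg_right ENNReal.toReal_nonneg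
  have : ContinuousWithinAt (fun y => variationOnFromTo f s a x + variationOnFromTo f s x y) s x :=
    continuousWithinAt_const.add key
  exact this.congr (fun y hy => (variationOnFromTo.add hloc ha hx hy).symm)
    (variationOnFromTo.add hloc ha hx hx).symm

variable {n : ℕ}

/-- Every value of the arc length parameter is attained. -/
theorem Curve.exists_variation_eq (γ : Curve n) (hγ : γ.Rectifiable) {s : ℝ}
    (hs : s ∈ Icc 0 γ.length.toReal) :
    ∃ t ∈ Icc γ.a γ.b, variationOnFromTo γ.toFun (Icc γ.a γ.b) γ.a t = s := by
  have hbv : BoundedVariationOn γ.toFun (Icc γ.a γ.b) := ne_of_lt hγ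
  have ha : γ.a ∈ Icc γ.a γ.b := left_mem_Icc.2 γ.lt.le
  have hc := continuousOn_variationOnFromTo hbv γ.cont ha
  have := intermediate_value_Icc γ.lt.le hc
  rw [variationOnFromTo.self, variationOnFromTo.eq_of_le _ _ γ.lt.le, inter_self] at this
  exact this hs

theorem Curve.naturalParameterization_variation (γ : Curve n) (hγ : γ.Rectifiable) {t : ℝ}
    (ht : t ∈ Icc γ.a γ.b) :
    naturalParameterization γ.toFun (Icc γ.a γ.b) γ.a
      (variationOnFromTo γ.toFun (Icc γ.a γ.b) γ.a t) = γ.toFun t := by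
  have hbv : BoundedVariationOn γ.toFun (Icc γ.a γ.b) := ne_of_lt hγ
  exact edist_eq_zero.1 (edist_naturalParameterization_eq_zero hbv.locallyBoundedVariationOn
    (left_mem_Icc.2 γ.lt.le) ht)

/-- The restriction of a curve to a smaller segment. -/
noncomputable def Curve.sub (γ : Curve n) (a b : ℝ) (hab : a < b) (ha : γ.a ≤ a) (hb : b ≤ γ.b) :
    Curve n where
  a := a
  b := b
  lt := hab
  toFun := γ.toFun
  cont := γ.cont.mono (Icc_subset_Icc ha hb)

theorem Curve.sub_rectifiable {γ : Curve n} (hγ : γ.Rectifiable) {a b : ℝ} (hab : a < b)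
    (ha : γ.a ≤ a) (hb : b ≤ γ.b) : (γ.sub a b hab ha hb).Rectifiable :=
  (eVariationOn.mono _ (Icc_subset_Icc ha hb)).trans_lt hγ

/-- The arc length parametrization of the subcurve is that of `γ` shifted by the length `c` of the
part of `γ` before `a`, so its integral is taken over a subinterval of the parameter interval of
`γ`. -/
theorem Curve.lineIntegral_sub_le {γ : Curve n} (hγ : γ.Rectifiable) {a b : ℝ} (hab : a < b)
    (ha : γ.a ≤ a) (hb : b ≤ γ.b) (ρ : Rn n → ℝ≥0∞) :
    (γ.sub a b hab ha hb).lineIntegral ρ ≤ γ.lineIntegral ρ := by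
  set γ' := γ.sub a b hab ha hb with hγ'
  have hsub := Curve.sub_rectifiable hγ hab ha hb
  have hbv : BoundedVariationOn γ.toFun (Icc γ.a γ.b) := ne_of_lt hγ
  have hloc := hbv.locallyBoundedVariationOn
  have hmem : ∀ t ∈ Icc a b, t ∈ Icc γ.a γ.b := fun t ht => ⟨ha.trans ht.1, ht.2.trans hb⟩
  have hA : γ.a ∈ Icc γ.a γ.b := left_mem_Icc.2 γ.lt.le
  have ha' : a ∈ Icc a b := left_mem_Icc.2 hab.le
  have hb' : b ∈ Icc a b := right_mem_Icc.2 hab.le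
  set c := variationOnFromTo γ.toFun (Icc γ.a γ.b) γ.a a with hc
  have hc0 : 0 ≤ c := variationOnFromTo.nonneg_of_le _ _ ha
  have hvar : ∀ t ∈ Icc a b, variationOnFromTo γ.toFun (Icc a b) a t =
      variationOnFromTo γ.toFun (Icc γ.a γ.b) a t := by
    intro t ht
    rw [variationOnFromTo.eq_of_le _ _ ht.1, variationOnFromTo.eq_of_le _ _ ht.1]
    congr 2
    ext u
    constructor
    · rintro ⟨h1, h2⟩; exact ⟨hmem u h1, h2⟩
    · rintro ⟨h1, h2⟩; exact ⟨⟨h2.1, h2.2.trans ht.2⟩, h2⟩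
  have hlen : c + γ'.length.toReal ≤ γ.length.toReal := by
    have e1 : γ'.length.toReal = variationOnFromTo γ.toFun (Icc γ.a γ.b) a b := by
      rw [← hvar b hb', variationOnFromTo.eq_of_le _ _ hab.le, inter_self]; rfl
    have e2 : γ.length.toReal = variationOnFromTo γ.toFun (Icc γ.a γ.b) γ.a γ.b := by
      rw [variationOnFromTo.eq_of_le _ _ γ.lt.le, inter_self]; rfl
    rw [e1, e2, variationOnFromTo.add hloc hA (hmem a ha') (hmem b hb')]
    exact variationOnFromTo.monotoneOn hloc hA (hmem b hb') (right_mem_Icc.2 γ.lt.le) hb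
  have hnat : ∀ s ∈ Icc 0 γ'.length.toReal,
      naturalParameterization γ'.toFun (Icc γ'.a γ'.b) γ'.a s =
        naturalParameterization γ.toFun (Icc γ.a γ.b) γ.a (s + c) := by
    intro s hs
    obtain ⟨t, ht, rfl⟩ := γ'.exists_variation_eq hsub hs
    rw [γ'.naturalParameterization_variation hsub ht]
    have : variationOnFromTo γ'.toFun (Icc γ'.a γ'.b) γ'.a t + c =
        variationOnFromTo γ.toFun (Icc γ.a γ.b) γ.a t := by
      rw [← variationOnFromTo.add hloc hA (hmem a ha') (hmem t ht), ← hvar t ht, add_comm]; rfl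
    rw [this, γ.naturalParameterization_variation hγ (hmem t ht)]; rfl
  calc γ'.lineIntegral ρ = ∫⁻ s in Icc (0 : ℝ) γ'.length.toReal,
        ρ (naturalParameterization γ.toFun (Icc γ.a γ.b) γ.a (s + c)) :=
        setLIntegral_congr_fun measurableSet_Icc fun s hs => by rw [hnat s hs]
    _ = ∫⁻ s in (fun s => s + c) ⁻¹' Icc c (c + γ'.length.toReal),
        ρ (naturalParameterization γ.toFun (Icc γ.a γ.b) γ.a (s + c)) := by
        congr 2
        ext s
        simp only [mem_Icc, mem_preimage]
        constructor <;> rintro ⟨h1, h2⟩ <;> constructor <;> linarith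
    _ = ∫⁻ s in Icc c (c + γ'.length.toReal),
        ρ (naturalParameterization γ.toFun (Icc γ.a γ.b) γ.a s) :=
        (measurePreserving_add_right volume c).setLIntegral_comp_preimage_emb
          (measurableEmbedding_addRight c)
          (fun s => ρ (naturalParameterization γ.toFun (Icc γ.a γ.b) γ.a s)) _
    _ ≤ _ := lintegral_mono_set (Icc_subset_Icc hc0 hlen)

/-- If every curve of `Γ` has a subcurve in `Γ'`, the modulus of `Γ` does not exceed that
of `Γ'`. -/
theorem modulus_le_of_subcurves {Γ Γ' : Set (Curve n)}
    (h : ∀ γ ∈ Γ, ∃ (a b : ℝ) (hab : a < b) (ha : γ.a ≤ a) (hb : b ≤ γ.b),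
      γ.sub a b hab ha hb ∈ Γ') : modulus Γ ≤ modulus Γ' := by
  refine le_iInf₂ fun ρ hρ => iInf₂_le ρ ⟨hρ.1, fun γ hγ hrec => ?_⟩
  obtain ⟨a, b, hab, ha, hb, hmem⟩ := h γ hγ
  exact (hρ.2 _ hmem (Curve.sub_rectifiable hrec hab ha hb)).trans
    (Curve.lineIntegral_sub_le hrec hab ha hb ρ)

/-- A continuous function passing from below `α` to above `β` crosses the interval `(α, β)`. -/
theorem exists_crossing {φ : ℝ → ℝ} {a b α β : ℝ} (hab : a ≤ b) (hφ : ContinuousOn φ (Icc a b))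
    (hαβ : α < β) (ha : φ a ≤ α) (hb : β ≤ φ b) :
    ∃ a' b', a' < b' ∧ a ≤ a' ∧ b' ≤ b ∧ φ a' = α ∧ φ b' = β ∧ ∀ t ∈ Ioo a' b', φ t ∈ Ioo α β := by
  -- `b'` is the first time at which `β` is reached, and `a'` the last time before `b'` at which `φ`
  -- is at most `α`.
  have hS : IsCompact {t ∈ Icc a b | β ≤ φ t} := by
    have := hφ.preimage_isClosed_of_isClosed isClosed_Icc (isClosed_Ici (a := β))
    exact isCompact_Icc.of_isClosed_subset this inter_subset_left
  obtain ⟨b', ⟨hb'm, hb'β⟩, hb'min⟩ := hS.exists_isLeast ⟨b, right_mem_Icc.2 hab, hb⟩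
  have hb'lt : ∀ t ∈ Icc a b, t < b' → φ t < β := fun t ht htb => by
    by_contra hcon
    exact absurd (hb'min ⟨ht, not_lt.1 hcon⟩) (not_le.2 htb)
  have hφ' : ContinuousOn φ (Icc a b') := hφ.mono (Icc_subset_Icc_right hb'm.2)
  have hφb' : φ b' = β := by
    have := intermediate_value_Icc hb'm.1 hφ' ⟨ha.trans hαβ.le, hb'β⟩
    obtain ⟨t, ht, hte⟩ := this
    rcases ht.2.lt_or_eq with hlt | heq
    · exact absurd hte (hb'lt t ⟨ht.1, ht.2.trans hb'm.2⟩ hlt).ne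
    · rw [← heq, hte]
  have hT : IsCompact {t ∈ Icc a b' | φ t ≤ α} := by
    have := hφ'.preimage_isClosed_of_isClosed isClosed_Icc (isClosed_Iic (a := α))
    exact isCompact_Icc.of_isClosed_subset this inter_subset_left
  obtain ⟨a', ⟨ha'm, ha'α⟩, ha'max⟩ := hT.exists_isGreatest ⟨a, left_mem_Icc.2 hb'm.1, ha⟩
  have ha'gt : ∀ t ∈ Icc a b', a' < t → α < φ t := fun t ht htb => by
    by_contra hcon
    exact absurd (ha'max ⟨ht, not_lt.1 hcon⟩) (not_le.2 htb)
  have hlt : a' < b' := by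
    rcases ha'm.2.lt_or_eq with h | h
    · exact h
    · rw [h, hφb'] at ha'α; linarith
  have hφa' : φ a' = α := by
    obtain ⟨t, ht, hte⟩ := intermediate_value_Icc hlt.le
      (hφ'.mono (Icc_subset_Icc_left ha'm.1)) ⟨ha'α, hφb'.symm ▸ hαβ.le⟩
    rcases ht.1.lt_or_eq with h | h
    · exact absurd hte (ha'gt t ⟨ha'm.1.trans ht.1, ht.2⟩ h).ne'
    · rw [h, hte]
  refine ⟨a', b', hlt, ha'm.1, hb'm.2, hφa', hφb', fun t ht => ⟨?_, ?_⟩⟩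
  · exact ha'gt t ⟨ha'm.1.trans ht.1.le, ht.2.le⟩ ht.1
  · exact hb'lt t ⟨ha'm.1.trans ht.1.le, ht.2.le.trans hb'm.2⟩ ht.2

theorem Curve.dist_le_length (γ : Curve n) (hγ : γ.Rectifiable) :
    dist (γ.toFun γ.a) (γ.toFun γ.b) ≤ γ.length.toReal := by
  have := eVariationOn.edist_le γ.toFun (left_mem_Icc.2 γ.lt.le) (right_mem_Icc.2 γ.lt.le)
  rw [dist_edist]
  exact ENNReal.toReal_mono hγ.ne this

/-- The modulus of a family of curves of large length in a bounded set is finite. -/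
theorem modulus_le_of_length {Γ : Set (Curve n)} {S : Set (Rn n)} (hS : MeasurableSet S) {d : ℝ}
    (hd : 0 < d) (hsub : ∀ γ ∈ Γ, ∀ t ∈ Icc γ.a γ.b, γ.toFun t ∈ S)
    (hdist : ∀ γ ∈ Γ, d ≤ dist (γ.toFun γ.a) (γ.toFun γ.b)) :
    modulus Γ ≤ ∫⁻ x, S.indicator (fun _ => (ENNReal.ofReal d)⁻¹) x ^ n := by
  refine iInf₂_le (S.indicator fun _ => (ENNReal.ofReal d)⁻¹)
    ⟨measurable_const.indicator hS, fun γ hγ hrec => ?_⟩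
  have h1 : γ.lineIntegral (S.indicator fun _ => (ENNReal.ofReal d)⁻¹) =
      ∫⁻ _ in Icc (0 : ℝ) γ.length.toReal, (ENNReal.ofReal d)⁻¹ := by
    refine setLIntegral_congr_fun measurableSet_Icc fun s hs => ?_
    obtain ⟨t, ht, rfl⟩ := γ.exists_variation_eq hrec hs
    rw [γ.naturalParameterization_variation hrec ht, indicator_of_mem (hsub γ hγ t ht)]
  rw [h1, setLIntegral_const, Real.volume_Icc, sub_zero, mul_comm, ← div_eq_mul_inv,
    ENNReal.le_div_iff_mul_le (.inl (by simpa using hd)) (.inl ENNReal.ofReal_ne_top), one_mul]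
  exact ENNReal.ofReal_le_ofReal ((hdist γ hγ).trans (γ.dist_le_length hrec))

/-- A segment as a curve parametrized by arc length. -/
noncomputable def segmentCurve (x u : Rn n) (L : ℝ) (hL : 0 < L) : Curve n where
  a := 0
  b := L
  lt := hL
  toFun := fun t => x + t • u
  cont := by fun_prop

theorem eVariationOn_segment (x : Rn n) {u : Rn n} (hu : ‖u‖ = 1) {a b : ℝ} (hab : a ≤ b) :
    eVariationOn (fun t : ℝ => x + t • u) (Icc a b) = ENNReal.ofReal (b - a) := by
  have hiso : Isometry (fun t : ℝ => x + t • u) := by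
    refine Isometry.of_dist_eq fun s t => ?_
    rw [dist_eq_norm, add_sub_add_left_eq_sub, ← sub_smul, norm_smul, hu, mul_one, Real.dist_eq,
      Real.norm_eq_abs]
  have h1 : eVariationOn (fun t : ℝ => x + t • u) (Icc a b) = eVariationOn (id : ℝ → ℝ) (Icc a b) := by
    simp only [eVariationOn, hiso.edist_eq, id]
  rw [h1]
  have h2 := (monotoneOn_id (s := Icc a b)).eVariationOn_eq (left_mem_Icc.2 hab)
    (right_mem_Icc.2 hab)
  rw [inter_self] at h2
  rw [h2, id, id]

theorem segmentCurve_rectifiable (x : Rn n) {u : Rn n} (hu : ‖u‖ = 1) {L : ℝ} (hL : 0 < L) :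
    (segmentCurve x u L hL).Rectifiable := by
  have : (segmentCurve x u L hL).length = ENNReal.ofReal (L - 0) :=
    eVariationOn_segment x hu hL.le
  rw [Curve.Rectifiable, this]
  exact ENNReal.ofReal_lt_top

theorem segmentCurve_lineIntegral (x : Rn n) {u : Rn n} (hu : ‖u‖ = 1) {L : ℝ} (hL : 0 < L)
    (ρ : Rn n → ℝ≥0∞) :
    (segmentCurve x u L hL).lineIntegral ρ = ∫⁻ s in Icc (0 : ℝ) L, ρ (x + s • u) := by
  have hlen : (segmentCurve x u L hL).length = ENNReal.ofReal (L - 0) :=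
    eVariationOn_segment x hu hL.le
  rw [Curve.lineIntegral, hlen, sub_zero, ENNReal.toReal_ofReal hL.le]
  refine setLIntegral_congr_fun measurableSet_Icc fun s hs => ?_
  have h := (segmentCurve x u L hL).naturalParameterization_variation
    (segmentCurve_rectifiable x hu hL) (t := s) hs
  have hv : variationOnFromTo (segmentCurve x u L hL).toFun
      (Icc (segmentCurve x u L hL).a (segmentCurve x u L hL).b) (segmentCurve x u L hL).a s = s := by
    rw [variationOnFromTo.eq_of_le (segmentCurve x u L hL).toFun _ (a := (segmentCurve x u L hL).a) hs.1]
    have : Icc (segmentCurve x u L hL).a (segmentCurve x u L hL).b ∩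
      Icc (segmentCurve x u L hL).a s = Icc 0 s := by
      show Icc 0 L ∩ Icc 0 s = Icc 0 s
      exact inter_eq_right.2 (Icc_subset_Icc_right hs.2)
    rw [this]
    have := eVariationOn_segment x hu hs.1
    rw [sub_zero] at this
    show (eVariationOn (fun t : ℝ => x + t • u) (Icc 0 s)).toReal = s
    rw [this, ENNReal.toReal_ofReal hs.1]
  rw [hv] at h
  rw [h]; rfl

/-! ### Polar coordinates and singular integrals -/

theorem nontrivial_Rn {n : ℕ} (hn : 2 ≤ n) : Nontrivial (Rn n) := by
  have : Nonempty (Fin n) := ⟨⟨0, by omega⟩⟩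
  infer_instance

/-- Integration in polar coordinates. -/
theorem lintegral_polar {n : ℕ} (hn : 2 ≤ n) {g : Rn n → ℝ≥0∞} (hg : Measurable g) :
    ∫⁻ w, g w = ∫⁻ u : sphere (0 : Rn n) 1, ∫⁻ r in Ioi (0 : ℝ),
      ENNReal.ofReal (r ^ (n - 1)) * g (r • (u : Rn n)) ∂volume
        ∂(volume : Measure (Rn n)).toSphere := by
  have := nontrivial_Rn hn
  have hmp := (volume : Measure (Rn n)).measurePreserving_homeomorphUnitSphereProd
  have h1 := (hmp.symm (homeomorphUnitSphereProd (Rn n)).toMeasurableEquiv).lintegral_comp_emb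
    (MeasurableEquiv.measurableEmbedding _) (fun x : ({0}ᶜ : Set (Rn n)) => g x)
  rw [lintegral_subtype_comap (measurableSet_singleton _).compl, restrict_compl_singleton] at h1
  rw [← h1, finrank_euclideanSpace_fin]
  have hsymm : ∀ a : sphere (0 : Rn n) 1 × Ioi (0 : ℝ),
      (((homeomorphUnitSphereProd (Rn n)).toMeasurableEquiv.symm a : ({0}ᶜ : Set (Rn n))) : Rn n)
        = (a.2 : ℝ) • (a.1 : Rn n) :=
    fun a => homeomorphUnitSphereProd_symm_apply_coe (Rn n) a
  simp only [hsymm]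
  have hmeas : Measurable fun a : sphere (0 : Rn n) 1 × Ioi (0 : ℝ) =>
      g ((a.2 : ℝ) • (a.1 : Rn n)) := hg.comp (by fun_prop)
  rw [lintegral_prod _ hmeas.aemeasurable]
  refine lintegral_congr fun u => ?_
  have hmeas' : Measurable fun r : Ioi (0 : ℝ) => g ((r : ℝ) • (u : Rn n)) :=
    hg.comp (by fun_prop)
  rw [Measure.volumeIoiPow, lintegral_withDensity_eq_lintegral_mul _ (by fun_prop) hmeas']
  exact lintegral_subtype_comap measurableSet_Ioi
    (fun r => ENNReal.ofReal (r ^ (n - 1)) * g (r • (u : Rn n)))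

/-- Local integrability of powers of the norm. -/
theorem lintegral_enorm_rpow_lt_top {E : Type*} [NormedAddCommGroup E] [NormedSpace ℝ E]
    [MeasurableSpace E] [BorelSpace E] [FiniteDimensional ℝ E] [Nontrivial E] (μ : Measure E)
    [μ.IsAddHaarMeasure] {p R : ℝ} (hR : 0 < R) (hp : -(Module.finrank ℝ E : ℝ) < p) :
    ∫⁻ z in ball (0 : E) R, ‖z‖ₑ ^ p ∂μ < ⊤ := by
  have hd : 1 ≤ Module.finrank ℝ E := Module.finrank_pos
  have h1 : IntegrableOn (fun z : E => ‖z‖ ^ p) (ball 0 R) μ := by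
    rw [integrableOn_fun_norm_addHaar μ (f := fun y : ℝ => y ^ p)]
    have : IntegrableOn (fun y : ℝ => y ^ (Module.finrank ℝ E - 1 + p : ℝ)) (Ioo 0 R) :=
      (intervalIntegral.integrableOn_Ioo_rpow_iff hR).2 (by linarith)
    refine this.congr_fun (fun y hy => ?_) measurableSet_Ioo
    simp only [smul_eq_mul]
    rw [Real.rpow_add hy.1, ← Nat.cast_one, ← Nat.cast_sub hd, Real.rpow_natCast]
  have h2 := (hasFiniteIntegral_iff_ofReal
    (ae_of_all _ fun z => Real.rpow_nonneg (norm_nonneg z) p)).1 h1.2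
  refine lt_of_le_of_lt (lintegral_mono_ae ?_) h2
  have h0 : ∀ᵐ z ∂(μ.restrict (ball (0 : E) R)), z ≠ 0 :=
    ae_restrict_of_ae (Measure.ae_ne μ 0)
  filter_upwards [h0] with z hz
  rw [← ofReal_norm, ENNReal.ofReal_rpow_of_pos (norm_pos_iff.2 hz)]

/-! ### A lower bound for the modulus of curves joining a path to a fat set -/

/-- Estimate of the volume of a set by the potential of a function whose integrals along the
segments from a point to this set are at least one. -/
theorem volume_le_potential (hn : 2 ≤ n) {R : ℝ} (hR : 0 < R) {ρ : Rn n → ℝ≥0∞}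
    (hρ : Measurable ρ) {F : Set (Rn n)} (hF : MeasurableSet F) {k : Rn n}
    (hseg : ∀ (u : Rn n) (r : ℝ), ‖u‖ = 1 → 0 < r → k + r • u ∈ F →
      r < R ∧ 1 ≤ ∫⁻ s in Ioo 0 r, ρ (k + s • u)) :
    volume F ≤ ENNReal.ofReal (R ^ n) *
      ∫⁻ w in ball k R, ρ w * ‖w - k‖ₑ ^ (1 - n : ℝ) := by
  have := nontrivial_Rn hn
  -- `I u` is the integral of `ρ` along the whole ray of length `R`. It is at least one in every
  -- direction in which the ray meets `F`, so in polar coordinates the volume of `F` is at most `Rⁿ`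
  -- times the integral of `I`.
  set I : sphere (0 : Rn n) 1 → ℝ≥0∞ := fun u => ∫⁻ s in Ioo 0 R, ρ (k + s • (u : Rn n)) with hI
  have hvol : volume F = ∫⁻ z : Rn n, F.indicator 1 (k + z) := by
    rw [lintegral_add_left_eq_self (μ := (volume : Measure (Rn n))) (F.indicator 1) k,
      lintegral_indicator_one hF]
  have hmF : Measurable fun z : Rn n => F.indicator (1 : Rn n → ℝ≥0∞) (k + z) :=
    (measurable_one.indicator hF).comp (measurable_const_add k)
  have hle : volume F ≤ ENNReal.ofReal (R ^ n) *
      ∫⁻ u, I u ∂(volume : Measure (Rn n)).toSphere := by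
    rw [hvol, lintegral_polar hn hmF, ← lintegral_const_mul' _ _ ENNReal.ofReal_ne_top]
    refine lintegral_mono fun u => ?_
    have hu : ‖(u : Rn n)‖ = 1 := by simp
    have hpt : ∀ r ∈ Ioi (0 : ℝ), ENNReal.ofReal (r ^ (n - 1)) * F.indicator 1 (k + r • (u : Rn n))
        ≤ (Ioo 0 R).indicator (fun _ => ENNReal.ofReal (R ^ (n - 1)) * I u) r := by
      intro r hr
      by_cases hmem : k + r • (u : Rn n) ∈ F
      · obtain ⟨h1, h2⟩ := hseg u r hu hr hmem
        rw [indicator_of_mem hmem, indicator_of_mem (show r ∈ Ioo 0 R from ⟨hr, h1⟩)]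
        refine mul_le_mul' (ENNReal.ofReal_le_ofReal ?_) (h2.trans ?_)
        · exact pow_le_pow_left₀ (le_of_lt hr) h1.le _
        · exact lintegral_mono_set (Ioo_subset_Ioo_right h1.le)
      · rw [indicator_of_notMem hmem, mul_zero]; exact zero_le
    calc _ ≤ ∫⁻ r in Ioi (0 : ℝ), (Ioo 0 R).indicator
          (fun _ => ENNReal.ofReal (R ^ (n - 1)) * I u) r := setLIntegral_mono' measurableSet_Ioi hpt
      _ ≤ ∫⁻ r, (Ioo 0 R).indicator (fun _ => ENNReal.ofReal (R ^ (n - 1)) * I u) r :=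
          setLIntegral_le_lintegral _ _
      _ = ENNReal.ofReal (R ^ n) * I u := by
          rw [lintegral_indicator measurableSet_Ioo, setLIntegral_const, Real.volume_Ioo, sub_zero,
            mul_right_comm, ← ENNReal.ofReal_mul (by positivity), ← pow_succ,
            Nat.sub_add_cancel (by omega)]
  refine hle.trans (mul_le_mul' le_rfl (le_of_eq ?_))
  have hg : Measurable fun z : Rn n => (ball (0 : Rn n) R).indicator
      (fun z => ρ (k + z) * ‖z‖ₑ ^ (1 - n : ℝ)) z := by
    refine Measurable.indicator ?_ measurableSet_ball
    exact (hρ.comp (measurable_const_add k)).mul (measurable_enorm.pow_const _)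
  have h1 : ∫⁻ w in ball k R, ρ w * ‖w - k‖ₑ ^ (1 - n : ℝ) =
      ∫⁻ z : Rn n, (ball (0 : Rn n) R).indicator
        (fun z => ρ (k + z) * ‖z‖ₑ ^ (1 - n : ℝ)) z := by
    rw [← lintegral_indicator measurableSet_ball,
      ← lintegral_add_left_eq_self (μ := (volume : Measure (Rn n))) _ k]
    refine lintegral_congr fun z => ?_
    by_cases hz : z ∈ ball (0 : Rn n) R
    · rw [indicator_of_mem hz, indicator_of_mem (by simpa using hz), add_sub_cancel_left]
    · rw [indicator_of_notMem hz, indicator_of_notMem (by simpa using hz)]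
  -- In polar coordinates about `k` the Jacobian `r ^ (n - 1)` cancels the kernel `‖w - k‖ ^ (1 -
  -- n)`, which turns the potential into the integral of `I`.
  rw [h1, lintegral_polar hn hg]
  refine lintegral_congr fun u => ?_
  have hu : ‖(u : Rn n)‖ = 1 := by simp
  have : I u = ∫⁻ r in Ioi (0 : ℝ), (Ioo 0 R).indicator (fun s => ρ (k + s • (u : Rn n))) r := by
    rw [setLIntegral_indicator measurableSet_Ioo]
    rw [inter_eq_left.2 (Ioo_subset_Ioi_self)]
  rw [this]
  refine setLIntegral_congr_fun measurableSet_Ioi fun r (hr : 0 < r) => ?_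
  have hnorm : ‖r • (u : Rn n)‖ = r := by rw [norm_smul, hu, mul_one, Real.norm_of_nonneg hr.le]
  by_cases hrR : r < R
  · rw [indicator_of_mem (show r ∈ Ioo 0 R from ⟨hr, hrR⟩),
      indicator_of_mem (by simpa [hnorm] using hrR), mul_left_comm, ← ofReal_norm, hnorm,
      ENNReal.ofReal_rpow_of_pos hr, ← ENNReal.ofReal_mul (by positivity)]
    have : r ^ (n - 1) * r ^ (1 - n : ℝ) = 1 := by
      rw [← Real.rpow_natCast, ← Real.rpow_add hr, Nat.cast_sub (by omega)]
      simp
    rw [this, ENNReal.ofReal_one, mul_one]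
  · rw [indicator_of_notMem (fun h => hrR h.2), indicator_of_notMem (by simpa [hnorm] using hrR),
      mul_zero]

/-- The first times at which a path starting at `x₀` reaches the spheres about `x₀`
form a measurable selection. -/
theorem exists_measurable_selection {p : ℝ → Rn n} (hp : Continuous p) {r : ℝ}
    (hr : r ≤ dist (p 1) (p 0)) :
    ∃ k : ℝ → Rn n, Measurable k ∧ ∀ t ∈ Ioo 0 r, k t ∈ p '' Icc 0 1 ∧ dist (k t) (p 0) = t := by
  -- The cut-off `min t r` keeps `S t` nonempty for every real `t`. Its infimum is then monotone in
  -- `t` on the whole line, and measurability is free.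
  set S : ℝ → Set ℝ := fun t => {s ∈ Icc (0 : ℝ) 1 | min t r ≤ dist (p s) (p 0)} with hS
  have hne : ∀ t, (S t).Nonempty := fun t => ⟨1, by simp, (min_le_right _ _).trans hr⟩
  have hbdd : ∀ t, BddBelow (S t) := fun t => ⟨0, fun s hs => hs.1.1⟩
  have hcl : ∀ t, IsClosed (S t) := fun t =>
    isClosed_Icc.inter (isClosed_le continuous_const (hp.dist continuous_const))
  have hmem : ∀ t, sInf (S t) ∈ S t := fun t => (hcl t).csInf_mem (hne t) (hbdd t)
  have hmono : Monotone fun t => sInf (S t) := fun t t' htt =>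
    csInf_le_csInf (hbdd t) (hne t') fun s hs => ⟨hs.1, (min_le_min_right _ htt).trans hs.2⟩
  refine ⟨fun t => p (sInf (S t)), hp.measurable.comp hmono.measurable, fun t ht =>
    ⟨⟨_, (hmem t).1, rfl⟩, ?_⟩⟩
  have hmin : min t r = t := min_eq_left ht.2.le
  have h1 : t ≤ dist (p (sInf (S t))) (p 0) := by have := (hmem t).2; rwa [hmin] at this
  refine le_antisymm ?_ h1
  by_contra hcon
  push Not at hcon
  have hc : ContinuousOn (fun s => dist (p s) (p 0)) (Icc 0 (sInf (S t))) :=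
    (hp.dist continuous_const).continuousOn
  obtain ⟨s, hs, hst⟩ := intermediate_value_Icc (hmem t).1.1 hc
    ⟨by simpa using ht.1.le, hcon.le⟩
  have : sInf (S t) ≤ s :=
    csInf_le (hbdd t) ⟨⟨hs.1, hs.2.trans (hmem t).1.2⟩, by rw [hmin]; exact hst.ge⟩
  have heq : s = sInf (S t) := le_antisymm hs.2 this
  rw [heq] at hst
  exact hcon.ne' hst

/-- At distance at least one from `c` the integrand is at most one; near `c` the singularity is
integrable, and translation invariance makes its contribution independent of `c`. -/
theorem exists_lintegral_enorm_sub_le (r : ℝ) :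
    ∃ C : ℝ≥0∞, C ≠ ⊤ ∧ ∀ c : ℝ, ∫⁻ t in Ioo 0 r, ‖c - t‖ₑ ^ (-(1 / 2) : ℝ) ≤ C := by
  have hfin : ∫⁻ z in ball (0 : ℝ) 1, ‖z‖ₑ ^ (-(1 / 2) : ℝ) < ⊤ :=
    lintegral_enorm_rpow_lt_top volume one_pos (by simp; norm_num)
  refine ⟨ENNReal.ofReal r + ∫⁻ z in ball (0 : ℝ) 1, ‖z‖ₑ ^ (-(1 / 2) : ℝ),
    ENNReal.add_ne_top.2 ⟨ENNReal.ofReal_ne_top, hfin.ne⟩, fun c => ?_⟩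
  have hpt : ∀ t : ℝ, ‖c - t‖ₑ ^ (-(1 / 2) : ℝ) ≤
      1 + (ball (0 : ℝ) 1).indicator (fun z => ‖z‖ₑ ^ (-(1 / 2) : ℝ)) (c - t) := by
    intro t
    by_cases h : c - t ∈ ball (0 : ℝ) 1
    · rw [indicator_of_mem h]; exact le_add_self
    · rw [indicator_of_notMem h, add_zero]
      have h1 : (1 : ℝ≥0∞) ≤ ‖c - t‖ₑ := by
        rw [← ofReal_norm, ← ENNReal.ofReal_one]
        exact ENNReal.ofReal_le_ofReal (by simpa using h)
      rw [ENNReal.rpow_neg]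
      exact ENNReal.inv_le_one.2 (ENNReal.one_le_rpow h1 (by norm_num))
  calc _ ≤ ∫⁻ t in Ioo 0 r,
        (1 + (ball (0 : ℝ) 1).indicator (fun z => ‖z‖ₑ ^ (-(1 / 2) : ℝ)) (c - t)) :=
        lintegral_mono hpt
    _ = ENNReal.ofReal r + ∫⁻ t in Ioo 0 r,
        (ball (0 : ℝ) 1).indicator (fun z => ‖z‖ₑ ^ (-(1 / 2) : ℝ)) (c - t) := by
        rw [lintegral_add_left measurable_const, setLIntegral_const, Real.volume_Ioo, sub_zero,
          one_mul]
    _ ≤ ENNReal.ofReal r + ∫⁻ t,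
        (ball (0 : ℝ) 1).indicator (fun z => ‖z‖ₑ ^ (-(1 / 2) : ℝ)) (c - t) := by
        exact add_le_add le_rfl (setLIntegral_le_lintegral _ _)
    _ = _ := by
        rw [lintegral_sub_left_eq_self
          ((ball (0 : ℝ) 1).indicator (fun z => ‖z‖ₑ ^ (-(1 / 2) : ℝ))) c,
          lintegral_indicator measurableSet_ball]

/-- Hölder's inequality for a potential integrated over a measurable selection. -/
theorem exists_potential_bound (hn : 2 ≤ n) {R r : ℝ} (hR : 0 < R) :
    ∃ A : ℝ≥0∞, A ≠ ⊤ ∧ ∀ (ρ : Rn n → ℝ≥0∞), Measurable ρ → ∀ (k : ℝ → Rn n), Measurable k →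
      ∀ x₀ : Rn n, (∀ t ∈ Ioo 0 r, dist (k t) x₀ = t) →
      ∫⁻ t in Ioo 0 r, ∫⁻ w in ball (k t) R, ρ w * ‖w - k t‖ₑ ^ (1 - n : ℝ) ≤
        A * (∫⁻ w, ρ w ^ n) ^ (1 / n : ℝ) := by
  have := nontrivial_Rn hn
  have hn' : (2 : ℝ) ≤ n := by exact_mod_cast hn
  obtain ⟨C₁, hC₁, hC₁'⟩ := exists_lintegral_enorm_sub_le r
  set q : ℝ := Real.conjExponent n with hq
  have hpq : (n : ℝ).HolderConjugate q := Real.HolderConjugate.conjExponent (by linarith)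
  -- For a single pole the kernel raised to the conjugate exponent `q` has exponent `-n`, just
  -- failing to be integrable. The poles `k t` lie at distance `t` from `x₀`, so a factor `‖w - k t‖
  -- ^ (-δ)` can be dominated by `|‖w - x₀‖ - t| ^ (-δ)` and absorbed by the integration in `t`;
  -- with this `δ` its `n`-th power has exponent `-1/2`. What remains has exponent `e = -n + δ q`,
  -- which is integrable.
  set δ : ℝ := 1 / (2 * n) with hδ
  have hδn : δ * n = 1 / 2 := by rw [hδ]; field_simp
  set e : ℝ := (1 - n + δ) * q with he
  have hqv : q = n / (n - 1) := rfl
  have hn1 : (0 : ℝ) < n - 1 := by linarith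
  have heq : e = -n + δ * q := by
    rw [he, hqv]; field_simp; ring
  have hδ0 : 0 < δ := by rw [hδ]; positivity
  have hq0 : 0 < q := by rw [hqv]; positivity
  set C₂ : ℝ≥0∞ := ∫⁻ z in ball (0 : Rn n) R, ‖z‖ₑ ^ e with hC₂
  have hC₂t : C₂ ≠ ⊤ := (lintegral_enorm_rpow_lt_top volume hR (by
    rw [finrank_euclideanSpace_fin, heq]; nlinarith [mul_pos hδ0 hq0])).ne
  refine ⟨C₁ ^ (1 / n : ℝ) * (ENNReal.ofReal r * C₂) ^ (1 / q), ?_, ?_⟩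
  · refine ENNReal.mul_ne_top (ENNReal.rpow_ne_top_of_nonneg (by positivity) hC₁)
      (ENNReal.rpow_ne_top_of_nonneg (by positivity)
        (ENNReal.mul_ne_top ENNReal.ofReal_ne_top hC₂t))
  intro ρ hρ k hk x₀ hkx
  set f₁ : ℝ × Rn n → ℝ≥0∞ := fun z => ρ z.2 * ‖‖z.2 - x₀‖ - z.1‖ₑ ^ (-δ) with hf₁
  set f₂ : ℝ × Rn n → ℝ≥0∞ := fun z =>
    (ball (0 : Rn n) R).indicator (fun y => ‖y‖ₑ ^ (1 - n + δ)) (z.2 - k z.1) with hf₂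
  have hm₁ : Measurable f₁ := by
    refine (hρ.comp measurable_snd).mul (Measurable.pow_const (Measurable.enorm ?_) _)
    fun_prop
  have hm₂ : Measurable f₂ := by
    refine Measurable.comp (g := (ball (0 : Rn n) R).indicator (fun y => ‖y‖ₑ ^ (1 - n + δ)))
      ((measurable_enorm.pow_const _).indicator measurableSet_ball) ?_
    exact measurable_snd.sub (hk.comp measurable_fst)
  set μ : Measure (ℝ × Rn n) := (volume.restrict (Ioo 0 r)).prod volume with hμ
  have hholder := ENNReal.lintegral_mul_le_Lp_mul_Lq μ hpq hm₁.aemeasurable hm₂.aemeasurable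
  have hleft : ∫⁻ t in Ioo 0 r, ∫⁻ w in ball (k t) R, ρ w * ‖w - k t‖ₑ ^ (1 - n : ℝ) ≤
      ∫⁻ z, (f₁ * f₂) z ∂μ := by
    rw [hμ, lintegral_prod _ (hm₁.mul hm₂).aemeasurable]
    refine setLIntegral_mono' measurableSet_Ioo fun t ht => ?_
    rw [← lintegral_indicator measurableSet_ball]
    refine lintegral_mono fun w => ?_
    by_cases hw : w ∈ ball (k t) R
    · have hw' : w - k t ∈ ball (0 : Rn n) R := by
        simpa [dist_eq_norm] using hw
      rw [indicator_of_mem hw, Pi.mul_apply, hf₁, hf₂]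
      simp only
      rw [indicator_of_mem hw', mul_assoc]
      gcongr
      have hd : ‖‖w - x₀‖ - t‖ₑ ≤ ‖w - k t‖ₑ := by
        rw [← ofReal_norm, ← ofReal_norm]
        refine ENNReal.ofReal_le_ofReal ?_
        have habs := abs_dist_sub_le w (k t) x₀
        rw [hkx t ht] at habs
        rwa [Real.norm_eq_abs, ← dist_eq_norm, ← dist_eq_norm]
      have h1 : ‖w - k t‖ₑ ^ (-δ) ≤ ‖‖w - x₀‖ - t‖ₑ ^ (-δ) := by
        rw [ENNReal.rpow_neg, ENNReal.rpow_neg, ENNReal.inv_le_inv]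
        exact ENNReal.rpow_le_rpow hd hδ0.le
      refine le_trans ?_ (mul_le_mul' h1 le_rfl)
      -- At the pole itself exponents cannot be added, but all the powers are negative and both
      -- sides are infinite.
      by_cases h0 : ‖w - k t‖ₑ = 0
      · have hneg : 1 - n + δ < 0 := by
          have : δ < 1 := by nlinarith
          linarith
        rw [h0, ENNReal.zero_rpow_of_neg (by linarith : -δ < 0),
          ENNReal.zero_rpow_of_neg (by linarith : (1 : ℝ) - n < 0), ENNReal.zero_rpow_of_neg hneg,
          ENNReal.top_mul_top]
      · rw [← ENNReal.rpow_add _ _ h0 enorm_ne_top]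
        ring_nf; rfl
    · rw [indicator_of_notMem hw]; exact zero_le
  have hI₁ : ∫⁻ z, f₁ z ^ (n : ℝ) ∂μ ≤ C₁ * ∫⁻ w, ρ w ^ n := by
    rw [hμ, lintegral_prod_symm _ (hm₁.pow_const _).aemeasurable, ← lintegral_const_mul' _ _ hC₁]
    refine lintegral_mono fun w => ?_
    have : ∀ t : ℝ, f₁ (t, w) ^ (n : ℝ) = ρ w ^ n * ‖‖w - x₀‖ - t‖ₑ ^ (-(1 / 2) : ℝ) := by
      intro t
      rw [hf₁]
      simp only
      rw [ENNReal.mul_rpow_of_nonneg _ _ (by positivity), ENNReal.rpow_natCast, ← ENNReal.rpow_mul,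
        neg_mul, hδn]
    simp only [this]
    rw [lintegral_const_mul _ (Measurable.pow_const (Measurable.enorm (by fun_prop)) _), mul_comm]
    gcongr
    exact hC₁' _
  have hI₂ : ∫⁻ z, f₂ z ^ q ∂μ = ENNReal.ofReal r * C₂ := by
    rw [hμ, lintegral_prod _ (hm₂.pow_const _).aemeasurable]
    have : ∀ t : ℝ, ∫⁻ w, f₂ (t, w) ^ q = C₂ := by
      intro t
      rw [hC₂, ← lintegral_indicator measurableSet_ball,
        ← lintegral_sub_right_eq_self (μ := (volume : Measure (Rn n)))
          ((ball (0 : Rn n) R).indicator fun z => ‖z‖ₑ ^ e) (k t)]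
      refine lintegral_congr fun w => ?_
      rw [hf₂]
      simp only
      by_cases hw : w - k t ∈ ball (0 : Rn n) R
      · rw [indicator_of_mem hw, indicator_of_mem hw, ← ENNReal.rpow_mul]
      · rw [indicator_of_notMem hw, indicator_of_notMem hw, ENNReal.zero_rpow_of_pos hq0]
    simp only [this]
    rw [setLIntegral_const, Real.volume_Ioo, sub_zero, mul_comm]
  calc _ ≤ _ := hleft
    _ ≤ _ := hholder
    _ ≤ (C₁ * ∫⁻ w, ρ w ^ n) ^ (1 / n : ℝ) * (ENNReal.ofReal r * C₂) ^ (1 / q) := by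
        rw [hI₂]; gcongr
    _ = _ := by
        rw [ENNReal.mul_rpow_of_nonneg _ _ (by positivity)]; ring

/-- A lower bound for the modulus of the curves that join, in a domain containing a ball, a path
issuing from the centre of this ball to a fat set in the ball. -/
theorem exists_modulus_lower_bound (hn : 2 ≤ n) {r₁ r₂ : ℝ} (hr₁ : 0 < r₁) (hr₁₂ : r₁ ≤ r₂)
    {v : ℝ≥0∞} (hv : v ≠ 0) :
    ∃ κ : ℝ≥0∞, κ ≠ 0 ∧ ∀ (D E F : Set (Rn n)) (p : ℝ → Rn n), Continuous p → ball (p 0) r₂ ⊆ D →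
      r₁ ≤ dist (p 1) (p 0) → p '' Icc 0 1 ⊆ E → MeasurableSet F → F ⊆ ball (p 0) r₂ →
      v ≤ volume F → Disjoint E F → κ ≤ modulus (curvesJoining E F D) := by
  have := nontrivial_Rn hn
  have hr₂ : 0 < r₂ := hr₁.trans_le hr₁₂
  -- The poles and the points of `F` lie in one ball of radius `r₂`, hence at mutual distance less
  -- than `2 * r₂`.
  obtain ⟨A, hA, hA'⟩ := exists_potential_bound (n := n) hn (R := 2 * r₂) (r := r₁) (by positivity)
  set B : ℝ≥0∞ := ENNReal.ofReal ((2 * r₂) ^ n) * A with hB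
  have hBt : B ≠ ⊤ := ENNReal.mul_ne_top ENNReal.ofReal_ne_top hA
  have hn0 : (n : ℝ) ≠ 0 := by positivity
  refine ⟨(ENNReal.ofReal r₁ * v / B) ^ n, ?_, ?_⟩
  · refine pow_ne_zero _ (ENNReal.div_ne_zero.2 ⟨mul_ne_zero ?_ hv, hBt⟩)
    simpa using hr₁
  intro D E F p hp hball hdist hE hF hFb hvF hEF
  refine le_iInf₂ fun ρ hρ => ?_
  obtain ⟨k, hk, hk'⟩ := exists_measurable_selection hp hdist
  -- By convexity of the ball, the segments from `k t` to `F` belong to the family, so the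
  -- admissible `ρ` satisfies the hypothesis of `volume_le_potential` at each `k t`. Integrating
  -- over `t` and using Hölder's inequality bounds the energy of `ρ` from below.
  have hpot : ∀ t ∈ Ioo 0 r₁, v ≤ ENNReal.ofReal ((2 * r₂) ^ n) *
      ∫⁻ w in ball (k t) (2 * r₂), ρ w * ‖w - k t‖ₑ ^ (1 - n : ℝ) := by
    intro t ht
    refine hvF.trans (volume_le_potential hn (by positivity) hρ.1 hF fun u r hu hr hmem => ?_)
    have hkb : k t ∈ ball (p 0) r₂ := by
      rw [mem_ball, (hk' t ht).2]; exact ht.2.trans_le hr₁₂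
    have hdistr : dist (k t + r • u) (k t) = r := by
      rw [dist_eq_norm, add_sub_cancel_left, norm_smul, hu, mul_one, Real.norm_of_nonneg hr.le]
    refine ⟨?_, ?_⟩
    · have h1 := dist_triangle_right (k t + r • u) (k t) (p 0)
      have h2 := mem_ball.1 (hFb hmem)
      have h3 := mem_ball.1 hkb
      linarith
    · have hmemΓ : segmentCurve (k t) u r hr ∈ curvesJoining E F D := by
        refine ⟨?_, hmem, fun s hs => hball ?_⟩
        · show k t + (0 : ℝ) • u ∈ E
          rw [zero_smul, add_zero]
          exact hE (hk' t ht).1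
        · have := (convex_ball (p 0) r₂).add_smul_mem hkb (y := r • u) (hFb hmem)
            (t := s / r) ⟨div_nonneg hs.1.le hr.le, (div_le_one hr).2 hs.2.le⟩
          rw [smul_smul, div_mul_cancel₀ _ hr.ne'] at this
          exact this
      have := hρ.2 _ hmemΓ (segmentCurve_rectifiable (k t) hu hr)
      rw [segmentCurve_lineIntegral (k t) hu hr] at this
      rwa [setLIntegral_congr Ioo_ae_eq_Icc]
  have h1 : ENNReal.ofReal r₁ * v ≤ B * (∫⁻ w, ρ w ^ n) ^ (1 / n : ℝ) := by
    calc ENNReal.ofReal r₁ * v = ∫⁻ _ in Ioo 0 r₁, v := by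
          rw [setLIntegral_const, Real.volume_Ioo, sub_zero, mul_comm]
      _ ≤ ∫⁻ t in Ioo 0 r₁, ENNReal.ofReal ((2 * r₂) ^ n) *
          ∫⁻ w in ball (k t) (2 * r₂), ρ w * ‖w - k t‖ₑ ^ (1 - n : ℝ) :=
          setLIntegral_mono' measurableSet_Ioo hpot
      _ = ENNReal.ofReal ((2 * r₂) ^ n) * ∫⁻ t in Ioo 0 r₁,
          ∫⁻ w in ball (k t) (2 * r₂), ρ w * ‖w - k t‖ₑ ^ (1 - n : ℝ) :=
          lintegral_const_mul' _ _ ENNReal.ofReal_ne_top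
      _ ≤ ENNReal.ofReal ((2 * r₂) ^ n) * (A * (∫⁻ w, ρ w ^ n) ^ (1 / n : ℝ)) := by
          gcongr
          exact hA' ρ hρ.1 k hk (p 0) fun t ht => (hk' t ht).2
      _ = _ := by rw [hB, mul_assoc]
  have h2 : ENNReal.ofReal r₁ * v / B ≤ (∫⁻ w, ρ w ^ n) ^ (1 / n : ℝ) :=
    ENNReal.div_le_of_le_mul' h1
  calc _ ≤ ((∫⁻ w, ρ w ^ n) ^ (1 / n : ℝ)) ^ n := pow_le_pow_left' h2 n
    _ = _ := by
      rw [← ENNReal.rpow_natCast, ← ENNReal.rpow_mul, one_div, inv_mul_cancel₀ hn0,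
        ENNReal.rpow_one]

/-! ### The Hausdorff measure on spheres -/

/-- The difference splits into the change of the vector and the change of the scaling factor; each
part is at most `‖a‖⁻¹ * ‖a - b‖`. Used to project the faces of the cube to the sphere by Lipschitz
maps. -/
theorem norm_normalize_sub_le {E : Type*} [NormedAddCommGroup E] [NormedSpace ℝ E] {a b : E}
    (ha : 1 ≤ ‖a‖) (hb : 1 ≤ ‖b‖) : ‖‖a‖⁻¹ • a - ‖b‖⁻¹ • b‖ ≤ 2 * ‖a - b‖ := by
  have ha0 : 0 < ‖a‖ := by linarith
  have hb0 : 0 < ‖b‖ := by linarith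
  have h1 : ‖a‖⁻¹ • a - ‖b‖⁻¹ • b = ‖a‖⁻¹ • (a - b) + (‖a‖⁻¹ - ‖b‖⁻¹) • b := by
    rw [smul_sub, sub_smul]; abel
  have h2 : ‖(‖a‖⁻¹ - ‖b‖⁻¹) • b‖ ≤ ‖a‖⁻¹ * ‖a - b‖ := by
    have : ‖a‖⁻¹ - ‖b‖⁻¹ = ‖a‖⁻¹ * ‖b‖⁻¹ * (‖b‖ - ‖a‖) := by field_simp
    rw [norm_smul, this, norm_mul, norm_mul, norm_inv, norm_inv, norm_norm, norm_norm]
    have h3 : ‖‖b‖ - ‖a‖‖ ≤ ‖a - b‖ := by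
      rw [norm_sub_rev a b]; exact abs_norm_sub_norm_le b a
    calc _ = ‖a‖⁻¹ * ‖‖b‖ - ‖a‖‖ := by field_simp
      _ ≤ _ := by gcongr
  have h3 : ‖‖a‖⁻¹ • (a - b)‖ = ‖a‖⁻¹ * ‖a - b‖ := by
    rw [norm_smul, norm_inv, norm_norm]
  have h4 : ‖a‖⁻¹ ≤ 1 := inv_le_one_of_one_le₀ ha
  calc _ ≤ ‖‖a‖⁻¹ • (a - b)‖ + ‖(‖a‖⁻¹ - ‖b‖⁻¹) • b‖ := by rw [h1]; exact norm_add_le _ _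
    _ ≤ ‖a‖⁻¹ * ‖a - b‖ + ‖a‖⁻¹ * ‖a - b‖ := add_le_add h3.le h2
    _ ≤ 1 * ‖a - b‖ + 1 * ‖a - b‖ := by gcongr
    _ = _ := by ring

/-- A face of the cube `[-1, 1]ⁿ`, parametrized by `ℝⁿ⁻¹`. -/
noncomputable def cubeFace {m : ℕ} (i : Fin (m + 1)) (σ : ℝ) (x : Fin m → ℝ) : Rn (m + 1) :=
  WithLp.toLp 2 (i.insertNth (α := fun _ => ℝ) σ x)

theorem exists_lipschitzWith_cubeFace {m : ℕ} (i : Fin (m + 1)) (σ : ℝ) :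
    ∃ K : NNReal, LipschitzWith K (cubeFace i σ) := by
  have h1 : LipschitzWith 1 (fun x : Fin m → ℝ => i.insertNth (α := fun _ => ℝ) σ x) := by
    refine LipschitzWith.of_dist_le_mul fun x y => ?_
    rw [Fin.dist_insertNth_insertNth]
    simp
  exact ⟨_, (PiLp.lipschitzWith_toLp 2 (fun _ : Fin (m + 1) => ℝ)).comp h1⟩

theorem one_le_norm_cubeFace {m : ℕ} (i : Fin (m + 1)) {σ : ℝ} (hσ : |σ| = 1) (x : Fin m → ℝ) :
    1 ≤ ‖cubeFace i σ x‖ := by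
  have := PiLp.norm_apply_le (cubeFace i σ x) i
  simpa [cubeFace, hσ] using this

/-- The `(n - 1)`-dimensional Hausdorff measure of the unit sphere is finite. -/
theorem hausdorffMeasure_sphere_lt_top (hn : 2 ≤ n) :
    Measure.hausdorffMeasure ((n : ℝ) - 1) (sphere (0 : Rn n) 1) < ⊤ := by
  obtain ⟨m, rfl⟩ : ∃ m, n = m + 1 := ⟨n - 1, by omega⟩
  have hdim : ((m + 1 : ℕ) : ℝ) - 1 = m := by push_cast; ring
  rw [hdim]
  set N : Rn (m + 1) → Rn (m + 1) := fun a => ‖a‖⁻¹ • a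
  set I : Set (Fin m → ℝ) := Icc (fun _ => -1) (fun _ => 1)
  -- The sphere is covered by the radial projections of the faces of the cube, which are Lipschitz
  -- images of a cube of dimension `m`, where the Hausdorff measure is Lebesgue measure. Dividing a
  -- point by its coordinate of largest modulus puts it on a face.
  have hcover : sphere (0 : Rn (m + 1)) 1 ⊆
      ⋃ i : Fin (m + 1), (N '' (cubeFace i 1 '' I)) ∪ (N '' (cubeFace i (-1) '' I)) := by
    intro u hu
    have hu1 : ‖u‖ = 1 := by simpa using hu
    obtain ⟨i, -, hi⟩ := Finset.exists_max_image Finset.univ (fun i => |u i|) ⟨0, by simp⟩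
    have hi0 : 0 < |u i| := by
      rw [abs_pos]
      intro h0
      have : u = 0 := by
        ext j
        have := hi j (Finset.mem_univ j)
        rw [h0, abs_zero] at this
        simpa using abs_nonpos_iff.1 this
      rw [this, norm_zero] at hu1
      exact zero_ne_one hu1
    have key : ∀ σ : ℝ, u i = |u i| * σ → u ∈ N '' (cubeFace i σ '' I) := by
      intro σ hσ
      have hx : cubeFace i σ (fun j => |u i|⁻¹ * u (i.succAbove j)) = |u i|⁻¹ • u := by
        ext j
        refine i.succAboveCases ?_ (fun j => ?_) j
        · simp only [cubeFace, Fin.insertNth_apply_same, PiLp.smul_apply, smul_eq_mul]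
          rw [eq_inv_mul_iff_mul_eq₀ hi0.ne', ← hσ]
        · simp [cubeFace]
      refine ⟨_, ⟨fun j => |u i|⁻¹ * u (i.succAbove j), ?_, rfl⟩, ?_⟩
      · have : ∀ j, |(|u i|⁻¹ * u (i.succAbove j))| ≤ 1 := fun j => by
          rw [abs_mul, abs_inv, abs_abs, inv_mul_le_iff₀ hi0, mul_one]
          exact hi _ (Finset.mem_univ _)
        exact ⟨fun j => (abs_le.1 (this j)).1, fun j => (abs_le.1 (this j)).2⟩
      · rw [hx]
        show ‖|u i|⁻¹ • u‖⁻¹ • |u i|⁻¹ • u = u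
        rw [norm_smul, hu1, mul_one, norm_inv, Real.norm_eq_abs, abs_abs, inv_inv, smul_smul,
          mul_inv_cancel₀ hi0.ne', one_smul]
    rcases le_total 0 (u i) with h | h
    · exact mem_iUnion.2 ⟨i, Or.inl (key 1 (by rw [abs_of_nonneg h, mul_one]))⟩
    · exact mem_iUnion.2 ⟨i, Or.inr (key (-1) (by rw [abs_of_nonpos h]; ring))⟩
  have hI : Measure.hausdorffMeasure (m : ℝ) I < ⊤ := by
    have := hausdorffMeasure_pi_real (ι := Fin m)
    rw [Fintype.card_fin] at this
    rw [this]
    exact (isCompact_Icc).measure_lt_top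
  have hface : ∀ (i : Fin (m + 1)) (σ : ℝ), |σ| = 1 →
      Measure.hausdorffMeasure (m : ℝ) (N '' (cubeFace i σ '' I)) < ⊤ := by
    intro i σ hσ
    obtain ⟨K, hK⟩ := exists_lipschitzWith_cubeFace i σ
    have hm : (0 : ℝ) ≤ m := by positivity
    have h1 : Measure.hausdorffMeasure (m : ℝ) (cubeFace i σ '' I) < ⊤ :=
      (hK.hausdorffMeasure_image_le hm I).trans_lt
        (ENNReal.mul_lt_top (ENNReal.rpow_lt_top_of_nonneg hm ENNReal.coe_ne_top) hI)
    have hN : LipschitzOnWith 2 N (cubeFace i σ '' I) := by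
      refine LipschitzOnWith.of_dist_le_mul ?_
      rintro _ ⟨x, -, rfl⟩ _ ⟨y, -, rfl⟩
      rw [dist_eq_norm, dist_eq_norm]
      exact norm_normalize_sub_le (one_le_norm_cubeFace i hσ x) (one_le_norm_cubeFace i hσ y)
    exact (hN.hausdorffMeasure_image_le hm).trans_lt
      (ENNReal.mul_lt_top (ENNReal.rpow_lt_top_of_nonneg hm ENNReal.coe_ne_top) h1)
  refine (measure_mono hcover).trans_lt ((measure_iUnion_le _).trans_lt ?_)
  rw [tsum_fintype]
  refine ENNReal.sum_lt_top.2 fun i _ => (measure_union_le _ _).trans_lt ?_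
  exact ENNReal.add_lt_top.2 ⟨hface i 1 (by simp), hface i (-1) (by simp)⟩

open scoped Pointwise in
/-- The surface measure of a spherical cap. -/
theorem toSphere_cap_le (hn : 2 ≤ n) {a : Rn n} (ha : ‖a‖ = 1) {d : ℝ} (hd : 0 < d) (hd1 : d ≤ 1) :
    (volume : Measure (Rn n)).toSphere ((↑) ⁻¹' closedBall a d) ≤
      n * (2 ^ (n + 1) * volume (ball (0 : Rn n) 1)) * ENNReal.ofReal (d ^ (n - 1)) := by
  have := nontrivial_Rn hn
  have hmeas : MeasurableSet ((↑) ⁻¹' closedBall a d : Set (sphere (0 : Rn n) 1)) :=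
    measurable_subtype_coe measurableSet_closedBall
  rw [Measure.toSphere_apply' _ hmeas, finrank_euclideanSpace_fin, mul_assoc]
  refine mul_le_mul' le_rfl ?_
  -- The surface measure is `n` times the volume of the cone over the cap. This cone is covered by
  -- `N` balls of radius `2 * d` with centres spaced by `d` along the axis, and `N * d ≤ 2`.
  set N : ℕ := ⌊1 / d⌋₊ + 1 with hN
  have hsub : Ioo (0 : ℝ) 1 • ((↑) '' ((↑) ⁻¹' closedBall a d : Set (sphere (0 : Rn n) 1)) :
      Set (Rn n)) ⊆ ⋃ j ∈ Finset.range N, closedBall (((j : ℝ) * d) • a) (2 * d) := by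
    rintro _ ⟨s, hs, _, ⟨x, hx, rfl⟩, rfl⟩
    have hxd : ‖(x : Rn n) - a‖ ≤ d := by simpa [dist_eq_norm] using hx
    have hsd : 0 ≤ s / d := div_nonneg hs.1.le hd.le
    refine mem_iUnion₂.2 ⟨⌊s / d⌋₊, ?_, ?_⟩
    · rw [Finset.mem_range, hN, Nat.lt_succ_iff]
      exact Nat.floor_le_floor (div_le_div_of_nonneg_right hs.2.le hd.le)
    · rw [mem_closedBall, dist_eq_norm]
      have h1 : s • (x : Rn n) - ((⌊s / d⌋₊ : ℝ) * d) • a =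
          s • ((x : Rn n) - a) + (s - (⌊s / d⌋₊ : ℝ) * d) • a := by
        rw [smul_sub, sub_smul]; abel
      have h2 : |s - (⌊s / d⌋₊ : ℝ) * d| ≤ d := by
        have h3 := Nat.floor_le hsd
        have h4 := Nat.lt_floor_add_one (s / d)
        rw [le_div_iff₀ hd] at h3
        rw [div_lt_iff₀ hd] at h4
        rw [abs_le]; constructor <;> nlinarith
      simp only
      rw [h1]
      refine (norm_add_le _ _).trans ?_
      rw [norm_smul, norm_smul, ha, mul_one, Real.norm_eq_abs, Real.norm_eq_abs, abs_of_pos hs.1]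
      nlinarith [hs.1, hs.2, norm_nonneg ((x : Rn n) - a)]
  refine (measure_mono hsub).trans ((measure_biUnion_finset_le _ _).trans ?_)
  have hball : ∀ j : ℕ, volume (closedBall (((j : ℝ) * d) • a) (2 * d)) =
      ENNReal.ofReal ((2 * d) ^ n) * volume (ball (0 : Rn n) 1) := by
    intro j
    rw [Measure.addHaar_closedBall _ _ (by positivity), finrank_euclideanSpace_fin]
  rw [Finset.sum_congr rfl fun j _ => hball j, Finset.sum_const, Finset.card_range, nsmul_eq_mul,
    ← mul_assoc, mul_right_comm (2 ^ (n + 1) : ℝ≥0∞)]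
  refine mul_le_mul' ?_ le_rfl
  have h2 : (2 : ℝ≥0∞) ^ (n + 1) = ENNReal.ofReal (2 ^ (n + 1)) := by
    rw [ENNReal.ofReal_pow (by norm_num)]; simp
  rw [h2, ← ENNReal.ofReal_natCast, ← ENNReal.ofReal_mul (by positivity),
    ← ENNReal.ofReal_mul (by positivity)]
  refine ENNReal.ofReal_le_ofReal ?_
  have hNle : (N : ℝ) * d ≤ 2 := by
    have h3 := Nat.floor_le (div_nonneg zero_le_one hd.le)
    rw [le_div_iff₀ hd] at h3
    rw [hN]; push_cast; linarith
  have hdn : d ^ n = d * d ^ (n - 1) := by rw [← pow_succ', Nat.sub_add_cancel (by omega)]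
  calc (N : ℝ) * (2 * d) ^ n = (N * d) * (2 ^ n * d ^ (n - 1)) := by rw [mul_pow, hdn]; ring
    _ ≤ 2 * (2 ^ n * d ^ (n - 1)) := by gcongr
    _ = _ := by ring

/-- The surface measure of the unit sphere is dominated by the Hausdorff measure. -/
theorem exists_lintegral_toSphere_le (hn : 2 ≤ n) :
    ∃ C : ℝ≥0∞, C ≠ ⊤ ∧ ∀ g : Rn n → ℝ≥0∞,
      ∫⁻ u : sphere (0 : Rn n) 1, g u ∂(volume : Measure (Rn n)).toSphere ≤
        C * ∫⁻ x in sphere (0 : Rn n) 1, g x ∂(Measure.hausdorffMeasure ((n : ℝ) - 1)) := by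
  have := nontrivial_Rn hn
  set C : ℝ≥0∞ := n * (2 ^ (n + 1) * volume (ball (0 : Rn n) 1)) with hC
  have hC0 : C ≠ 0 := by
    refine mul_ne_zero (by simp; omega) (mul_ne_zero (by simp) ?_)
    exact (measure_ball_pos _ _ one_pos).ne'
  have hCt : C ≠ ⊤ := by
    refine ENNReal.mul_ne_top (by simp) (ENNReal.mul_ne_top (by simp) measure_ball_lt_top.ne)
  have hemb : MeasurableEmbedding ((↑) : sphere (0 : Rn n) 1 → Rn n) :=
    MeasurableEmbedding.subtype_coe isClosed_sphere.measurableSet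
  set ν : Measure (Rn n) := (volume : Measure (Rn n)).toSphere.map (↑) with hν
  have hνapp : ∀ s, ν s = (volume : Measure (Rn n)).toSphere ((↑) ⁻¹' s) := hemb.map_apply _
  have hdim : ((n : ℝ) - 1) = ((n - 1 : ℕ) : ℝ) := by rw [Nat.cast_sub (by omega)]; simp
  have hn1 : 0 < n - 1 := by omega
  have hcap : ∀ a : Rn n, ‖a‖ = 1 → ∀ d : ℝ, 0 ≤ d → d ≤ 1 →
      ν (closedBall a d) ≤ C * ENNReal.ofReal (d ^ (n - 1)) := by
    intro a ha d hd hd1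
    rcases hd.lt_or_eq with h | h
    · rw [hνapp]; exact toSphere_cap_le hn ha h hd1
    -- A cap of radius zero is needed for sets of zero diameter; its bound is the limit of those for
    -- small positive radii.
    · have hlim : Tendsto (fun e : ℝ => C * ENNReal.ofReal (e ^ (n - 1))) (𝓝[>] 0)
          (𝓝 (C * ENNReal.ofReal (0 ^ (n - 1)))) := by
        refine ENNReal.Tendsto.const_mul ?_ (Or.inr hCt)
        refine (ENNReal.continuous_ofReal.comp (continuous_pow (n - 1))).continuousAt.tendsto.mono_left
          nhdsWithin_le_nhds
      rw [← h]
      refine ge_of_tendsto hlim ?_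
      filter_upwards [Ioo_mem_nhdsGT (zero_lt_one (α := ℝ))] with e he
      refine (measure_mono (closedBall_subset_closedBall he.1.le)).trans ?_
      rw [hνapp]; exact toSphere_cap_le hn ha he.1 he.2.le
  -- Mass distribution principle: a set of diameter at most one that meets the sphere lies in a cap
  -- of radius its diameter. One-sided domination is enough, so the exact proportionality of the two
  -- measures is not needed.
  have hle : C⁻¹ • ν ≤ Measure.hausdorffMeasure ((n : ℝ) - 1) := by
    refine Measure.le_hausdorffMeasure _ _ 1 one_pos fun s hs => ?_
    rw [Measure.smul_apply, smul_eq_mul]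
    rcases (s ∩ sphere (0 : Rn n) 1).eq_empty_or_nonempty with hem | ⟨a, has, ha⟩
    · have : ν s = 0 := by
        rw [hνapp]
        convert measure_empty (μ := (volume : Measure (Rn n)).toSphere)
        ext x
        simp only [mem_preimage, mem_empty_iff_false, iff_false]
        exact fun hx => (hem ▸ (⟨hx, x.2⟩ : (x : Rn n) ∈ s ∩ sphere 0 1) : (x : Rn n) ∈ (∅ : Set _))
      rw [this, mul_zero]; exact zero_le
    · have hfin : ediam s ≠ ⊤ := (hs.trans_lt ENNReal.one_lt_top).ne
      set d := (ediam s).toReal with hd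
      have hd1 : d ≤ 1 := by
        rw [hd, ← ENNReal.toReal_one]; exact ENNReal.toReal_mono ENNReal.one_ne_top hs
      have hsub : s ⊆ closedBall a d := by
        intro x hx
        rw [mem_closedBall, dist_edist]
        exact ENNReal.toReal_mono hfin (edist_le_ediam_of_mem hx has)
      have ha1 : ‖a‖ = 1 := by simpa using ha
      have h1 := (measure_mono hsub).trans (hcap a ha1 d ENNReal.toReal_nonneg hd1)
      rw [ENNReal.inv_mul_le_iff hC0 hCt]
      refine h1.trans (mul_le_mul' le_rfl (le_of_eq ?_))
      rw [hdim, ENNReal.rpow_natCast, ENNReal.ofReal_pow ENNReal.toReal_nonneg,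
        ENNReal.ofReal_toReal hfin]
  refine ⟨C, hCt, fun g => ?_⟩
  have hνC : ν ≤ C • Measure.hausdorffMeasure ((n : ℝ) - 1) := by
    intro s
    have := hle s
    rw [Measure.smul_apply, smul_eq_mul, ENNReal.inv_mul_le_iff hC0 hCt] at this
    exact this
  have hres : ν.restrict (sphere 0 1) = ν := by
    refine Measure.restrict_eq_self_of_ae_mem ?_
    rw [hν, hemb.ae_map_iff]
    exact ae_of_all _ fun x => x.2
  calc ∫⁻ u : sphere (0 : Rn n) 1, g u ∂(volume : Measure (Rn n)).toSphere = ∫⁻ x, g x ∂ν := by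
        rw [hν, hemb.lintegral_map]
    _ = ∫⁻ x in sphere (0 : Rn n) 1, g x ∂ν := by rw [hres]
    _ ≤ ∫⁻ x in sphere (0 : Rn n) 1, g x ∂(C • Measure.hausdorffMeasure ((n : ℝ) - 1)) :=
        lintegral_mono' (Measure.restrict_mono le_rfl hνC) le_rfl
    _ = _ := by rw [Measure.restrict_smul, lintegral_smul_measure, smul_eq_mul]

/-! ### Smallness of the weighted integrals over spherical rings -/

/-- The infimum of the weighted integrals `∫ Q(y) ηⁿ(|y - y₀|) dy` over rings about `y₀` with a given
outer radius vanishes. -/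
def RingIntegralsVanish (Q : Rn n → ℝ≥0∞) (y₀ : Rn n) : Prop :=
  ∀ r₂ : ℝ, 0 < r₂ → ∀ ε : ℝ≥0∞, ε ≠ 0 → ∃ r₁, 0 < r₁ ∧ r₁ < r₂ ∧ ∃ η : ℝ → ℝ≥0∞,
    AEMeasurable η (volume.restrict (Ioo r₁ r₂)) ∧ 1 ≤ ∫⁻ r in Ioo r₁ r₂, η r ∧
      ∫⁻ y in annulus y₀ r₁ r₂, Q y * η ‖y - y₀‖ ^ n ≤ ε

/-- It suffices to find weights with large integrals that dominate the weighted integrals of `Q`. -/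
theorem ringIntegralsVanish_of_large (hn : 2 ≤ n) {Q : Rn n → ℝ≥0∞} {y₀ : Rn n}
    (h : ∀ r₂ : ℝ, 0 < r₂ → ∃ C : ℝ≥0∞, C ≠ ⊤ ∧ ∀ L : ℝ≥0∞, L ≠ ⊤ → ∃ r₁, 0 < r₁ ∧ r₁ < r₂ ∧
      ∃ η : ℝ → ℝ≥0∞, Measurable η ∧ L ≤ ∫⁻ r in Ioo r₁ r₂, η r ∧ ∫⁻ r in Ioo r₁ r₂, η r ≠ ⊤ ∧
        ∫⁻ y in annulus y₀ r₁ r₂, Q y * η ‖y - y₀‖ ^ n ≤ C * ∫⁻ r in Ioo r₁ r₂, η r) :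
    RingIntegralsVanish Q y₀ := by
  intro r₂ hr₂ ε hε
  obtain ⟨C, hC, hL⟩ := h r₂ hr₂
  -- Dividing the weight by its integral `I` leaves at most `C * I ^ (1 - n)`. Since `I ≥ 1` and `n
  -- ≥ 2` this is at most `C / I`, which `I ≥ C / ε` makes at most `ε`.
  obtain ⟨r₁, hr₁, hr₁₂, η, hη, hLI, hIt, hQ⟩ := hL (max 1 (C / ε))
    (max_ne_top (by simp) (ENNReal.div_ne_top hC hε))
  set I := ∫⁻ r in Ioo r₁ r₂, η r with hI
  have h1I : 1 ≤ I := (le_max_left _ _).trans hLI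
  have hI0 : I ≠ 0 := (zero_lt_one.trans_le h1I).ne'
  refine ⟨r₁, hr₁, hr₁₂, fun r => I⁻¹ * η r, (hη.const_mul _).aemeasurable, ?_, ?_⟩
  · rw [lintegral_const_mul _ hη, ← hI, ENNReal.inv_mul_cancel hI0 hIt]
  · have hInv : I⁻¹ ^ n ≠ ⊤ := ENNReal.pow_ne_top (ENNReal.inv_ne_top.2 hI0)
    calc ∫⁻ y in annulus y₀ r₁ r₂, Q y * (I⁻¹ * η ‖y - y₀‖) ^ n
        = I⁻¹ ^ n * ∫⁻ y in annulus y₀ r₁ r₂, Q y * η ‖y - y₀‖ ^ n := by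
          rw [← lintegral_const_mul' _ _ hInv]
          refine lintegral_congr fun y => ?_
          rw [mul_pow]; ring
      _ ≤ I⁻¹ ^ 2 * (C * I) := by
          refine mul_le_mul' (pow_le_pow_right_of_le_one' ?_ hn) hQ
          exact ENNReal.inv_le_one.2 h1I
      _ = C * I⁻¹ * (I⁻¹ * I) := by ring
      _ = C * I⁻¹ := by rw [ENNReal.inv_mul_cancel hI0 hIt, mul_one]
      _ ≤ ε := by
          rw [← div_eq_mul_inv]
          refine ENNReal.div_le_of_le_mul ?_
          by_cases hεt : ε = ⊤
          · rw [hεt, ENNReal.top_mul hI0]; exact le_top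
          · have := (le_max_right _ _).trans hLI
            rwa [ENNReal.div_le_iff hε hεt, mul_comm] at this

-- Dilation by `t` multiplies the measure by `t ^ (n - 1)` and translation is an isometry. This
-- refers the means over all spheres to the unit sphere.
open scoped Pointwise in
theorem setLIntegral_hausdorffMeasure_dilation (hn : 2 ≤ n) (y₀ : Rn n) {t : ℝ} (ht : 0 < t)
    (g : Rn n → ℝ≥0∞) :
    ENNReal.ofReal t ^ (n - 1) * ∫⁻ x in sphere (0 : Rn n) 1, g (y₀ + t • x)
        ∂(Measure.hausdorffMeasure ((n : ℝ) - 1)) =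
      ∫⁻ y in sphere y₀ t, g y ∂(Measure.hausdorffMeasure ((n : ℝ) - 1)) := by
  have hdim : ((n : ℝ) - 1) = ((n - 1 : ℕ) : ℝ) := by rw [Nat.cast_sub (by omega)]; simp
  rw [hdim]
  set H : Measure (Rn n) := Measure.hausdorffMeasure ((n - 1 : ℕ) : ℝ) with hH
  set T : Rn n ≃ₜ Rn n := (Homeomorph.smulOfNeZero t ht.ne').trans (Homeomorph.addLeft y₀) with hT
  have hTapp : ∀ x, T x = y₀ + t • x := fun x => rfl
  have hTe : MeasurableEmbedding T := T.measurableEmbedding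
  have hmap : ENNReal.ofReal t ^ (n - 1) • H.map T = H := by
    ext s hs
    rw [Measure.smul_apply, hTe.map_apply, smul_eq_mul]
    have himage : T '' (T ⁻¹' s) = s := image_preimage_eq s T.surjective
    have h1 : H (t • (T ⁻¹' s)) = ENNReal.ofReal t ^ (n - 1) * H (T ⁻¹' s) := by
      rw [hH, Measure.hausdorffMeasure_smul₀ (by positivity) ht.ne', ENNReal.smul_def, smul_eq_mul,
        ENNReal.coe_rpow_of_nonneg _ (by positivity), ENNReal.rpow_natCast]
      congr 2
      rw [← Real.enorm_of_nonneg ht.le]; rfl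
    rw [← h1]
    have h2 : s = (fun x => y₀ + x) '' (t • (T ⁻¹' s)) := by
      conv_lhs => rw [← himage]
      rw [← image_smul, image_image]
      rfl
    conv_rhs => rw [h2]
    exact ((IsometryEquiv.addLeft y₀).isometry.hausdorffMeasure_image (Or.inl (by positivity)) _).symm
  have hpre : T ⁻¹' (sphere y₀ t) = sphere (0 : Rn n) 1 := by
    ext x
    rw [mem_preimage, hTapp, mem_sphere, mem_sphere, dist_eq_norm, add_sub_cancel_left, norm_smul,
      Real.norm_of_nonneg ht.le, dist_zero_right]
    constructor
    · intro h; exact mul_left_cancel₀ ht.ne' (by rw [h, mul_one])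
    · intro h; rw [h, mul_one]
  conv_rhs => rw [← hmap]
  rw [Measure.restrict_smul, lintegral_smul_measure, smul_eq_mul, hTe.restrict_map,
    hTe.lintegral_map, hpre]
  rfl

theorem exists_lintegral_toSphere_le_sphereMean (hn : 2 ≤ n) :
    ∃ K : ℝ≥0∞, K ≠ 0 ∧ K ≠ ⊤ ∧ ∀ (Q : Rn n → ℝ≥0∞) (y₀ : Rn n) (t : ℝ), 0 < t →
      ∫⁻ u : sphere (0 : Rn n) 1, Q (y₀ + t • (u : Rn n)) ∂(volume : Measure (Rn n)).toSphere ≤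
        K * sphereMean Q y₀ t := by
  obtain ⟨C, hC, hC'⟩ := exists_lintegral_toSphere_le hn
  -- Adding one makes `M` invertible without a proof that the sphere has positive measure; enlarging
  -- the denominator only decreases the quotient.
  set M : ℝ≥0∞ := Measure.hausdorffMeasure ((n : ℝ) - 1) (sphere (0 : Rn n) 1) + 1 with hM
  have hMt : M ≠ ⊤ := ENNReal.add_ne_top.2 ⟨(hausdorffMeasure_sphere_lt_top hn).ne, by simp⟩
  have hM0 : M ≠ 0 := by simp [hM]
  refine ⟨(C + 1) * M, mul_ne_zero (by simp) hM0, ENNReal.mul_ne_top (by simp [hC]) hMt,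
    fun Q y₀ t ht => ?_⟩
  refine (hC' fun x => Q (y₀ + t • x)).trans ?_
  rw [mul_assoc]
  refine mul_le_mul' le_self_add ?_
  have ht0 : ENNReal.ofReal t ^ (n - 1) ≠ 0 := pow_ne_zero _ (by simpa using ht)
  have htt : ENNReal.ofReal t ^ (n - 1) ≠ ⊤ := ENNReal.pow_ne_top ENNReal.ofReal_ne_top
  set J := ∫⁻ x in sphere (0 : Rn n) 1, Q (y₀ + t • x)
        ∂(Measure.hausdorffMeasure ((n : ℝ) - 1))
  have h1 : J / M ≤ sphereMean Q y₀ t := by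
    rw [sphereMean, ← setLIntegral_hausdorffMeasure_dilation hn y₀ ht Q, mul_comm (Measure.hausdorffMeasure _ _),
      ENNReal.mul_div_mul_left _ _ ht0 htt]
    exact ENNReal.div_le_div le_rfl le_self_add
  calc J = M * (J / M) := (ENNReal.mul_div_cancel hM0 hMt).symm
    _ ≤ _ := mul_le_mul' le_rfl h1

theorem lintegral_polar' (hn : 2 ≤ n) {g : Rn n → ℝ≥0∞} (hg : Measurable g) (y₀ : Rn n) :
    ∫⁻ w, g w = ∫⁻ r in Ioi (0 : ℝ), ENNReal.ofReal (r ^ (n - 1)) *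
      ∫⁻ u : sphere (0 : Rn n) 1, g (y₀ + r • (u : Rn n))
        ∂(volume : Measure (Rn n)).toSphere := by
  have := nontrivial_Rn hn
  rw [← lintegral_add_left_eq_self (μ := (volume : Measure (Rn n))) g y₀,
    lintegral_polar hn (g := fun x => g (y₀ + x)) (hg.comp (measurable_const_add y₀)),
    lintegral_lintegral_swap]
  · refine lintegral_congr fun r => ?_
    rw [lintegral_const_mul' _ _ ENNReal.ofReal_ne_top]
  · refine Measurable.aemeasurable ?_
    refine Measurable.mul (f := fun z : sphere (0 : Rn n) 1 × ℝ => ENNReal.ofReal (z.2 ^ (n - 1)))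
      (by fun_prop) (hg.comp ?_)
    fun_prop

/-- By polar coordinates a null set meets almost every sphere about `y₀` in a null set. This permits
replacing `Q` by a Borel version in spherical integrals. -/
theorem ae_ae_polar (hn : 2 ≤ n) {Q Q' : Rn n → ℝ≥0∞} (h : Q =ᵐ[volume] Q') (y₀ : Rn n) :
    ∀ᵐ r ∂(volume.restrict (Ioi (0 : ℝ))),
      ∫⁻ u : sphere (0 : Rn n) 1, Q (y₀ + r • (u : Rn n)) ∂(volume : Measure (Rn n)).toSphere =
      ∫⁻ u : sphere (0 : Rn n) 1, Q' (y₀ + r • (u : Rn n)) ∂(volume : Measure (Rn n)).toSphere := by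
  have := nontrivial_Rn hn
  obtain ⟨N, hN, hNm, hN0⟩ := exists_measurable_superset_of_null (ae_iff.1 h)
  have hmN : Measurable (N.indicator (1 : Rn n → ℝ≥0∞)) := measurable_one.indicator hNm
  have h1 := lintegral_polar' hn hmN y₀
  have hcomp : Measurable fun z : ℝ × sphere (0 : Rn n) 1 =>
      N.indicator (1 : Rn n → ℝ≥0∞) (y₀ + z.1 • (z.2 : Rn n)) := hmN.comp (by fun_prop)
  rw [lintegral_indicator_one hNm, hN0, eq_comm, lintegral_eq_zero_iff] at h1
  · filter_upwards [h1, ae_restrict_mem measurableSet_Ioi] with r hr hr0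
    have hr0' : (0 : ℝ) < r := hr0
    have h2 : ∫⁻ u : sphere (0 : Rn n) 1, N.indicator 1 (y₀ + r • (u : Rn n))
        ∂(volume : Measure (Rn n)).toSphere = 0 := by
      rcases mul_eq_zero.1 hr with h | h
      · rw [ENNReal.ofReal_eq_zero] at h
        exact absurd h (not_le.2 (pow_pos hr0' _))
      · exact h
    have hsec : Measurable fun u : sphere (0 : Rn n) 1 =>
      N.indicator (1 : Rn n → ℝ≥0∞) (y₀ + r • (u : Rn n)) := hcomp.comp measurable_prodMk_left
    rw [lintegral_eq_zero_iff hsec] at h2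
    refine lintegral_congr_ae ?_
    filter_upwards [h2] with u hu
    by_contra hne
    have : y₀ + r • (u : Rn n) ∈ N := hN hne
    have h3 : N.indicator (1 : Rn n → ℝ≥0∞) (y₀ + r • (u : Rn n)) = 0 := hu
    rw [indicator_of_mem this] at h3
    exact one_ne_zero h3
  · exact Measurable.mul (by fun_prop) hcomp.lintegral_prod_right'

/-- The divergence condition implies the vanishing of the ring integrals. -/
theorem ringIntegralsVanish_of_divergence (hn : 2 ≤ n) {Q : Rn n → ℝ≥0∞}
    (hQ : AEMeasurable Q volume) {y₀ : Rn n} (h : DivergenceAtFinite Q y₀) :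
    RingIntegralsVanish Q y₀ := by
  have hn1 : (0 : ℝ) < n - 1 := by
    have : (2 : ℝ) ≤ n := by exact_mod_cast hn
    linarith
  have hpow : ∀ x : ℝ≥0∞, (x ^ (1 / ((n : ℝ) - 1))) ^ (n - 1) = x := by
    intro x
    rw [← ENNReal.rpow_natCast, ← ENNReal.rpow_mul, Nat.cast_sub (by omega), Nat.cast_one,
      one_div, inv_mul_cancel₀ hn1.ne', ENNReal.rpow_one]
  obtain ⟨K, hK0, hKt, hK⟩ := exists_lintegral_toSphere_le_sphereMean hn
  set Q' := hQ.mk Q with hQ'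
  have hQm : Measurable Q' := hQ.measurable_mk
  have hcomp : Measurable fun z : ℝ × sphere (0 : Rn n) 1 => Q' (y₀ + z.1 • (z.2 : Rn n)) :=
    hQm.comp (by fun_prop)
  set q : ℝ → ℝ≥0∞ := fun t => ∫⁻ u : sphere (0 : Rn n) 1, Q' (y₀ + t • (u : Rn n))
    ∂(volume : Measure (Rn n)).toSphere with hq
  have hqm : Measurable q := hcomp.lintegral_prod_right'
  set p : ℝ := 1 / ((n : ℝ) - 1) with hp
  have hp0 : 0 ≤ p := by rw [hp]; positivity
  -- The extremal weight: `t ^ (n - 1) * q t * H t ^ (n - 1) ≤ 1`, so in polar coordinates the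
  -- `Q`-integral of `η ^ n` is at most the integral of `η` for every `η ≤ H`.
  set H : ℝ → ℝ≥0∞ := fun t => (ENNReal.ofReal t * q t ^ p)⁻¹ with hH
  have hHm : Measurable H := ((by fun_prop : Measurable ENNReal.ofReal).mul (hqm.pow_const _)).inv
  obtain ⟨δ, hδ, hfin, hinf⟩ := h
  -- The finiteness assumption on `(ε, δ)` pushes the divergence into `(0, ε)`, so the weight can be
  -- supported below any prescribed outer radius.
  have hsmall : ∀ᶠ ε in 𝓝[>] (0 : ℝ), ∫⁻ t in Ioo 0 ε, H t = ⊤ := by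
    filter_upwards [hfin, Ioo_mem_nhdsGT hδ] with ε hε hεδ
    have h1 : divergenceIntegral Q y₀ 0 ε = ⊤ := by
      by_contra hne
      have hle : divergenceIntegral Q y₀ 0 δ ≤
          divergenceIntegral Q y₀ 0 ε + divergenceIntegral Q y₀ ε δ := by
        have : Ioo 0 δ ⊆ Ioc 0 ε ∪ Ioo ε δ := by
          intro t ht
          rcases le_or_gt t ε with h | h
          · exact Or.inl ⟨ht.1, h⟩
          · exact Or.inr ⟨h, ht.2⟩
        refine (lintegral_mono_set this).trans ((lintegral_union_le _ _ _).trans (le_of_eq ?_))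
        rw [divergenceIntegral, divergenceIntegral, setLIntegral_congr Ioo_ae_eq_Ioc.symm]
      rw [hinf, top_le_iff, ENNReal.add_eq_top] at hle
      exact hle.elim hne hε.ne
    have h2 : divergenceIntegral Q y₀ 0 ε ≤ K ^ p * ∫⁻ t in Ioo 0 ε, H t := by
      rw [← lintegral_const_mul' _ _ (ENNReal.rpow_ne_top_of_nonneg hp0 hKt)]
      refine lintegral_mono_ae ?_
      have h3 := ae_restrict_of_ae_restrict_of_subset
        (Ioo_subset_Ioi_self : Ioo (0 : ℝ) ε ⊆ Ioi 0) (ae_ae_polar hn hQ.ae_eq_mk y₀)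
      filter_upwards [h3, ae_restrict_mem measurableSet_Ioo] with t ht ht0
      have h4 : q t ≤ K * sphereMean Q y₀ t := ht.symm.trans_le (hK Q y₀ t ht0.1)
      have hKp0 : K ^ p ≠ 0 := by
        rw [Ne, ENNReal.rpow_eq_zero_iff]
        rintro (⟨h, -⟩ | ⟨h, -⟩)
        exacts [hK0 h, hKt h]
      have hKpt : K ^ p ≠ ⊤ := ENNReal.rpow_ne_top_of_nonneg hp0 hKt
      rw [hH]
      simp only
      calc (ENNReal.ofReal t * sphereMean Q y₀ t ^ p)⁻¹
          = K ^ p * (K ^ p * (ENNReal.ofReal t * sphereMean Q y₀ t ^ p))⁻¹ := by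
            rw [ENNReal.mul_inv (Or.inl hKp0) (Or.inl hKpt), ← mul_assoc,
              ENNReal.mul_inv_cancel hKp0 hKpt, one_mul]
        _ ≤ _ := by
            refine mul_le_mul' le_rfl (ENNReal.inv_le_inv.2 ?_)
            rw [mul_left_comm, ← ENNReal.mul_rpow_of_nonneg _ _ hp0]
            exact mul_le_mul' le_rfl (ENNReal.rpow_le_rpow h4 hp0)
    rw [h1, top_le_iff] at h2
    exact (ENNReal.mul_eq_top.1 h2).elim (fun h => h.2)
      (fun h => absurd h.1 (ENNReal.rpow_ne_top_of_nonneg hp0 hKt))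
  refine ringIntegralsVanish_of_large hn fun r₂ hr₂ => ⟨1, ENNReal.one_ne_top, fun L hL => ?_⟩
  obtain ⟨δ', hδ'inf, hδ'0, hδ'r⟩ := (hsmall.and (Ioo_mem_nhdsGT hr₂)).exists
  set a : ℕ → ℝ := fun j => 1 / ((j : ℝ) + 1) with ha
  have ha0 : ∀ j, 0 < a j := fun j => by rw [ha]; positivity
  -- Truncation in range and height keeps the integrals finite; by monotone convergence they grow to
  -- infinity.
  set η : ℕ → ℝ → ℝ≥0∞ := fun j => (Ioo (a j) δ').indicator fun t => min (H t) (j : ℝ≥0∞) with hη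
  have hηm : ∀ j, Measurable (η j) := fun j => (hHm.min measurable_const).indicator measurableSet_Ioo
  have hmono : Monotone η := by
    intro i j hij t
    have haij : a j ≤ a i := Nat.one_div_le_one_div hij
    refine (indicator_le_indicator_of_subset (Ioo_subset_Ioo_left haij) (fun _ => zero_le) t).trans ?_
    refine indicator_le_indicator ?_
    exact min_le_min le_rfl (by exact_mod_cast hij)
  have hsup : ∀ t ∈ Ioo 0 δ', ⨆ j, η j t = H t := by
    intro t ht
    refine le_antisymm (iSup_le fun j => (indicator_le_self _ _ t).trans (min_le_left _ _)) ?_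
    refine le_of_forall_lt fun c hc => ?_
    obtain ⟨j₁, hj₁⟩ := ENNReal.exists_nat_gt (hc.trans_le le_top).ne
    obtain ⟨j₂, hj₂⟩ := exists_nat_one_div_lt ht.1
    refine lt_of_lt_of_le ?_ (le_iSup (fun j => η j t) (max j₁ j₂))
    have hmem : t ∈ Ioo (a (max j₁ j₂)) δ' :=
      ⟨(Nat.one_div_le_one_div (le_max_right _ _)).trans_lt hj₂, ht.2⟩
    rw [hη]
    simp only
    rw [indicator_of_mem hmem]
    exact lt_min hc (hj₁.trans_le (by exact_mod_cast le_max_left j₁ j₂))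
  have hlim : ⨆ j, ∫⁻ t in Ioo 0 δ', η j t = ⊤ := by
    rw [← lintegral_iSup hηm hmono, ← hδ'inf]
    exact setLIntegral_congr_fun measurableSet_Ioo hsup
  obtain ⟨j, hj⟩ := lt_iSup_iff.1 (hlim ▸ hL.lt_top : L < ⨆ j, ∫⁻ t in Ioo 0 δ', η j t)
  set r₁ : ℝ := min (a j) (r₂ / 2) with hr₁
  have hr₁0 : 0 < r₁ := lt_min (ha0 j) (by linarith)
  have hr₁a : r₁ ≤ a j := min_le_left _ _
  have hint : ∫⁻ t in Ioo r₁ r₂, η j t = ∫⁻ t, η j t := by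
    rw [hη]
    simp only
    rw [setLIntegral_indicator measurableSet_Ioo, lintegral_indicator measurableSet_Ioo,
      inter_eq_left.2 (Ioo_subset_Ioo hr₁a hδ'r.le)]
  have hηle : ∀ t, η j t ≤ H t := fun t => (indicator_le_self _ _ t).trans (min_le_left _ _)
  refine ⟨r₁, hr₁0, (min_le_right _ _).trans_lt (by linarith), η j, hηm j, ?_, ?_, ?_⟩
  · rw [hint]
    exact hj.le.trans (setLIntegral_le_lintegral _ _)
  · rw [hint, hη]
    simp only
    rw [lintegral_indicator measurableSet_Ioo]
    refine ((lintegral_mono fun t => min_le_right _ _).trans_lt ?_).ne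
    rw [setLIntegral_const]
    exact ENNReal.mul_lt_top (ENNReal.natCast_lt_top j) (by simp)
  · rw [one_mul, hint]
    have hgm : Measurable fun y => Q' y * η j ‖y - y₀‖ ^ n :=
      hQm.mul (((hηm j).comp (by fun_prop)).pow_const _)
    calc ∫⁻ y in annulus y₀ r₁ r₂, Q y * η j ‖y - y₀‖ ^ n
        ≤ ∫⁻ y, Q y * η j ‖y - y₀‖ ^ n := setLIntegral_le_lintegral _ _
      _ = ∫⁻ y, Q' y * η j ‖y - y₀‖ ^ n := by
          refine lintegral_congr_ae ?_
          filter_upwards [hQ.ae_eq_mk] with y hy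
          rw [hy]
      _ = ∫⁻ t in Ioi (0 : ℝ), ENNReal.ofReal (t ^ (n - 1)) *
            ∫⁻ u : sphere (0 : Rn n) 1, Q' (y₀ + t • (u : Rn n)) *
              η j ‖y₀ + t • (u : Rn n) - y₀‖ ^ n ∂(volume : Measure (Rn n)).toSphere :=
          lintegral_polar' hn hgm y₀
      _ ≤ ∫⁻ t in Ioi (0 : ℝ), η j t := by
          refine setLIntegral_mono' measurableSet_Ioi fun t (ht : 0 < t) => ?_
          have hnorm : ∀ u : sphere (0 : Rn n) 1, ‖y₀ + t • (u : Rn n) - y₀‖ = t := by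
            intro u
            rw [add_sub_cancel_left, norm_smul, Real.norm_of_nonneg ht.le]; simp
          simp only [hnorm]
          have hsec : Measurable fun u : sphere (0 : Rn n) 1 => Q' (y₀ + t • (u : Rn n)) :=
            hcomp.comp measurable_prodMk_left
          rw [lintegral_mul_const _ hsec]
          have hηn : η j t ^ n = η j t ^ (n - 1) * η j t := by
            rw [← pow_succ, Nat.sub_add_cancel (by omega)]
          have hH1 : ENNReal.ofReal (t ^ (n - 1)) * q t * H t ^ (n - 1) ≤ 1 := by
            have : H t ^ (n - 1) = (ENNReal.ofReal (t ^ (n - 1)) * q t)⁻¹ := by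
              rw [hH]
              simp only
              rw [← ENNReal.inv_pow, mul_pow, hpow, ENNReal.ofReal_pow ht.le]
            rw [this]
            exact ENNReal.mul_inv_le_one _
          calc ENNReal.ofReal (t ^ (n - 1)) * (q t * η j t ^ n)
              = ENNReal.ofReal (t ^ (n - 1)) * q t * η j t ^ (n - 1) * η j t := by
                rw [hηn]; ring
            _ ≤ ENNReal.ofReal (t ^ (n - 1)) * q t * H t ^ (n - 1) * η j t := by
                gcongr
                exact hηle t
            _ ≤ 1 * η j t := mul_le_mul' hH1 le_rfl
            _ = _ := one_mul _
      _ ≤ _ := setLIntegral_le_lintegral _ _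

/-! ### Ring weights for functions of finite mean oscillation -/

/-- The means of a function of bounded mean oscillation over dyadic balls grow at most linearly. -/
theorem exists_dyadic_growth (hn : 2 ≤ n) {Q : Rn n → ℝ≥0∞} (hQ : AEMeasurable Q volume)
    {y₀ : Rn n} (h : FMOAtFinite Q y₀) {r₂ : ℝ} (hr₂ : 0 < r₂) :
    ∃ δ, 0 < δ ∧ δ ≤ r₂ ∧ ∃ M : ℝ≥0∞, M ≠ ⊤ ∧ ∀ k : ℕ,
      ∫⁻ y in ball y₀ (δ * (1 / 2) ^ k), Q y ≤
        (k + 1) * M * ENNReal.ofReal ((δ * (1 / 2) ^ k) ^ n) := by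
  have := nontrivial_Rn hn
  obtain ⟨⟨ε₀, hε₀, hint⟩, hlim⟩ := h
  obtain ⟨C, hlimC, hCt⟩ := exists_between hlim
  have hosc := eventually_lt_of_limsup_lt hlimC
  obtain ⟨ε₁, hε₁, hε₁'⟩ := mem_nhdsGT_iff_exists_Ioo_subset.1 hosc
  set δ : ℝ := min (min ε₀ (ε₁ / 2)) r₂ with hδ
  have hε₁0 : (0 : ℝ) < ε₁ := hε₁
  have hδ0 : 0 < δ := lt_min (lt_min hε₀ (by linarith)) hr₂
  have hδε₀ : δ ≤ ε₀ := (min_le_left _ _).trans (min_le_left _ _)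
  have hδε₁ : δ < ε₁ := ((min_le_left _ _).trans (min_le_right _ _)).trans_lt (by linarith)
  set r : ℕ → ℝ := fun k => δ * (1 / 2) ^ k with hr
  have hr0 : ∀ k, 0 < r k := fun k => by rw [hr]; positivity
  have hrδ : ∀ k, r k ≤ δ := fun k =>
    mul_le_of_le_one_right hδ0.le (pow_le_one₀ (by norm_num) (by norm_num))
  have hrs : ∀ k, r k = 2 * r (k + 1) := fun k => by rw [hr]; simp only; rw [pow_succ]; ring
  have hmono : ∀ k, r (k + 1) ≤ r k := fun k => by rw [hrs k]; linarith [hr0 (k + 1)]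
  have hC : ∀ k, ∫⁻ x in ball y₀ (r k), ‖(Q x).toReal - ⨍ z in ball y₀ (r k), (Q z).toReal‖ₑ ≤
      C * volume (ball y₀ (r k)) := by
    intro k
    have h1 := hε₁' ⟨hr0 k, (hrδ k).trans_lt hδε₁⟩
    exact (ENNReal.div_le_iff (measure_ball_pos _ _ (hr0 k)).ne' measure_ball_lt_top.ne).1
      (le_of_lt h1)
  set V : ℝ≥0∞ := volume (ball (0 : Rn n) 1) with hV
  have hVt : V ≠ ⊤ := measure_ball_lt_top.ne
  have hvol : ∀ k, volume (ball y₀ (r k)) = ENNReal.ofReal (r k ^ n) * V := fun k => by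
    rw [Measure.addHaar_ball _ _ (hr0 k).le, finrank_euclideanSpace_fin]
  have hvol0 : ∀ k, volume (ball y₀ (r k)) ≠ 0 := fun k => (measure_ball_pos _ _ (hr0 k)).ne'
  have hvolt : ∀ k, volume (ball y₀ (r k)) ≠ ⊤ := fun k => measure_ball_lt_top.ne
  have hvs : ∀ k, volume (ball y₀ (r k)) = 2 ^ n * volume (ball y₀ (r (k + 1))) := fun k => by
    rw [hvol, hvol, hrs k, mul_pow, ENNReal.ofReal_mul (by positivity),
      ENNReal.ofReal_pow (by norm_num)]
    simp [mul_assoc]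
  have hfin : ∀ k, ∫⁻ y in ball y₀ (r k), Q y ≠ ⊤ := fun k =>
    ((lintegral_mono_set (ball_subset_ball ((hrδ k).trans hδε₀))).trans_lt hint).ne
  have hQfin : ∀ k, ∀ᵐ y ∂(volume.restrict (ball y₀ (r k))), Q y < ⊤ := fun k =>
    ae_lt_top' hQ.restrict (hfin k)
  set A : ℕ → ℝ≥0∞ := fun k => (∫⁻ y in ball y₀ (r k), Q y) / volume (ball y₀ (r k)) with hA
  have hAint : ∀ k, ∫⁻ y in ball y₀ (r k), Q y = A k * volume (ball y₀ (r k)) := fun k =>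
    (ENNReal.div_mul_cancel (hvol0 k) (hvolt k)).symm
  have hofReal : ∀ k, (fun y => ENNReal.ofReal (Q y).toReal) =ᵐ[volume.restrict (ball y₀ (r k))] Q := by
    intro k
    filter_upwards [hQfin k] with y hy
    exact ENNReal.ofReal_toReal hy.ne
  have havg : ∀ k, ENNReal.ofReal (⨍ z in ball y₀ (r k), (Q z).toReal) = A k := by
    intro k
    rw [ofReal_setAverage (integrable_toReal_of_lintegral_ne_top hQ.restrict (hfin k))
      (ae_of_all _ fun _ => ENNReal.toReal_nonneg), lintegral_congr_ae (hofReal k)]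
  -- Passing to the half ball raises the mean by at most the oscillation over the larger ball times
  -- the ratio `2 ^ n` of the volumes.
  have hstep : ∀ k, A (k + 1) ≤ A k + 2 ^ n * C := by
    intro k
    set m := ⨍ z in ball y₀ (r k), (Q z).toReal with hm
    have hpt : ∀ y, ENNReal.ofReal (Q y).toReal ≤ ‖(Q y).toReal - m‖ₑ + ENNReal.ofReal m := by
      intro y
      rw [← ofReal_norm, Real.norm_eq_abs]
      refine le_trans (ENNReal.ofReal_le_ofReal ?_) ENNReal.ofReal_add_le
      linarith [le_abs_self ((Q y).toReal - m)]
    have h1 : A (k + 1) * volume (ball y₀ (r (k + 1))) ≤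
        (A k + 2 ^ n * C) * volume (ball y₀ (r (k + 1))) := by
      calc A (k + 1) * volume (ball y₀ (r (k + 1)))
          = ∫⁻ y in ball y₀ (r (k + 1)), ENNReal.ofReal (Q y).toReal := by
            rw [← hAint, lintegral_congr_ae (hofReal (k + 1))]
        _ ≤ ∫⁻ y in ball y₀ (r (k + 1)), (‖(Q y).toReal - m‖ₑ + ENNReal.ofReal m) :=
            lintegral_mono hpt
        _ = (∫⁻ y in ball y₀ (r (k + 1)), ‖(Q y).toReal - m‖ₑ) +
              A k * volume (ball y₀ (r (k + 1))) := by
            rw [lintegral_add_right _ measurable_const, setLIntegral_const, havg k]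
        _ ≤ C * volume (ball y₀ (r k)) + A k * volume (ball y₀ (r (k + 1))) := by
            refine add_le_add ((lintegral_mono_set (ball_subset_ball (hmono k))).trans (hC k)) le_rfl
        _ = _ := by rw [hvs k]; ring
    exact (ENNReal.mul_le_mul_iff_left (hvol0 _) (hvolt _)).1 h1
  have hgrowth : ∀ k : ℕ, A k ≤ (k + 1) * (A 0 + 2 ^ n * C) := by
    intro k
    induction k with
    | zero => simp
    | succ k ih =>
      calc A (k + 1) ≤ A k + 2 ^ n * C := hstep k
        _ ≤ (k + 1) * (A 0 + 2 ^ n * C) + (A 0 + 2 ^ n * C) := add_le_add ih le_add_self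
        _ = _ := by push_cast; ring
  refine ⟨δ, hδ0, min_le_right _ _, (A 0 + 2 ^ n * C) * V, ?_, fun k => ?_⟩
  · refine ENNReal.mul_ne_top (ENNReal.add_ne_top.2 ⟨ENNReal.div_ne_top (hfin 0) (hvol0 0), ?_⟩) hVt
    exact ENNReal.mul_ne_top (by simp) hCt.ne
  · calc ∫⁻ y in ball y₀ (r k), Q y = A k * (ENNReal.ofReal (r k ^ n) * V) := by
          rw [hAint, hvol]
      _ ≤ (k + 1) * (A 0 + 2 ^ n * C) * (ENNReal.ofReal (r k ^ n) * V) :=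
          mul_le_mul' (hgrowth k) le_rfl
      _ = _ := by ring

/-- Finite mean oscillation implies the vanishing of the ring integrals. -/
theorem ringIntegralsVanish_of_fmo (hn : 2 ≤ n) {Q : Rn n → ℝ≥0∞} (hQ : AEMeasurable Q volume)
    {y₀ : Rn n} (h : FMOAtFinite Q y₀) : RingIntegralsVanish Q y₀ := by
  refine ringIntegralsVanish_of_large hn fun r₂ hr₂ => ?_
  obtain ⟨δ, hδ, hδr, M, hM, hgrowth⟩ := exists_dyadic_growth hn hQ h hr₂
  refine ⟨2 * M, ENNReal.mul_ne_top (by simp) hM, fun L hL => ?_⟩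
  set r : ℕ → ℝ := fun k => δ * (1 / 2) ^ k with hr
  have hr0 : ∀ k, 0 < r k := fun k => by rw [hr]; positivity
  have hrs : ∀ k, r k = 2 * r (k + 1) := fun k => by rw [hr]; simp only; rw [pow_succ]; ring
  have hanti : Antitone r := antitone_nat_of_succ_le fun k => by
    rw [hrs k]; linarith [hr0 (k + 1)]
  have hrδ : ∀ k, r k ≤ δ := fun k => by simpa [hr] using hanti (Nat.zero_le k)
  obtain ⟨N, hN⟩ : ∃ N : ℕ, 2 * L.toReal + 1 ≤ ∑ k ∈ Finset.range N, 1 / ((k : ℝ) + 1) :=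
    (Real.tendsto_sum_range_one_div_nat_succ_atTop.eventually_ge_atTop _).exists
  set I : ℕ → Set ℝ := fun k => Ico (r (k + 1)) (r k) with hI
  have hdisj : Pairwise (Function.onFun Disjoint I) := hanti.pairwise_disjoint_on_Ico_succ
  -- A dyadic version of the weight `1 / (t log (1 / t))`. The `k`-th shell contributes `1 / (2 (k +
  -- 1))` to the integral, a divergent series, while the growth of the means bounds its contribution
  -- to the `Q`-integral by `M (k + 1) ^ (1 - n) ≤ M / (k + 1)`; hence the constant `2 * M`.
  set c : ℕ → ℝ≥0∞ := fun k => ENNReal.ofReal (1 / (((k : ℝ) + 1) * r k)) with hc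
  set η : ℝ → ℝ≥0∞ := fun t => ∑ k ∈ Finset.range N, (I k).indicator (fun _ => c k) t with hη
  have hηm : Measurable η := Finset.measurable_fun_sum _ fun k _ =>
    measurable_const.indicator measurableSet_Ico
  have hηn : ∀ t, η t ^ n = ∑ k ∈ Finset.range N, (I k).indicator (fun _ => c k ^ n) t := by
    intro t
    by_cases hex : ∃ k ∈ Finset.range N, t ∈ I k
    · obtain ⟨k, hk, htk⟩ := hex
      have hne : ∀ j ∈ Finset.range N, j ≠ k → t ∉ I j := fun j _ hjk htj =>
        (disjoint_left.1 (hdisj hjk)) htj htk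
      rw [hη]
      simp only
      rw [Finset.sum_eq_single_of_mem k hk fun j hj hjk => indicator_of_notMem (hne j hj hjk) _,
        Finset.sum_eq_single_of_mem k hk fun j hj hjk => indicator_of_notMem (hne j hj hjk) _,
        indicator_of_mem htk, indicator_of_mem htk]
    · push Not at hex
      rw [hη]
      simp only
      rw [Finset.sum_eq_zero fun j hj => indicator_of_notMem (hex j hj) _,
        Finset.sum_eq_zero fun j hj => indicator_of_notMem (hex j hj) _, zero_pow (by omega)]
  set H : ℝ≥0∞ := ∑ k ∈ Finset.range N, ENNReal.ofReal (1 / ((k : ℝ) + 1)) with hH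
  have hHeq : H = ENNReal.ofReal (∑ k ∈ Finset.range N, 1 / ((k : ℝ) + 1)) := by
    rw [hH, ENNReal.ofReal_sum_of_nonneg fun k _ => by positivity]
  have hcI : ∀ k, c k * volume (I k) = ENNReal.ofReal (1 / ((k : ℝ) + 1)) / 2 := by
    intro k
    have h1 := hr0 k
    rw [hc, hI]
    simp only
    rw [Real.volume_Ico, ← ENNReal.ofReal_mul (by positivity),
      ← ENNReal.ofReal_ofNat 2, ← ENNReal.ofReal_div_of_pos (by norm_num)]
    congr 1
    have : r k - r (k + 1) = r k / 2 := by rw [hrs k]; ring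
    rw [this]; field_simp
  -- The inner radius is `r N / 2` because the last half-open shell contains `r N`.
  have hint : ∫⁻ t in Ioo (r N / 2) r₂, η t = H / 2 := by
    rw [div_eq_mul_inv H 2, hH, Finset.sum_mul, hη,
      lintegral_finsetSum _ fun k _ => measurable_const.indicator measurableSet_Ico]
    refine Finset.sum_congr rfl fun k hk => ?_
    have hsub : I k ⊆ Ico (r N) r₂ := Ico_subset_Ico
      (hanti (Nat.succ_le_of_lt (Finset.mem_range.1 hk))) ((hrδ k).trans hδr)
    have hsub' : I k ⊆ Ioo (r N / 2) r₂ := fun t ht =>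
      ⟨by linarith [(hsub ht).1, hr0 N], (hsub ht).2⟩
    rw [setLIntegral_indicator measurableSet_Ico, inter_eq_left.2 hsub', setLIntegral_const, hcI,
      div_eq_mul_inv]
  refine ⟨r N / 2, by linarith [hr0 N], by linarith [hrδ N, hr0 N], η, hηm, ?_, ?_, ?_⟩
  · rw [hint, hHeq, ENNReal.le_div_iff_mul_le (by simp) (by simp), ← ENNReal.ofReal_toReal hL,
      ← ENNReal.ofReal_ofNat 2, ← ENNReal.ofReal_mul ENNReal.toReal_nonneg]
    refine ENNReal.ofReal_le_ofReal ?_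
    linarith
  · rw [hint, hHeq]
    exact ENNReal.div_ne_top ENNReal.ofReal_ne_top (by simp)
  · rw [hint]
    have hterm : ∀ k, AEMeasurable
        (fun y : Rn n => Q y * (I k).indicator (fun _ => c k ^ n) ‖y - y₀‖) volume := fun k =>
      hQ.mul ((measurable_const.indicator measurableSet_Ico).comp (by fun_prop)).aemeasurable
    calc ∫⁻ y in annulus y₀ (r N / 2) r₂, Q y * η ‖y - y₀‖ ^ n
        ≤ ∫⁻ y, Q y * η ‖y - y₀‖ ^ n := setLIntegral_le_lintegral _ _
      _ = ∫⁻ y, ∑ k ∈ Finset.range N, Q y * (I k).indicator (fun _ => c k ^ n) ‖y - y₀‖ := by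
          refine lintegral_congr fun y => ?_
          rw [hηn, Finset.mul_sum]
      _ = ∑ k ∈ Finset.range N, ∫⁻ y, Q y * (I k).indicator (fun _ => c k ^ n) ‖y - y₀‖ :=
          lintegral_finsetSum' _ fun k _ => hterm k
      _ ≤ ∑ k ∈ Finset.range N, M * ENNReal.ofReal (1 / ((k : ℝ) + 1)) := by
          refine Finset.sum_le_sum fun k _ => ?_
          have hcn : c k ^ n ≠ ⊤ := ENNReal.pow_ne_top ENNReal.ofReal_ne_top
          calc ∫⁻ y, Q y * (I k).indicator (fun _ => c k ^ n) ‖y - y₀‖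
              ≤ ∫⁻ y, (ball y₀ (r k)).indicator (fun y => c k ^ n * Q y) y := by
                refine lintegral_mono fun y => ?_
                by_cases hy : ‖y - y₀‖ ∈ I k
                · have hyb : y ∈ ball y₀ (r k) := by rw [mem_ball, dist_eq_norm]; exact hy.2
                  rw [indicator_of_mem hy, indicator_of_mem hyb, mul_comm]
                · rw [indicator_of_notMem hy, mul_zero]; exact zero_le
            _ = c k ^ n * ∫⁻ y in ball y₀ (r k), Q y := by
                rw [lintegral_indicator measurableSet_ball, lintegral_const_mul' _ _ hcn]
            _ ≤ c k ^ n * ((k + 1) * M * ENNReal.ofReal (r k ^ n)) :=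
                mul_le_mul' le_rfl (hgrowth k)
            _ = M * (c k ^ n * (k + 1) * ENNReal.ofReal (r k ^ n)) := by ring
            _ ≤ _ := by
                refine mul_le_mul' le_rfl ?_
                have hk1 : ((k : ℝ≥0∞) + 1) = ENNReal.ofReal ((k : ℝ) + 1) := by
                  rw [ENNReal.ofReal_add (by positivity) (by norm_num)]; simp
                have h1 := hr0 k
                rw [hk1, hc]
                simp only
                rw [← ENNReal.ofReal_pow (by positivity), ← ENNReal.ofReal_mul (by positivity),
                  ← ENNReal.ofReal_mul (by positivity)]
                refine ENNReal.ofReal_le_ofReal ?_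
                have hk : (1 : ℝ) ≤ (k : ℝ) + 1 := by linarith [(Nat.cast_nonneg k : (0 : ℝ) ≤ k)]
                have h2 : ((k : ℝ) + 1) ^ 2 ≤ ((k : ℝ) + 1) ^ n := pow_le_pow_right₀ hk hn
                have h3 : (1 / (((k : ℝ) + 1) * r k)) ^ n * ((k : ℝ) + 1) * r k ^ n =
                    ((k : ℝ) + 1) / ((k : ℝ) + 1) ^ n := by
                  rw [div_pow, mul_pow, one_pow]; field_simp
                rw [h3, div_le_div_iff₀ (by positivity) (by positivity)]
                nlinarith
      _ = M * H := by rw [hH, Finset.mul_sum]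
      _ = 2 * M * (H / 2) := by
          rw [mul_comm 2 M, mul_assoc, ENNReal.mul_div_cancel (by simp) (by simp)]

/-- The inversion preserves almost everywhere measurability. -/
theorem aemeasurable_comp_invert (hn : 2 ≤ n) {Q : Rn n → ℝ≥0∞} (hQ : AEMeasurable Q volume) :
    AEMeasurable (Q ∘ invert) volume := by
  have := nontrivial_Rn hn
  have hm : Measurable (invert : Rn n → Rn n) := by unfold invert; fun_prop
  refine hQ.comp_quasiMeasurePreserving ⟨hm, ?_⟩
  refine Measure.AbsolutelyContinuous.mk fun s hs hs0 => ?_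
  rw [Measure.map_apply hm hs]
  have hinv : ∀ y : Rn n, y ≠ 0 → invert (invert y) = y := by
    intro y hy
    have h0 : ‖y‖ ≠ 0 := norm_ne_zero_iff.2 hy
    unfold invert
    rw [norm_smul, norm_inv, norm_pow, norm_norm, smul_smul]
    have : ((((‖y‖ ^ 2)⁻¹ * ‖y‖) ^ 2)⁻¹ * (‖y‖ ^ 2)⁻¹) = 1 := by field_simp
    rw [this, one_smul]
  have hinv0 : ∀ y : Rn n, y ≠ 0 → invert y ≠ 0 := by
    intro y hy
    unfold invert
    exact smul_ne_zero (inv_ne_zero (pow_ne_zero _ (norm_ne_zero_iff.2 hy))) hy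
  -- The inversion is an involution off the origin, so the preimage of a null set is, up to the
  -- origin, its image under a differentiable map, hence null.
  have hsub : invert ⁻¹' s ⊆ {0} ∪ invert '' (s ∩ {0}ᶜ) := by
    intro y hy
    by_cases h : y = 0
    · exact Or.inl h
    · exact Or.inr ⟨invert y, ⟨hy, hinv0 y h⟩, hinv y h⟩
  refine measure_mono_null hsub (measure_union_null (measure_singleton 0) ?_)
  refine addHaar_image_eq_zero_of_differentiableOn_of_addHaar_eq_zero volume ?_
    (measure_mono_null inter_subset_left hs0)
  intro x hx
  have hx0 : x ≠ 0 := hx.2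
  have : DifferentiableAt ℝ (fun y : Rn n => (‖y‖ ^ 2)⁻¹ • y) x := by
    have h1 : DifferentiableAt ℝ (fun y : Rn n => ‖y‖ ^ 2) x :=
      (differentiable_id.norm_sq ℝ) x
    exact (h1.inv (pow_ne_zero _ (norm_ne_zero_iff.2 hx0))).smul differentiableAt_id
  exact this.differentiableWithinAt

/-! ### The topology of the extended space -/

theorem mem_nhds_coe {N : Set (RnBar n)} {y : Rn n} (h : N ∈ 𝓝 (y : RnBar n)) :
    ∃ r, 0 < r ∧ ∀ z : Rn n, ‖z - y‖ ≤ r → (z : RnBar n) ∈ N := by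
  rw [OnePoint.nhds_coe_eq, mem_map] at h
  obtain ⟨r, hr, hsub⟩ := Metric.nhds_basis_closedBall.mem_iff.1 h
  exact ⟨r, hr, fun z hz => hsub (by rwa [mem_closedBall, dist_eq_norm])⟩

theorem mem_nhds_infty {N : Set (RnBar n)} (h : N ∈ 𝓝 (OnePoint.infty : RnBar n)) :
    ∃ R, 0 < R ∧ ∀ z : Rn n, R ≤ ‖z‖ → (z : RnBar n) ∈ N := by
  have h' := OnePoint.tendsto_coe_infty h
  rw [coclosedCompact_eq_cocompact, ← Metric.cobounded_eq_cocompact, mem_map] at h'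
  obtain ⟨R, -, hR⟩ := hasBasis_cobounded_norm.mem_iff.1 h'
  exact ⟨max R 1, by positivity, fun z hz => hR ((le_max_left _ _).trans hz)⟩

theorem isOpen_coe_ball (y : Rn n) (r : ℝ) :
    IsOpen {z : RnBar n | ∃ x : Rn n, (x : RnBar n) = z ∧ ‖x - y‖ < r} := by
  have : {z : RnBar n | ∃ x : Rn n, (x : RnBar n) = z ∧ ‖x - y‖ < r} =
      (fun x : Rn n => (x : RnBar n)) '' ball y r := by
    ext z
    simp only [mem_ofPred_eq, mem_image, mem_ball, dist_eq_norm]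
    exact ⟨fun ⟨x, h1, h2⟩ => ⟨x, h2, h1⟩, fun ⟨x, h2, h1⟩ => ⟨x, h1, h2⟩⟩
  rw [this]
  exact OnePoint.isOpenMap_coe _ isOpen_ball

theorem isOpen_compl_coe_closedBall (R : ℝ) :
    IsOpen ((fun x : Rn n => (x : RnBar n)) '' closedBall 0 R)ᶜ :=
  OnePoint.isOpen_compl_image_coe.2 ⟨isClosed_closedBall, isCompact_closedBall 0 R⟩

theorem coe_mem_toExt {S : Set (Rn n)} {x : Rn n} : (x : RnBar n) ∈ toExt S ↔ x ∈ S :=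
  OnePoint.coe_injective.mem_set_image

theorem isOpen_toExt {S : Set (Rn n)} (hS : IsOpen S) : IsOpen (toExt S) :=
  OnePoint.isOpenMap_coe _ hS

/-- Otherwise the interior of `V` and the complement of its closure would separate `E`. This
converts the frontier conditions in `WeaklyFlatBoundary` into conditions on entering and leaving
neighbourhoods. -/
theorem IsConnected.inter_frontier {X : Type*} [TopologicalSpace X] {E V : Set X}
    (hE : IsPreconnected E) (h1 : (E ∩ V).Nonempty) (h2 : (E ∩ Vᶜ).Nonempty) :
    (E ∩ frontier V).Nonempty := by
  by_contra hcon
  rw [not_nonempty_iff_eq_empty] at hcon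
  have hnot : ∀ x ∈ E, x ∉ frontier V := fun x hx hf => by
    have : x ∈ E ∩ frontier V := ⟨hx, hf⟩
    rw [hcon] at this; exact this
  have hin : ∀ x ∈ E, x ∈ V → x ∈ interior V := fun x hx hV => by
    by_contra h; exact hnot x hx ⟨subset_closure hV, h⟩
  have hout : ∀ x ∈ E, x ∉ V → x ∈ (closure V)ᶜ := fun x hx hV h =>
    hnot x hx ⟨h, fun hi => hV (interior_subset hi)⟩
  obtain ⟨x, hxE, hxV⟩ := h1
  obtain ⟨z, hzE, hzV⟩ := h2
  obtain ⟨w, -, hw1, hw2⟩ := hE (interior V) (closure V)ᶜ isOpen_interior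
    isClosed_closure.isOpen_compl
    (fun w hw => (em (w ∈ V)).imp (hin w hw) (hout w hw))
    ⟨x, hxE, hin x hxE hxV⟩ ⟨z, hzE, hout z hzE hzV⟩
  exact hw2 (subset_closure (interior_subset hw1))

/-- Two points of a connected open set are joined by a path, and this path is a continuum. -/
theorem exists_path_continuum {C : Set (Rn n)} (hC : IsOpen C) (hpre : IsPreconnected C)
    {x z : Rn n} (hx : x ∈ C) (hz : z ∈ C) :
    ∃ p : ℝ → Rn n, Continuous p ∧ p 0 = x ∧ p 1 = z ∧ p '' Icc 0 1 ⊆ C ∧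
      IsContinuumSet (p '' Icc 0 1) := by
  have hpath := hC.isConnected_iff_isPathConnected.1 ⟨⟨x, hx⟩, hpre⟩
  have hj := hpath.joinedIn x hx z hz
  set γ := hj.somePath with hγ
  have hcont : Continuous γ.extend := γ.extend.continuous
  refine ⟨γ.extend, hcont, γ.extend_zero, γ.extend_one, ?_,
    isCompact_Icc.image hcont, (isConnected_Icc zero_le_one).image _ hcont.continuousOn⟩
  rintro _ ⟨t, ht, rfl⟩
  rw [γ.extend_apply ht]
  exact hj.somePath_mem ⟨t, ht⟩

/-- Adjoining a limit point keeps a set connected, so components are relatively closed. -/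
theorem closure_connectedComponentIn_inter {X : Type*} [TopologicalSpace X] {F : Set X} {x z : X}
    (hz : z ∈ closure (connectedComponentIn F x)) (hzF : z ∈ F) (hx : x ∈ F) :
    z ∈ connectedComponentIn F x := by
  have hpre : IsPreconnected (insert z (connectedComponentIn F x)) :=
    isPreconnected_connectedComponentIn.subset_closure (subset_insert _ _)
      (insert_subset hz subset_closure)
  exact hpre.subset_connectedComponentIn (mem_insert_of_mem _ (mem_connectedComponentIn hx))
    (insert_subset hzF (connectedComponentIn_subset _ _)) (mem_insert _ _)

/-! ### The chordal distance and the topology of the extended space -/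

/-- The stereographic embedding of the extended space. -/
noncomputable def stereo (z : RnBar n) : Rn n × ℝ :=
  OnePoint.elim z (0, 0) fun x => ((1 + ‖x‖ ^ 2)⁻¹ • x, (1 + ‖x‖ ^ 2)⁻¹)

theorem stereo_coe (x : Rn n) :
    stereo (x : RnBar n) = ((1 + ‖x‖ ^ 2)⁻¹ • x, (1 + ‖x‖ ^ 2)⁻¹) := rfl

theorem stereo_infty : stereo (OnePoint.infty : RnBar n) = (0, 0) := rfl

theorem continuous_stereo : Continuous (stereo : RnBar n → Rn n × ℝ) := by
  rw [OnePoint.continuous_iff]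
  have hne : ∀ x : Rn n, 1 + ‖x‖ ^ 2 ≠ 0 := fun x => by positivity
  constructor
  · rw [coclosedCompact_eq_cocompact, stereo_infty]
    have h1 : Tendsto (fun x : Rn n => ‖x‖⁻¹) (cocompact (Rn n)) (𝓝 0) :=
      tendsto_inv_atTop_zero.comp tendsto_norm_cocompact_atTop
    have hev : ∀ᶠ x : Rn n in cocompact (Rn n), 1 ≤ ‖x‖ :=
      tendsto_norm_cocompact_atTop.eventually_ge_atTop 1
    refine Tendsto.prodMk_nhds ?_ ?_
    · refine squeeze_zero_norm' ?_ h1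
      filter_upwards [hev] with x hx
      rw [norm_smul, norm_inv, Real.norm_of_nonneg (by positivity), inv_mul_le_iff₀ (by positivity)]
      field_simp
      nlinarith
    · refine squeeze_zero_norm' ?_ h1
      filter_upwards [hev] with x hx
      rw [norm_inv, Real.norm_of_nonneg (by positivity)]
      refine inv_anti₀ (by positivity) ?_
      nlinarith
  · simp only [stereo_coe]
    have h : Continuous fun x : Rn n => (1 + ‖x‖ ^ 2)⁻¹ :=
      (continuous_const.add (continuous_norm.pow 2)).inv₀ hne
    exact (h.smul continuous_id).prodMk h

theorem stereo_injective : Function.Injective (stereo : RnBar n → Rn n × ℝ) := by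
  intro z w h
  have hpos : ∀ x : Rn n, (1 + ‖x‖ ^ 2)⁻¹ ≠ 0 := fun x => by positivity
  induction z using OnePoint.rec with
  | infty =>
    induction w using OnePoint.rec with
    | infty => rfl
    | coe y =>
      rw [stereo_infty, stereo_coe, Prod.mk.injEq] at h
      exact absurd h.2.symm (hpos y)
  | coe x =>
    induction w using OnePoint.rec with
    | infty =>
      rw [stereo_infty, stereo_coe, Prod.mk.injEq] at h
      exact absurd h.2 (hpos x)
    | coe y =>
      rw [stereo_coe, stereo_coe, Prod.mk.injEq] at h
      obtain ⟨h1, h2⟩ := h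
      rw [h2] at h1
      rw [smul_right_injective _ (hpos y) h1]

/-- The first component is split into the change of the vector, weighted at `x`, and the change of
the weight, applied to `y`. Ordering the norms gives `B ≤ A`, so that the weight `A⁻²` is at most
`(A * B)⁻¹`. -/
theorem dist_stereo_le_aux {x y : Rn n} (hxy : ‖y‖ ≤ ‖x‖) :
    dist (stereo (x : RnBar n)) (stereo (y : RnBar n)) ≤ 3 * chordalDist x y := by
  rw [stereo_coe, stereo_coe, chordalDist, Prod.dist_eq]
  set a := ‖x‖ with ha
  set b := ‖y‖ with hb
  have ha0 : 0 ≤ a := norm_nonneg x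
  have hb0 : 0 ≤ b := norm_nonneg y
  set A := Real.sqrt (1 + a ^ 2) with hA
  set B := Real.sqrt (1 + b ^ 2) with hB
  have hA0 : 0 < A := Real.sqrt_pos.2 (by positivity)
  have hB0 : 0 < B := Real.sqrt_pos.2 (by positivity)
  have hA2 : A ^ 2 = 1 + a ^ 2 := Real.sq_sqrt (by positivity)
  have hB2 : B ^ 2 = 1 + b ^ 2 := Real.sq_sqrt (by positivity)
  have haA : a ≤ A := Real.le_sqrt_of_sq_le (by linarith)
  have hbB : b ≤ B := Real.le_sqrt_of_sq_le (by linarith)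
  have hA1 : 1 ≤ A := Real.le_sqrt_of_sq_le (by nlinarith)
  have hBA : B ≤ A := Real.sqrt_le_sqrt (by nlinarith)
  have hab : |a - b| ≤ ‖x - y‖ := abs_norm_sub_norm_le x y
  set d := ‖x - y‖ with hd
  have hd0 : 0 ≤ d := norm_nonneg _
  have hinv : |(1 + a ^ 2)⁻¹ - (1 + b ^ 2)⁻¹| ≤ (a + b) * d / (A ^ 2 * B ^ 2) := by
    rw [← hA2, ← hB2]
    have : (A ^ 2)⁻¹ - (B ^ 2)⁻¹ = (B ^ 2 - A ^ 2) / (A ^ 2 * B ^ 2) := by field_simp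
    rw [this, abs_div, abs_of_pos (by positivity : 0 < A ^ 2 * B ^ 2)]
    refine div_le_div_of_nonneg_right ?_ (by positivity)
    have h2 : B ^ 2 - A ^ 2 = -((a + b) * (a - b)) := by rw [hA2, hB2]; ring
    rw [h2, abs_neg, abs_mul, abs_of_nonneg (by positivity : 0 ≤ a + b)]
    gcongr
  refine max_le ?_ ?_
  · rw [dist_eq_norm]
    have h1 : (1 + a ^ 2)⁻¹ • x - (1 + b ^ 2)⁻¹ • y =
        (1 + a ^ 2)⁻¹ • (x - y) + ((1 + a ^ 2)⁻¹ - (1 + b ^ 2)⁻¹) • y := by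
      rw [smul_sub, sub_smul]; abel
    rw [h1]
    refine (norm_add_le _ _).trans ?_
    rw [norm_smul, norm_smul, norm_inv, Real.norm_of_nonneg (by positivity : 0 ≤ 1 + a ^ 2),
      Real.norm_eq_abs]
    have h2 : (1 + a ^ 2)⁻¹ * d ≤ d / (A * B) := by
      rw [← hA2, inv_mul_eq_div]
      refine div_le_div_of_nonneg_left hd0 (by positivity) ?_
      nlinarith
    have h3 : |(1 + a ^ 2)⁻¹ - (1 + b ^ 2)⁻¹| * b ≤ 2 * (d / (A * B)) := by
      refine (mul_le_mul_of_nonneg_right hinv hb0).trans ?_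
      rw [div_mul_eq_mul_div, ← mul_div_assoc, div_le_div_iff₀ (by positivity) (by positivity)]
      have h4 : (a + b) * b ≤ 2 * (A * B) := by nlinarith [mul_le_mul haA hbB hb0 hA0.le]
      have h5 : 0 ≤ d * (A * B) := by positivity
      nlinarith [mul_le_mul_of_nonneg_right h4 h5]
    calc _ ≤ d / (A * B) + 2 * (d / (A * B)) := add_le_add h2 h3
      _ = _ := by ring
  · rw [Real.dist_eq]
    refine hinv.trans ?_
    rw [← mul_div_assoc, div_le_div_iff₀ (by positivity) (by positivity)]
    have h4 : a + b ≤ 2 * (A * B) := by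
      have hB1 : 1 ≤ B := Real.le_sqrt_of_sq_le (by nlinarith)
      nlinarith [mul_le_mul haA hB1 zero_le_one hA0.le, mul_le_mul hA1 hbB hb0 hA0.le]
    have h5 : 0 ≤ d * (A * B) := by positivity
    have h6 : 0 ≤ d * (A * B) * (A * B) := by positivity
    nlinarith [mul_le_mul_of_nonneg_right h4 h5]

theorem chordalDist_comm (x y : Rn n) : chordalDist x y = chordalDist y x := by
  rw [chordalDist, chordalDist, norm_sub_rev, mul_comm (Real.sqrt (1 + ‖x‖ ^ 2))]

theorem dist_stereo_le (x y : Rn n) :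
    dist (stereo (x : RnBar n)) (stereo (y : RnBar n)) ≤ 3 * chordalDist x y := by
  rcases le_total ‖y‖ ‖x‖ with h | h
  · exact dist_stereo_le_aux h
  · rw [dist_comm, chordalDist_comm]; exact dist_stereo_le_aux h

/-- Points at a small chordal distance from a compact subset of an open set lie in this open set. -/
theorem exists_forall_mem_of_chordalDist_lt {K O : Set (RnBar n)} (hK : IsCompact K)
    (hO : IsOpen O) (hKO : K ⊆ O) : ∃ ε, 0 < ε ∧ ∀ x y : Rn n, chordalDist x y < ε →
      (x : RnBar n) ∈ K → (y : RnBar n) ∈ O := by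
  have hcl : IsClosed (stereo '' Oᶜ) :=
    (hO.isClosed_compl.isCompact.image continuous_stereo).isClosed
  have hdisj : Disjoint (stereo '' K) (stereo '' Oᶜ) :=
    (disjoint_image_iff stereo_injective).2 (disjoint_compl_right.mono_left hKO)
  obtain ⟨r, hr, hr'⟩ := Metric.exists_pos_forall_lt_edist (hK.image continuous_stereo) hcl hdisj
  refine ⟨r / 3, by positivity, fun x y hxy hx => ?_⟩
  by_contra hy
  have h1 := hr' _ ⟨_, hx, rfl⟩ _ ⟨_, hy, rfl⟩
  rw [edist_nndist, ENNReal.coe_lt_coe, ← NNReal.coe_lt_coe, coe_nndist] at h1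
  have h2 := dist_stereo_le x y
  linarith

/-- The form in which uniform convergence is used below: one index `m` serves for all points of `D`,
and information passes both from `f` to `fm m` and back. -/
theorem ChordalTendstoUniformlyOn.eventually_mem {fm : ℕ → Rn n → Rn n} {f : Rn n → Rn n}
    {D : Set (Rn n)} (h : ChordalTendstoUniformlyOn fm f D) {K O : Set (RnBar n)}
    (hK : IsCompact K) (hO : IsOpen O) (hKO : K ⊆ O) :
    ∀ᶠ m in atTop, ∀ x ∈ D, ((f x : RnBar n) ∈ K → (fm m x : RnBar n) ∈ O) ∧
      ((fm m x : RnBar n) ∈ K → (f x : RnBar n) ∈ O) := by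
  obtain ⟨ε, hε, hε'⟩ := exists_forall_mem_of_chordalDist_lt hK hO hKO
  filter_upwards [h ε hε] with m hm x hx
  exact ⟨hε' _ _ (by rw [chordalDist_comm]; exact hm x hx), hε' _ _ (hm x hx)⟩

theorem ChordalTendstoUniformlyOn.continuousOn {fm : ℕ → Rn n → Rn n} {f : Rn n → Rn n}
    {D : Set (Rn n)} (h : ChordalTendstoUniformlyOn fm f D) (hcont : ∀ m, ContinuousOn (fm m) D) :
    ContinuousOn f D := by
  rw [OnePoint.isOpenEmbedding_coe.isEmbedding.continuousOn_iff]
  intro x hx N hN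
  obtain ⟨K, hK, hKx, hKN⟩ := exists_compact_subset isOpen_interior (mem_interior_iff_mem_nhds.2 hN)
  obtain ⟨m, hm1, hm2⟩ := ((h.eventually_mem isCompact_singleton isOpen_interior
    (singleton_subset_iff.2 hKx)).and (h.eventually_mem hK isOpen_interior hKN)).exists
  have h1 : ((fm m x : Rn n) : RnBar n) ∈ interior K := (hm1 x hx).1 rfl
  have h2 : ContinuousWithinAt (fun z => (fm m z : RnBar n)) D x :=
    (OnePoint.continuous_coe.comp_continuousOn (hcont m)) x hx
  rw [mem_map]
  filter_upwards [h2 (isOpen_interior.mem_nhds h1), self_mem_nhdsWithin] with z hz hzD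
  exact interior_subset (s := N) ((hm2 z hzD).2 (interior_subset hz))

/-! ### Upper bounds for the modulus -/

/-- The vanishing of the ring integrals at a point of the extended space. -/
def RingIntegralsVanishAt (Q : Rn n → ℝ≥0∞) (y₀ : RnBar n) : Prop :=
  (∀ y : Rn n, y₀ = (y : RnBar n) → RingIntegralsVanish Q y) ∧
  (y₀ = OnePoint.infty → RingIntegralsVanish (Q ∘ invert) 0)

theorem norm_invert (y : Rn n) : ‖invert y‖ = ‖y‖⁻¹ := by
  rw [invert, norm_smul, norm_inv, norm_pow, norm_norm]
  rcases eq_or_ne ‖y‖ 0 with h | h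
  · rw [h]; simp
  · field_simp

theorem Curve.mem_of_curvesJoining {D E F : Set (Rn n)} (hE : E ⊆ D) (hF : F ⊆ D) {γ : Curve n}
    (hγ : γ ∈ curvesJoining E F D) {t : ℝ} (ht : t ∈ Icc γ.a γ.b) : γ.toFun t ∈ D := by
  rcases ht.1.eq_or_lt with h | h
  · rw [← h]; exact hE hγ.1
  · rcases ht.2.eq_or_lt with h' | h'
    · rw [h']; exact hF hγ.2.1
    · exact hγ.2.2 t ⟨h, h'⟩

/-- Every curve of the family contains a subcurve whose image crosses the ring, so the pulled back
family has at least as large a modulus. Stated for a general `g` in order to apply also to a map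
followed by the inversion. -/
theorem modulus_le_of_poletsky {g : Rn n → Rn n} {D E F : Set (Rn n)} {Q : Rn n → ℝ≥0∞} {y₀ : Rn n}
    {r₁ r₂ : ℝ} (hr₁ : 0 < r₁) (hr₁₂ : r₁ < r₂) (hg : InversePoletskyAtFinite g D Q y₀)
    (hout : ∃ y ∈ g '' D, r₂ < ‖y - y₀‖) {η : ℝ → ℝ≥0∞}
    (hη : AEMeasurable η (volume.restrict (Ioo r₁ r₂))) (hη1 : 1 ≤ ∫⁻ r in Ioo r₁ r₂, η r)
    {ε : ℝ≥0∞} (hε : ∫⁻ y in annulus y₀ r₁ r₂, Q y * η ‖y - y₀‖ ^ n ≤ ε)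
    (hE : E ⊆ D) (hF : F ⊆ D)
    (hcross : ∀ γ ∈ curvesJoining E F D, ∃ a' b', a' < b' ∧ γ.a ≤ a' ∧ b' ≤ γ.b ∧
      ‖g (γ.toFun a') - y₀‖ = r₁ ∧ ‖g (γ.toFun b') - y₀‖ = r₂ ∧
        ∀ t ∈ Ioo a' b', ‖g (γ.toFun t) - y₀‖ ∈ Ioo r₁ r₂) :
    modulus (curvesJoining E F D) ≤ ε := by
  have h1 : modulus (curvesJoining E F D) ≤ modulus (pulledBackCurves g D y₀ r₁ r₂) := by
    refine modulus_le_of_subcurves fun γ hγ => ?_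
    obtain ⟨a', b', hab, ha, hb, h1, h2, h3⟩ := hcross γ hγ
    refine ⟨a', b', hab, ha, hb, fun t ht => ?_, ?_, ?_, fun t ht => h3 t ht⟩
    · exact Curve.mem_of_curvesJoining hE hF hγ ⟨ha.trans ht.1, ht.2.trans hb⟩
    · rw [mem_sphere, dist_eq_norm]; exact h1
    · rw [mem_sphere, dist_eq_norm]; exact h2
  exact h1.trans ((hg r₁ r₂ hr₁ hr₁₂ hout η hη hη1).trans
    ((lintegral_mono_set inter_subset_left).trans hε))

/-- If the ring integrals vanish at `y₀`, the curves joining a set mapped close to `y₀` to a set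
mapped away from `y₀` form a family of small modulus. -/
theorem exists_nhds_modulus_le (hn : 2 ≤ n) {D D' : Set (Rn n)} (hD' : IsOpen D') {Q : Rn n → ℝ≥0∞}
    {y₀ : RnBar n} (hvan : RingIntegralsVanishAt Q y₀) {N : Set (RnBar n)} (hN : N ∈ 𝓝 y₀)
    {ε : ℝ≥0∞} (hε : ε ≠ 0) :
    ∃ N₁ ∈ 𝓝 y₀, IsOpen N₁ ∧ N₁ ⊆ N ∧ ∀ (g : Rn n → Rn n), ContinuousOn g D → g '' D = D' →
      InversePoletskyAt g D Q y₀ → ∀ E F : Set (Rn n), E ⊆ D → F ⊆ D → F.Nonempty →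
        (∀ x ∈ E, (g x : RnBar n) ∈ N₁) → (∀ x ∈ F, (g x : RnBar n) ∉ N) →
          modulus (curvesJoining E F D) ≤ ε := by
  have := nontrivial_Rn hn
  induction y₀ using OnePoint.rec with
  | coe y =>
    obtain ⟨r₂, hr₂, hr₂N⟩ := mem_nhds_coe hN
    -- The ring and the weight come from `Q` alone, which makes `N₁` independent of the map `g`.
    obtain ⟨r₁, hr₁, hr₁₂, η, hη, hη1, hηε⟩ := hvan.1 y rfl r₂ hr₂ ε hε
    refine ⟨_, (isOpen_coe_ball y r₁).mem_nhds ⟨y, rfl, by simpa using hr₁⟩, isOpen_coe_ball y r₁, ?_,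
      fun g hg himage hPol E F hE hF hFne hgE hgF => ?_⟩
    · rintro _ ⟨x, rfl, hx⟩
      exact hr₂N x (hx.le.trans hr₁₂.le)
    · have hF' : ∀ x ∈ F, r₂ < ‖g x - y‖ := fun x hx => by
        by_contra h; exact hgF x hx (hr₂N _ (not_lt.1 h))
      have hE' : ∀ x ∈ E, ‖g x - y‖ < r₁ := fun x hx => by
        obtain ⟨z, hz, hz'⟩ := hgE x hx
        rwa [OnePoint.coe_injective hz] at hz'
      obtain ⟨x, hx⟩ := hFne
      refine modulus_le_of_poletsky hr₁ hr₁₂ (hPol.1 y rfl) ⟨_, ⟨x, hF hx, rfl⟩, hF' x hx⟩ hη hη1 hηε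
        hE hF fun γ hγ => ?_
      have hc : ContinuousOn (fun t => ‖g (γ.toFun t) - y‖) (Icc γ.a γ.b) :=
        ((hg.comp γ.cont fun t ht => Curve.mem_of_curvesJoining hE hF hγ ht).sub
          continuousOn_const).norm
      exact exists_crossing γ.lt.le hc hr₁₂ (hE' _ hγ.1).le (hF' _ hγ.2.1).le
  | infty =>
    obtain ⟨R, hR, hRN⟩ := mem_nhds_infty hN
    obtain ⟨r₁, hr₁, hr₁₂, η, hη, hη1, hηε⟩ := hvan.2 rfl R⁻¹ (inv_pos.2 hR) ε hε
    have hRr : R < r₁⁻¹ := by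
      rw [lt_inv_comm₀ hR hr₁]; exact hr₁₂
    refine ⟨_, (isOpen_compl_coe_closedBall r₁⁻¹).mem_nhds ?_, isOpen_compl_coe_closedBall r₁⁻¹, ?_,
      fun g hg himage hPol E F hE hF hFne hgE hgF => ?_⟩
    · rintro ⟨x, -, hx⟩
      exact OnePoint.coe_ne_infty x hx
    · intro z hz
      induction z using OnePoint.rec with
      | infty => exact mem_of_mem_nhds hN
      | coe z =>
        refine hRN z ?_
        by_contra h
        exact hz ⟨z, by rw [mem_closedBall, dist_zero_right]; linarith, rfl⟩
    · have hF' : ∀ x ∈ F, ‖g x‖ < R := fun x hx => by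
        by_contra h; exact hgF x hx (hRN _ (not_lt.1 h))
      have hE' : ∀ x ∈ E, r₁⁻¹ < ‖g x‖ := fun x hx => by
        by_contra h
        exact hgE x hx ⟨g x, by rw [mem_closedBall, dist_zero_right]; exact not_lt.1 h, rfl⟩
      obtain ⟨x, hx⟩ := hFne
      -- The value `g x` may be zero, where `invert` has the default value `0`; openness of `D'`
      -- supplies a nonzero value of norm less than `R`.
      have hout : ∃ y ∈ (invert ∘ g) '' D, R⁻¹ < ‖y - 0‖ := by
        have hopen : IsOpen (D' ∩ ball 0 R) := hD'.inter isOpen_ball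
        have hmem : g x ∈ D' ∩ ball 0 R := by
          refine ⟨himage ▸ mem_image_of_mem g (hF hx), ?_⟩
          rw [mem_ball, dist_zero_right]; exact hF' x hx
        obtain ⟨z, ⟨hzD, hzR⟩, hz0⟩ :=
          (dense_compl_singleton (0 : Rn n)).inter_open_nonempty _ hopen ⟨_, hmem⟩
        rw [← himage] at hzD
        obtain ⟨w, hw, rfl⟩ := hzD
        refine ⟨_, ⟨w, hw, rfl⟩, ?_⟩
        rw [sub_zero, Function.comp, norm_invert]
        rw [mem_ball, dist_zero_right] at hzR
        exact (inv_lt_inv₀ hR (norm_pos_iff.2 hz0)).2 hzR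
      refine modulus_le_of_poletsky hr₁ hr₁₂ (hPol.2 rfl) hout hη hη1 hηε hE hF fun γ hγ => ?_
      have hc : ContinuousOn (fun t => -‖g (γ.toFun t)‖) (Icc γ.a γ.b) :=
        (hg.comp γ.cont fun t ht => Curve.mem_of_curvesJoining hE hF hγ ht).norm.neg
      obtain ⟨a', b', hab, ha, hb, h1, h2, h3⟩ := exists_crossing γ.lt.le hc (neg_lt_neg hRr)
        (neg_le_neg (hE' _ hγ.1).le) (neg_le_neg (hF' _ hγ.2.1).le)
      refine ⟨a', b', hab, ha, hb, ?_, ?_, fun t ht => ?_⟩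
      · rw [sub_zero, Function.comp, norm_invert, neg_injective h1, inv_inv]
      · rw [sub_zero, Function.comp, norm_invert, neg_injective h2]
      · obtain ⟨h4, h5⟩ := h3 t ht
        have h4' : ‖g (γ.toFun t)‖ < r₁⁻¹ := neg_lt_neg_iff.1 h4
        have h5' : R < ‖g (γ.toFun t)‖ := neg_lt_neg_iff.1 h5
        rw [sub_zero, Function.comp, norm_invert]
        exact ⟨(lt_inv_comm₀ hr₁ (hR.trans h5')).2 h4', (inv_lt_inv₀ (hR.trans h5') hR).2 h5'⟩

/-- Curves traversing a spherical ring form a family of finite modulus. -/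
theorem exists_modulus_ring_le (hn : 2 ≤ n) (x₀ : Rn n) {s t : ℝ} (hst : s < t) :
    ∃ C : ℝ≥0∞, C ≠ ⊤ ∧ ∀ Γ : Set (Curve n), (∀ γ ∈ Γ, ∃ τ₁ ∈ Icc γ.a γ.b, ∃ τ₂ ∈ Icc γ.a γ.b,
      ‖γ.toFun τ₁ - x₀‖ ≤ s ∧ t ≤ ‖γ.toFun τ₂ - x₀‖) → modulus Γ ≤ C := by
  have hd : 0 < t - s := sub_pos.2 hst
  refine ⟨∫⁻ x, (closedBall x₀ t).indicator (fun _ => (ENNReal.ofReal (t - s))⁻¹) x ^ n, ?_,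
    fun Γ hΓ => ?_⟩
  · have h1 : ∀ x, (closedBall x₀ t).indicator (fun _ => (ENNReal.ofReal (t - s))⁻¹) x ^ n =
        (closedBall x₀ t).indicator (fun _ => (ENNReal.ofReal (t - s))⁻¹ ^ n) x := by
      intro x
      by_cases hx : x ∈ closedBall x₀ t
      · rw [indicator_of_mem hx, indicator_of_mem hx]
      · rw [indicator_of_notMem hx, indicator_of_notMem hx, zero_pow (by omega)]
    simp only [h1]
    rw [lintegral_indicator measurableSet_closedBall, setLIntegral_const]
    refine ENNReal.mul_ne_top (ENNReal.pow_ne_top (ENNReal.inv_ne_top.2 ?_))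
      measure_closedBall_lt_top.ne
    simpa using hst
  · refine (modulus_le_of_subcurves (Γ' := {γ | (∀ τ ∈ Icc γ.a γ.b, γ.toFun τ ∈ closedBall x₀ t) ∧
      t - s ≤ dist (γ.toFun γ.a) (γ.toFun γ.b)}) fun γ hγ => ?_).trans
      (modulus_le_of_length measurableSet_closedBall hd (fun γ hγ => hγ.1) fun γ hγ => hγ.2)
    obtain ⟨τ₁, hτ₁, τ₂, hτ₂, h1, h2⟩ := hΓ γ hγ
    have hc : ContinuousOn (fun τ => ‖γ.toFun τ - x₀‖) (Icc γ.a γ.b) :=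
      (γ.cont.sub continuousOn_const).norm
    rcases lt_trichotomy τ₁ τ₂ with h | h | h
    · obtain ⟨a', b', hab, ha, hb, h3, h4, h5⟩ := exists_crossing h.le
        (hc.mono (Icc_subset_Icc hτ₁.1 hτ₂.2)) hst h1 h2
      refine ⟨a', b', hab, hτ₁.1.trans ha, hb.trans hτ₂.2, fun τ hτ => ?_, ?_⟩
      · rw [mem_closedBall, dist_eq_norm]
        rcases hτ.1.eq_or_lt with h6 | h6
        · rw [← h6]; exact h3.trans_le hst.le
        · rcases hτ.2.eq_or_lt with h7 | h7
          · rw [h7]; exact h4.le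
          · exact (h5 τ ⟨h6, h7⟩).2.le
      · have := abs_dist_sub_le (γ.toFun a') (γ.toFun b') x₀
        rw [dist_eq_norm _ x₀, dist_eq_norm _ x₀, h3, h4] at this
        exact (by linarith [neg_abs_le (s - t)] : t - s ≤ |s - t|).trans this
    · rw [h] at h1; linarith
    · obtain ⟨a', b', hab, ha, hb, h3, h4, h5⟩ := exists_crossing h.le
        (hc.neg.mono (Icc_subset_Icc hτ₂.1 hτ₁.2)) (neg_lt_neg hst) (neg_le_neg h2) (neg_le_neg h1)
      have h3' : ‖γ.toFun a' - x₀‖ = t := neg_injective h3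
      have h4' : ‖γ.toFun b' - x₀‖ = s := neg_injective h4
      refine ⟨a', b', hab, hτ₂.1.trans ha, hb.trans hτ₁.2, fun τ hτ => ?_, ?_⟩
      · rw [mem_closedBall, dist_eq_norm]
        rcases hτ.1.eq_or_lt with h6 | h6
        · rw [← h6]; exact h3'.le
        · rcases hτ.2.eq_or_lt with h7 | h7
          · rw [h7]; exact h4'.trans_le hst.le
          · exact (neg_lt_neg_iff.1 (h5 τ ⟨h6, h7⟩).1).le
      · have := abs_dist_sub_le (γ.toFun a') (γ.toFun b') x₀
        rw [dist_eq_norm _ x₀, dist_eq_norm _ x₀, h3', h4'] at this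
        exact (le_abs_self _).trans this

/-- The curves issuing from a small neighbourhood of a point and leaving a given neighbourhood of
this point form a family of finite modulus. -/
theorem exists_nhds_modulus_leaving_le (hn : 2 ≤ n) {x₀ : RnBar n} {U : Set (RnBar n)}
    (hU : U ∈ 𝓝 x₀) :
    ∃ U₂ ∈ 𝓝 x₀, IsOpen U₂ ∧ U₂ ⊆ U ∧ ∃ C : ℝ≥0∞, C ≠ ⊤ ∧ ∀ Γ : Set (Curve n),
      (∀ γ ∈ Γ, (γ.toFun γ.a : RnBar n) ∈ U₂ ∧ ∃ τ ∈ Icc γ.a γ.b, (γ.toFun τ : RnBar n) ∉ U) →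
        modulus Γ ≤ C := by
  induction x₀ using OnePoint.rec with
  | coe x =>
    obtain ⟨r, hr, hrU⟩ := mem_nhds_coe hU
    obtain ⟨C, hC, hC'⟩ := exists_modulus_ring_le hn x (half_lt_self hr)
    refine ⟨_, (isOpen_coe_ball x (r / 2)).mem_nhds ⟨x, rfl, by simpa using hr⟩,
      isOpen_coe_ball x _, ?_, C, hC, fun Γ hΓ => hC' Γ fun γ hγ => ?_⟩
    · rintro _ ⟨z, rfl, hz⟩
      exact hrU z (by linarith)
    · obtain ⟨⟨z, hz, hz'⟩, τ, hτ, hτU⟩ := hΓ γ hγ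
      refine ⟨γ.a, left_mem_Icc.2 γ.lt.le, τ, hτ, ?_, ?_⟩
      · rw [OnePoint.coe_injective hz] at hz'
        exact hz'.le
      · by_contra h; exact hτU (hrU _ (not_le.1 h).le)
  | infty =>
    obtain ⟨R, hR, hRU⟩ := mem_nhds_infty hU
    obtain ⟨C, hC, hC'⟩ := exists_modulus_ring_le hn (0 : Rn n) (by linarith : R < 2 * R)
    refine ⟨_, (isOpen_compl_coe_closedBall (2 * R)).mem_nhds ?_, isOpen_compl_coe_closedBall _, ?_,
      C, hC, fun Γ hΓ => hC' Γ fun γ hγ => ?_⟩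
    · rintro ⟨x, -, hx⟩
      exact OnePoint.coe_ne_infty x hx
    · intro z hz
      induction z using OnePoint.rec with
      | infty => exact mem_of_mem_nhds hU
      | coe z =>
        refine hRU z ?_
        by_contra h
        exact hz ⟨z, by rw [mem_closedBall, dist_zero_right]; linarith, rfl⟩
    · obtain ⟨h1, τ, hτ, hτU⟩ := hΓ γ hγ
      refine ⟨τ, hτ, γ.a, left_mem_Icc.2 γ.lt.le, ?_, ?_⟩
      · rw [sub_zero]; by_contra h; exact hτU (hRU _ (not_le.1 h).le)
      · rw [sub_zero]; by_contra h
        exact h1 ⟨_, by rw [mem_closedBall, dist_zero_right]; exact (not_le.1 h).le, rfl⟩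

/-! ### Consequences of a weakly flat boundary -/

/-- The lower bound for the modulus provided by a weakly flat boundary. -/
theorem WeaklyFlatBoundary.exists_lt_modulus {D : Set (Rn n)} (hD : WeaklyFlatBoundary D)
    {x₀ : RnBar n} (hx₀ : x₀ ∈ extBoundary D) {P : ℝ} (hP : 0 < P) {U : Set (RnBar n)}
    (hU : U ∈ 𝓝 x₀) : ∃ V ∈ 𝓝 x₀, V ⊆ U ∧ ∀ E F : Set (Rn n), IsContinuumSet E →
      IsContinuumSet F → E ⊆ D → F ⊆ D → (∃ x ∈ E, (x : RnBar n) ∈ V) →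
      (∃ x ∈ E, (x : RnBar n) ∉ U) → (∃ x ∈ F, (x : RnBar n) ∈ V) →
      (∃ x ∈ F, (x : RnBar n) ∉ U) → ENNReal.ofReal P < modulus (curvesJoining E F D) := by
  obtain ⟨V, hV, hVU, h⟩ := hD x₀ hx₀ P hP U hU
  have key : ∀ E : Set (Rn n), IsContinuumSet E → (∃ x ∈ E, (x : RnBar n) ∈ V) →
      (∃ x ∈ E, (x : RnBar n) ∉ U) →
      (toExt E ∩ frontier U).Nonempty ∧ (toExt E ∩ frontier V).Nonempty := by
    rintro E hE ⟨x, hx, hxV⟩ ⟨z, hz, hzU⟩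
    have hpre : IsPreconnected (toExt E) :=
      hE.2.isPreconnected.image _ OnePoint.continuous_coe.continuousOn
    exact ⟨IsConnected.inter_frontier hpre ⟨_, coe_mem_toExt.2 hx, hVU hxV⟩
        ⟨_, coe_mem_toExt.2 hz, hzU⟩,
      IsConnected.inter_frontier hpre ⟨_, coe_mem_toExt.2 hx, hxV⟩
        ⟨_, coe_mem_toExt.2 hz, fun h => hzU (hVU h)⟩⟩
  refine ⟨V, hV, hVU, fun E F hE hF hED hFD h1 h2 h3 h4 => ?_⟩
  obtain ⟨h5, h6⟩ := key E hE h1 h2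
  obtain ⟨h7, h8⟩ := key F hF h3 h4
  exact h E F hE hF hED hFD h5 h6 h7 h8

/-- A domain with weakly flat boundary is locally connected at its boundary. -/
theorem WeaklyFlatBoundary.locallyConnected (hn : 2 ≤ n) {D : Set (Rn n)} (hD : IsDomainSet D)
    (hflat : WeaklyFlatBoundary D) {x₀ : RnBar n} (hx₀ : x₀ ∈ extBoundary D) {U : Set (RnBar n)}
    (hU : U ∈ 𝓝 x₀) : ∃ V ∈ 𝓝 x₀, V ⊆ U ∧ ∀ x ∈ D, ∀ z ∈ D, (x : RnBar n) ∈ V →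
      (z : RnBar n) ∈ V → z ∈ connectedComponentIn {w ∈ D | (w : RnBar n) ∈ U} x := by
  obtain ⟨U₂, hU₂, hU₂o, hU₂U, C, hC, hC'⟩ := exists_nhds_modulus_leaving_le hn hU
  obtain ⟨U₁, hU₁, hU₁c, hU₁₂⟩ := exists_mem_nhds_isClosed_subset hU₂
  obtain ⟨V, hV, hVU₁, hmod⟩ := hflat.exists_lt_modulus hx₀
    (P := C.toReal + 1) (by positivity) hU₁
  set S₂ : Set (Rn n) := {w ∈ D | (w : RnBar n) ∈ U₂} with hS₂
  set S : Set (Rn n) := {w ∈ D | (w : RnBar n) ∈ U} with hS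
  have hS₂o : IsOpen S₂ := hD.1.inter (hU₂o.preimage OnePoint.continuous_coe)
  have hS₂S : S₂ ⊆ S := fun w hw => ⟨hw.1, hU₂U hw.2⟩
  have hVU₂ : V ⊆ U₂ := hVU₁.trans hU₁₂
  -- A component of `S₂` that stays in the closed set `U₁` is open and relatively closed in `D`,
  -- hence is all of `D`.
  have hwhole : ∀ x ∈ S₂, (∀ w ∈ connectedComponentIn S₂ x, (w : RnBar n) ∈ U₁) →
      D ⊆ connectedComponentIn S₂ x := by
    intro x hx hsub
    refine hD.2.isPreconnected.subset_of_closure_inter_subset hS₂o.connectedComponentIn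
      ⟨x, hx.1, mem_connectedComponentIn hx⟩ ?_
    rintro w ⟨hw, hwD⟩
    refine closure_connectedComponentIn_inter hw ⟨hwD, hU₁₂ ?_⟩ hx
    have hcl : IsClosed ((fun w : Rn n => (w : RnBar n)) ⁻¹' U₁) :=
      hU₁c.preimage OnePoint.continuous_coe
    exact (hcl.closure_subset_iff.2 hsub) hw
  refine ⟨V, hV, hVU₂.trans hU₂U, fun x hx z hz hxV hzV => ?_⟩
  have hxS₂ : x ∈ S₂ := ⟨hx, hVU₂ hxV⟩
  have hzS₂ : z ∈ S₂ := ⟨hz, hVU₂ hzV⟩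
  by_cases h1 : ∀ w ∈ connectedComponentIn S₂ x, (w : RnBar n) ∈ U₁
  · exact connectedComponentIn_mono x hS₂S (hwhole x hxS₂ h1 hz)
  by_cases h2 : ∀ w ∈ connectedComponentIn S₂ z, (w : RnBar n) ∈ U₁
  · have := connectedComponentIn_mono z hS₂S (hwhole z hzS₂ h2 hx)
    rw [← connectedComponentIn_eq this]
    exact mem_connectedComponentIn (hS₂S hzS₂)
  -- Both components now leave `U₁`, so they contain continua to which weak flatness applies, giving
  -- modulus above `C + 1`. If `x` and `z` lay in different components of `S`, every curve joining
  -- these continua would leave `U`, and the modulus would be at most `C`.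
  push Not at h1 h2
  obtain ⟨x', hx', hx'U⟩ := h1
  obtain ⟨z', hz', hz'U⟩ := h2
  obtain ⟨p, -, hp0, hp1, hpC, hpK⟩ := exists_path_continuum hS₂o.connectedComponentIn
    isPreconnected_connectedComponentIn (mem_connectedComponentIn hxS₂) hx'
  obtain ⟨q, -, hq0, hq1, hqC, hqK⟩ := exists_path_continuum hS₂o.connectedComponentIn
    isPreconnected_connectedComponentIn (mem_connectedComponentIn hzS₂) hz'
  by_contra hcon
  have h0 : (0 : ℝ) ∈ Icc (0 : ℝ) 1 := by simp
  have h1 : (1 : ℝ) ∈ Icc (0 : ℝ) 1 := by simp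
  have hpS : p '' Icc 0 1 ⊆ S₂ := hpC.trans (connectedComponentIn_subset _ _)
  have hqS : q '' Icc 0 1 ⊆ S₂ := hqC.trans (connectedComponentIn_subset _ _)
  have hpD : p '' Icc 0 1 ⊆ D := fun w hw => (hpS hw).1
  have hqD : q '' Icc 0 1 ⊆ D := fun w hw => (hqS hw).1
  have hlow := hmod _ _ hpK hqK hpD hqD ⟨x, ⟨0, h0, hp0⟩, hxV⟩ ⟨x', ⟨1, h1, hp1⟩, hx'U⟩
    ⟨z, ⟨0, h0, hq0⟩, hzV⟩ ⟨z', ⟨1, h1, hq1⟩, hz'U⟩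
  have hup := hC' (curvesJoining (p '' Icc 0 1) (q '' Icc 0 1) D) fun γ hγ => by
    refine ⟨(hpS hγ.1).2, ?_⟩
    by_contra hall
    push Not at hall
    have hsub : γ.toFun '' Icc γ.a γ.b ⊆ S := by
      rintro _ ⟨t, ht, rfl⟩
      exact ⟨Curve.mem_of_curvesJoining hpD hqD hγ ht, hall t ht⟩
    have ha := connectedComponentIn_mono x hS₂S (hpC hγ.1)
    have hb := connectedComponentIn_mono z hS₂S (hqC hγ.2.1)
    have hconn := (isPreconnected_Icc.image _ γ.cont).subset_connectedComponentIn
      ⟨γ.a, left_mem_Icc.2 γ.lt.le, rfl⟩ hsub ⟨γ.b, right_mem_Icc.2 γ.lt.le, rfl⟩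
    rw [← connectedComponentIn_eq ha] at hconn
    refine hcon ?_
    rw [connectedComponentIn_eq hconn, ← connectedComponentIn_eq hb]
    exact mem_connectedComponentIn (hS₂S hzS₂)
  have h3 := hlow.trans_le hup
  rw [← ENNReal.ofReal_toReal hC] at h3
  have h4 := (ENNReal.ofReal_lt_ofReal_iff_of_nonneg (by positivity)).1 h3
  rw [ENNReal.toReal_ofReal ENNReal.toReal_nonneg] at h4
  linarith

/-! ### Closed open maps and finite connectedness at the boundary -/

/-- As `z` is not a term, finitely many terms can be removed from any of its neighbourhoods, so it
is a cluster point of the sequence and not only of its range. -/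
theorem exists_subseq_of_mem_closure_range {u : ℕ → Rn n} {z : Rn n} (hz : z ∈ closure (range u))
    (hne : ∀ k, u k ≠ z) : ∃ ψ : ℕ → ℕ, StrictMono ψ ∧ Tendsto (u ∘ ψ) atTop (𝓝 z) := by
  have hcl : MapClusterPt z atTop u := by
    rw [mapClusterPt_iff_frequently]
    intro s hs
    rw [frequently_atTop]
    intro N
    have hfin : (u '' {k | k < N}).Finite := (finite_lt_nat N).image u
    have hz' : z ∉ u '' {k | k < N} := by
      rintro ⟨k, -, hk⟩
      exact hne k hk
    obtain ⟨w, ⟨hws, hwN⟩, ⟨k, rfl⟩⟩ := mem_closure_iff_nhds.1 hz _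
      (inter_mem hs (hfin.isClosed.isOpen_compl.mem_nhds hz'))
    exact ⟨k, not_lt.1 fun h => hwN ⟨k, h, rfl⟩, hws⟩
  exact hcl.tendsto_subseq

/-- Near every point an open map avoids a given value. -/
theorem IsOpenOn.exists_near_ne (hn : 2 ≤ n) {g : Rn n → Rn n} {D : Set (Rn n)} (hD : IsOpen D)
    (hc : ContinuousOn g D) (ho : IsOpenOn g D) {x : Rn n} (hx : x ∈ D) (y : Rn n) {ε : ℝ}
    (hε : 0 < ε) : ∃ x' ∈ D, dist x' x < ε ∧ dist (g x') (g x) < ε ∧ g x' ≠ y := by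
  have := nontrivial_Rn hn
  have hWo : IsOpen ((D ∩ g ⁻¹' ball (g x) ε) ∩ ball x ε) :=
    (hc.isOpen_inter_preimage hD isOpen_ball).inter isOpen_ball
  have hmem : x ∈ (D ∩ g ⁻¹' ball (g x) ε) ∩ ball x ε :=
    ⟨⟨hx, mem_preimage.2 (mem_ball_self hε)⟩, mem_ball_self hε⟩
  obtain ⟨_, ⟨x', hx', rfl⟩, hy⟩ := (dense_compl_singleton y).inter_open_nonempty _
    (ho _ (fun w hw => hw.1.1) hWo) ⟨_, mem_image_of_mem g hmem⟩
  exact ⟨x', hx'.1.1, hx'.2, hx'.1.2, hy⟩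

/-- Open closed maps are proper. -/
theorem IsClosedOnto.isCompact_inter_preimage (hn : 2 ≤ n) {g : Rn n → Rn n} {D D' : Set (Rn n)}
    (hg : IsClosedOnto g D D') (hD : IsOpen D) (hc : ContinuousOn g D) (ho : IsOpenOn g D)
    {K : Set (Rn n)} (hK : IsCompact K) (hKD : K ⊆ D') : IsCompact (D ∩ g ⁻¹' K) := by
  refine IsSeqCompact.isCompact fun x hx => ?_
  obtain ⟨y, hyK, φ, hφ, hlim⟩ := hK.isSeqCompact fun k => (hx k).2
  -- The perturbed points avoid the fibre over `y`. Closedness puts a point `z` of this fibre in the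
  -- closure of their range, and `z`, not being a term, must be a subsequential limit.
  have hpert : ∀ k : ℕ, ∃ x' ∈ D, dist x' (x (φ k)) < 1 / ((k : ℝ) + 1) ∧
      dist (g x') (g (x (φ k))) < 1 / ((k : ℝ) + 1) ∧ g x' ≠ y := fun k =>
    ho.exists_near_ne hn hD hc (hx (φ k)).1 y (by positivity)
  choose x' hx'D hx'x hgx' hgy using hpert
  have hz1 : Tendsto (fun k => dist (x' k) (x (φ k))) atTop (𝓝 0) :=
    squeeze_zero (fun _ => dist_nonneg) (fun k => (hx'x k).le) tendsto_one_div_add_atTop_nhds_zero_nat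
  have hz2 : Tendsto (fun k => dist (g (x' k)) (g (x (φ k)))) atTop (𝓝 0) :=
    squeeze_zero (fun _ => dist_nonneg) (fun k => (hgx' k).le) tendsto_one_div_add_atTop_nhds_zero_nat
  have hlim' : Tendsto (fun k => g (x' k)) atTop (𝓝 y) :=
    (tendsto_iff_of_dist hz2).2 hlim
  obtain ⟨C', hC', hC'eq⟩ := hg.2 (closure (range x')) isClosed_closure
  have hyC' : y ∈ C' := by
    refine hC'.mem_of_tendsto hlim' (Eventually.of_forall fun k => ?_)
    have : g (x' k) ∈ D' ∩ C' := hC'eq ▸ ⟨x' k, ⟨hx'D k, subset_closure (mem_range_self k)⟩, rfl⟩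
    exact this.2
  obtain ⟨z, ⟨hzD, hz⟩, hzy⟩ : y ∈ g '' (D ∩ closure (range x')) := hC'eq ▸ ⟨hKD hyK, hyC'⟩
  obtain ⟨ψ, hψ, hψlim⟩ := exists_subseq_of_mem_closure_range hz fun k h => hgy k (h ▸ hzy)
  refine ⟨z, ⟨hzD, by rw [mem_preimage, hzy]; exact hyK⟩, φ ∘ ψ, hφ.comp hψ, ?_⟩
  exact (tendsto_iff_of_dist (hz1.comp hψ.tendsto_atTop)).1 hψlim

/-- A component of the preimage of a connected open set under a proper open map is mapped onto
this set. -/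
theorem image_connectedComponentIn_eq {g : Rn n → Rn n} {D D' W : Set (Rn n)} (hD : IsOpen D)
    (hc : ContinuousOn g D) (ho : IsOpenOn g D)
    (hproper : ∀ K, IsCompact K → K ⊆ D' → IsCompact (D ∩ g ⁻¹' K)) (hWo : IsOpen W)
    (hW : IsPreconnected W) (hWD : W ⊆ D') {x : Rn n} (hx : x ∈ D) (hxW : g x ∈ W) :
    g '' connectedComponentIn (D ∩ g ⁻¹' W) x = W := by
  set C := connectedComponentIn (D ∩ g ⁻¹' W) x with hC
  have hsub : C ⊆ D ∩ g ⁻¹' W := connectedComponentIn_subset _ _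
  have hxC : x ∈ C := mem_connectedComponentIn ⟨hx, hxW⟩
  have hCo : IsOpen C := (hc.isOpen_inter_preimage hD hWo).connectedComponentIn
  have himage : g '' C ⊆ W := by
    rintro _ ⟨w, hw, rfl⟩; exact (hsub hw).2
  refine himage.antisymm (hW.subset_of_closure_inter_subset (ho C (fun w hw => (hsub hw).1) hCo)
    ⟨g x, hxW, mem_image_of_mem g hxC⟩ ?_)
  rintro y ⟨hy, hyW⟩
  obtain ⟨u, hu, hlim⟩ := mem_closure_iff_seq_limit.1 hy
  choose c hcC hcu using hu
  -- A convergent sequence with its limit is compact, so properness yields a limit of the preimages.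
  -- Thus the open image is also relatively closed in the connected set `W`.
  have hK : IsCompact (insert y (range u)) := hlim.isCompact_insert_range
  have hKD : insert y (range u) ⊆ D' := by
    refine insert_subset (hWD hyW) ?_
    rintro _ ⟨k, rfl⟩
    rw [← hcu k]; exact hWD (hsub (hcC k)).2
  obtain ⟨w, hw, φ, hφ, hφlim⟩ := (hproper _ hK hKD).isSeqCompact (x := c) fun k =>
    ⟨(hsub (hcC k)).1, by rw [mem_preimage, hcu k]; exact mem_insert_of_mem _ (mem_range_self k)⟩
  have hgw : g w = y := by
    have h1 : Tendsto (c ∘ φ) atTop (𝓝[D] w) :=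
      tendsto_nhdsWithin_iff.2 ⟨hφlim, Eventually.of_forall fun k => (hsub (hcC _)).1⟩
    have h2 : Tendsto (fun k => g (c (φ k))) atTop (𝓝 (g w)) := (hc w hw.1).tendsto.comp h1
    simp only [hcu] at h2
    exact tendsto_nhds_unique h2 (hlim.comp hφ.tendsto_atTop)
  have hwcl : w ∈ closure C := mem_closure_of_tendsto hφlim (Eventually.of_forall fun k => hcC _)
  exact ⟨w, closure_connectedComponentIn_inter hwcl ⟨hw.1, by rw [mem_preimage, hgw]; exact hyW⟩
    ⟨hx, hxW⟩, hgw⟩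

/-- In a domain finitely connected at its boundary, the points close to a boundary point lie in
finitely many connected open sets that are contained in a given neighbourhood of this point and
accumulate at it. -/
theorem FinitelyConnectedAtBoundary.exists_finite_cover {D' : Set (Rn n)} (hD' : IsOpen D')
    (hfin : FinitelyConnectedAtBoundary D') {y₀ : RnBar n} (hy₀ : y₀ ∈ extBoundary D')
    {U : Set (RnBar n)} (hU : U ∈ 𝓝 y₀) :
    ∃ V ∈ 𝓝 y₀, ∃ 𝒩 : Set (Set (Rn n)), 𝒩.Finite ∧ (∀ N ∈ 𝒩, IsOpen N ∧ IsPreconnected N ∧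
      N ⊆ D' ∧ (∀ w ∈ N, (w : RnBar n) ∈ U) ∧ y₀ ∈ closure (toExt N)) ∧
      ∀ w ∈ D', (w : RnBar n) ∈ V → ∃ N ∈ 𝒩, w ∈ N := by
  obtain ⟨V, hV, hVU, hVfin⟩ := hfin y₀ hy₀ (interior U) (interior_mem_nhds.2 hU)
  set S : Set (Rn n) := {w ∈ D' | (w : RnBar n) ∈ interior U} with hS
  have hSo : IsOpen S := hD'.inter (isOpen_interior.preimage OnePoint.continuous_coe)
  set T : Set (RnBar n) := V ∩ toExt D' with hT
  -- `V` need not be open, so its components in `D'` need not be either. Each lies in a single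
  -- component of the open set `S`, so only finitely many components of `S` meet `V`.
  have hrep : ∀ c : ConnectedComponents T, ∃ w : Rn n, ∀ (w' : Rn n) (h : (w' : RnBar n) ∈ T),
      ConnectedComponents.mk ⟨(w' : RnBar n), h⟩ = c →
        connectedComponentIn S w' = connectedComponentIn S w := by
    intro c
    obtain ⟨⟨_, hwV, w, hwD, rfl⟩, rfl⟩ := ConnectedComponents.surjective_coe c
    refine ⟨w, fun w' h' hc => ?_⟩
    have hpre : IsPreconnected (Subtype.val ''
        connectedComponent (⟨(w : RnBar n), hwV, w, hwD, rfl⟩ : T)) :=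
      isPreconnected_connectedComponent.image _ continuous_subtype_val.continuousOn
    set P : Set (Rn n) := (fun z : Rn n => (z : RnBar n)) ⁻¹' (Subtype.val ''
        connectedComponent (⟨(w : RnBar n), hwV, w, hwD, rfl⟩ : T)) with hP
    have hPim : (fun z : Rn n => (z : RnBar n)) '' P = Subtype.val ''
        connectedComponent (⟨(w : RnBar n), hwV, w, hwD, rfl⟩ : T) := by
      rw [hP, image_preimage_eq_of_subset]
      rintro _ ⟨⟨_, -, z, -, rfl⟩, -, rfl⟩
      exact ⟨z, rfl⟩
    have hPpre : IsPreconnected P := by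
      rw [← hPim] at hpre
      exact OnePoint.isOpenEmbedding_coe.isInducing.isPreconnected_image.1 hpre
    have hPS : P ⊆ S := by
      rintro z ⟨⟨_, hzV, z', hz'D, rfl⟩, -, hzz⟩
      have : z' = z := OnePoint.coe_injective hzz
      subst this
      exact ⟨hz'D, hVU hzV⟩
    have hwP : w ∈ P := ⟨_, mem_connectedComponent, rfl⟩
    have hw'P : w' ∈ P := ⟨⟨(w' : RnBar n), h'⟩, ConnectedComponents.coe_eq_coe'.1 hc, rfl⟩
    exact (connectedComponentIn_eq (hPpre.subset_connectedComponentIn hwP hPS hw'P)).symm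
  choose rep hrep using hrep
  set 𝒩₀ : Set (Set (Rn n)) := {N | ∃ w ∈ D', (w : RnBar n) ∈ V ∧ N = connectedComponentIn S w}
    with h𝒩₀
  have h𝒩₀fin : 𝒩₀.Finite := by
    refine (finite_range fun c : ConnectedComponents T => connectedComponentIn S (rep c)).subset ?_
    rintro _ ⟨w, hwD, hwV, rfl⟩
    exact ⟨_, (hrep _ w ⟨hwV, w, hwD, rfl⟩ rfl).symm⟩
  -- The finitely many components that do not accumulate at `y₀` are removed by shrinking `V`.
  set B := {N ∈ 𝒩₀ | y₀ ∉ closure (toExt N)} with hB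
  have hBfin : B.Finite := h𝒩₀fin.subset fun N hN => hN.1
  refine ⟨V ∩ ⋂ N ∈ B, (closure (toExt N))ᶜ, inter_mem hV ((biInter_mem hBfin).2 fun N hN =>
    isClosed_closure.isOpen_compl.mem_nhds hN.2), {N ∈ 𝒩₀ | y₀ ∈ closure (toExt N)},
    h𝒩₀fin.subset fun N hN => hN.1, ?_, ?_⟩
  · rintro N ⟨⟨w, hwD, hwV, rfl⟩, hN⟩
    exact ⟨hSo.connectedComponentIn, isPreconnected_connectedComponentIn,
      fun z hz => (connectedComponentIn_subset _ _ hz).1,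
      fun z hz => interior_subset (connectedComponentIn_subset _ _ hz).2, hN⟩
  · rintro w hwD ⟨hwV, hwB⟩
    have hmem : w ∈ connectedComponentIn S w := mem_connectedComponentIn ⟨hwD, hVU hwV⟩
    refine ⟨connectedComponentIn S w, ⟨⟨w, hwD, hwV, rfl⟩, ?_⟩, hmem⟩
    by_contra hcon
    exact mem_iInter₂.1 hwB _ ⟨⟨w, hwD, hwV, rfl⟩, hcon⟩ (subset_closure (coe_mem_toExt.2 hmem))

/-! ### Limits of open closed maps with the inverse Poletsky inequality -/

theorem extBoundary_eq {D : Set (Rn n)} (hD : IsOpen D) :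
    extBoundary D = extClosure D \ toExt D :=
  (isOpen_toExt hD).frontier_eq

/-- `f` is a non-constant limit of open closed maps of `D` onto `D'` satisfying the inverse Poletsky
inequality with a majorant whose weighted integrals over small spherical rings are small. -/
structure IsPoletskyLimit (Q : Rn n → ℝ≥0∞) (D D' : Set (Rn n)) (fm : ℕ → Rn n → Rn n)
    (f : Rn n → Rn n) : Prop where
  two_le : 2 ≤ n
  domain : IsDomainSet D
  isOpen_target : IsOpen D'
  flat : WeaklyFlatBoundary D
  finitelyConnected : FinitelyConnectedAtBoundary D'
  vanish : ∀ y₀ ∈ extClosure D', RingIntegralsVanishAt Q y₀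
  cont : ∀ m, ContinuousOn (fm m) D
  isOpenOn : ∀ m, IsOpenOn (fm m) D
  isClosedOnto : ∀ m, IsClosedOnto (fm m) D D'
  poletsky : ∀ m, ∀ y₀ ∈ extClosure D', InversePoletskyAt (fm m) D Q y₀
  tendsto : ChordalTendstoUniformlyOn fm f D
  nonconst : ∃ x ∈ D, ∃ z ∈ D, f x ≠ f z

namespace IsPoletskyLimit

variable {Q : Rn n → ℝ≥0∞} {D D' : Set (Rn n)} {fm : ℕ → Rn n → Rn n} {f : Rn n → Rn n}

theorem continuousOn (h : IsPoletskyLimit Q D D' fm f) : ContinuousOn f D :=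
  h.tendsto.continuousOn h.cont

theorem isCompact_preimage (h : IsPoletskyLimit Q D D' fm f) (m : ℕ) {K : Set (Rn n)}
    (hK : IsCompact K) (hKD : K ⊆ D') : IsCompact (D ∩ fm m ⁻¹' K) :=
  (h.isClosedOnto m).isCompact_inter_preimage h.two_le h.domain.1 (h.cont m) (h.isOpenOn m) hK hKD

theorem mem_target (h : IsPoletskyLimit Q D D' fm f) (m : ℕ) {x : Rn n} (hx : x ∈ D) :
    fm m x ∈ D' :=
  (h.isClosedOnto m).1 ▸ mem_image_of_mem _ hx

theorem coe_mem_extClosure (h : IsPoletskyLimit Q D D' fm f) {x : Rn n} (hx : x ∈ D) :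
    (f x : RnBar n) ∈ extClosure D' := by
  by_contra hcon
  obtain ⟨m, hm⟩ := (h.tendsto.eventually_mem isCompact_singleton
    (isClosed_closure (s := toExt D')).isOpen_compl (singleton_subset_iff.2 hcon)).exists
  exact (hm x hx).1 rfl (subset_closure (coe_mem_toExt.2 (h.mem_target m hx)))

/-- The curves joining a set that `f` maps close to `y₀` to a set that `f` maps away from `y₀` have
small modulus. -/
theorem exists_nhds_modulus_le (h : IsPoletskyLimit Q D D' fm f) {y₀ : RnBar n}
    (hy₀ : y₀ ∈ extClosure D') {N : Set (RnBar n)} (hN : N ∈ 𝓝 y₀) {ε : ℝ≥0∞} (hε : ε ≠ 0) :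
    ∃ N₁ ∈ 𝓝 y₀, IsOpen N₁ ∧ N₁ ⊆ N ∧ ∀ E F : Set (Rn n), E ⊆ D → F ⊆ D → F.Nonempty →
      (∀ x ∈ E, (f x : RnBar n) ∈ N₁) → (∀ x ∈ F, (f x : RnBar n) ∉ N) →
        modulus (curvesJoining E F D) ≤ ε := by
  obtain ⟨A, hA, hAN, hAc⟩ := local_compact_nhds (interior_mem_nhds.2 hN)
  obtain ⟨N₁, hN₁, hN₁o, hN₁A, hmod⟩ := InverseModulus.exists_nhds_modulus_le (D := D) h.two_le
    h.isOpen_target (h.vanish y₀ hy₀) hA hε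
  obtain ⟨B, hB, hBN, hBc⟩ := local_compact_nhds hN₁
  obtain ⟨m, hm₁, hm₂⟩ := ((h.tendsto.eventually_mem hBc hN₁o hBN).and
    (h.tendsto.eventually_mem hAc isOpen_interior hAN)).exists
  refine ⟨interior B, interior_mem_nhds.2 hB, isOpen_interior,
    interior_subset.trans (hBN.trans (hN₁A.trans (hAN.trans interior_subset))),
    fun E F hE hF hFne hfE hfF => ?_⟩
  exact hmod (fm m) (h.cont m) (h.isClosedOnto m).1 (h.poletsky m y₀ hy₀) E F hE hF hFne
    (fun x hx => (hm₁ x (hE hx)).1 (interior_subset (hfE x hx)))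
    (fun x hx hx' => hfF x hx (interior_subset ((hm₂ x (hF hx)).2 hx')))

/-- Connected open sets around `x₀` that `f` maps close to `f x₀` are small, unless `f` is constant
near `x₀`. -/
theorem exists_nhds_subset_ball (h : IsPoletskyLimit Q D D' fm f) {x₀ z : Rn n} {r₁ r₂ : ℝ}
    (hr₁ : 0 < r₁) (hr₁₂ : r₁ ≤ r₂) (hball : ball x₀ r₂ ⊆ D) (hz : z ∈ ball x₀ r₂)
    (hfz : f z ≠ f x₀) :
    ∃ N ∈ 𝓝 (f x₀ : RnBar n), ∀ C : Set (Rn n), IsOpen C → IsPreconnected C → C ⊆ D → x₀ ∈ C →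
      (∀ w ∈ C, (f w : RnBar n) ∈ N) → C ⊆ ball x₀ r₁ := by
  have hx₀ : x₀ ∈ D := hball (mem_ball_self (hr₁.trans_le hr₁₂))
  obtain ⟨A, B, hA, hB, hdisj⟩ := t2_separation_nhds
    (show (f x₀ : RnBar n) ≠ (f z : RnBar n) from fun he => hfz (OnePoint.coe_injective he).symm)
  have hBz : ∀ᶠ w in 𝓝 z, (f w : RnBar n) ∈ B ∧ w ∈ ball x₀ r₂ :=
    (((OnePoint.continuous_coe.tendsto _).comp
      (h.continuousOn.continuousAt (h.domain.1.mem_nhds (hball hz)))).eventually hB).and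
      (isOpen_ball.mem_nhds hz)
  obtain ⟨s, hs, hsB⟩ := Metric.eventually_nhds_iff_ball.1 hBz
  -- `κ` depends only on the radii and on the volume of the ball about `z`, so `N` can be chosen
  -- afterwards with upper bound `ε < κ`.
  obtain ⟨κ, hκ, hlow⟩ := exists_modulus_lower_bound h.two_le hr₁ hr₁₂
    (measure_ball_pos volume z hs).ne'
  obtain ⟨ε, hε, hεκ⟩ := exists_between (pos_iff_ne_zero.2 hκ)
  obtain ⟨N, hN, -, hNA, hmod⟩ :=
    h.exists_nhds_modulus_le (h.coe_mem_extClosure hx₀) hA hε.ne'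
  refine ⟨N, hN, fun C hCo hC hCD hxC hCN w hw => ?_⟩
  by_contra hfar
  obtain ⟨p, hp, hp0, hp1, hpC, -⟩ := exists_path_continuum hCo hC hxC hw
  have hfar' : r₁ ≤ dist (p 1) (p 0) := by
    rw [hp0, hp1]; exact not_lt.1 hfar
  have h1 := hlow D (p '' Icc 0 1) (ball z s) p hp (hp0 ▸ hball) hfar' le_rfl measurableSet_ball
    (hp0 ▸ fun w hw => (hsB w hw).2) le_rfl (disjoint_left.2 fun w hwp hws =>
      disjoint_left.1 hdisj (hNA (hCN w (hpC hwp))) (hsB w hws).1)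
  have h2 := hmod (p '' Icc 0 1) (ball z s) (hpC.trans hCD) (fun w hw => hball (hsB w hw).2)
    ⟨z, mem_ball_self hs⟩ (fun x hx => hCN x (hpC hx))
    (fun x hx hxA => disjoint_left.1 hdisj hxA (hsB x hx).1)
  exact absurd (h1.trans h2) (not_le.2 hεκ)

/-- Otherwise the component at `x₀` of the preimage of a small neighbourhood of `f x₀` would lie in
a ball too small to contain `x₁`, although it contains `K`. -/
theorem eq_on_ball_of_continuum (h : IsPoletskyLimit Q D D' fm f) {x₀ x₁ : Rn n} {K : Set (Rn n)}
    (hK : IsPreconnected K) (hKD : K ⊆ D ∩ f ⁻¹' {f x₀}) (hx₀ : x₀ ∈ K) (hx₁ : x₁ ∈ K)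
    (hne : x₁ ≠ x₀) {r : ℝ} (hr : 0 < r) (hball : ball x₀ r ⊆ D) :
    ∀ z ∈ ball x₀ r, f z = f x₀ := by
  intro z hz
  by_contra hfz
  obtain ⟨N, hN, hsmall⟩ := h.exists_nhds_subset_ball (lt_min (dist_pos.2 hne) hr)
    (min_le_right _ _) hball hz hfz
  have hSo : IsOpen (D ∩ f ⁻¹' ((fun y : Rn n => (y : RnBar n)) ⁻¹' interior N)) :=
    h.continuousOn.isOpen_inter_preimage h.domain.1
      (isOpen_interior.preimage OnePoint.continuous_coe)
  have hKS : K ⊆ D ∩ f ⁻¹' ((fun y : Rn n => (y : RnBar n)) ⁻¹' interior N) := fun w hw => by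
    refine ⟨(hKD hw).1, ?_⟩
    have : f w = f x₀ := (hKD hw).2
    rw [mem_preimage, mem_preimage, this]
    exact mem_interior_iff_mem_nhds.2 hN
  have := hsmall _ (hSo.connectedComponentIn (x := x₀)) isPreconnected_connectedComponentIn
    (fun w hw => (connectedComponentIn_subset _ _ hw).1) (mem_connectedComponentIn (hKS hx₀))
    (fun w hw => interior_subset (connectedComponentIn_subset _ _ hw).2)
    (hK.subset_connectedComponentIn hx₀ hKS hx₁)
  exact absurd (mem_ball.1 this) (not_lt.2 (min_le_left _ _))

/-- A nondegenerate continuum gives the fibre interior points. This interior is relatively closed in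
`D`: a small closed ball about a point of it is again a nondegenerate continuum, and constancy
spreads to a ball reaching the limit point. So `f` would be constant. -/
theorem isLightOn (h : IsPoletskyLimit Q D D' fm f) : IsLightOn f D := by
  have := nontrivial_Rn h.two_le
  intro y K hK hKD x₀ hx₀ x₁ hx₁
  by_contra hne
  have hfib : ∀ w : Rn n, f w = y → D ∩ f ⁻¹' {y} = D ∩ f ⁻¹' {f w} := fun w hw => by rw [hw]
  have hx₀y : f x₀ = y := (hKD hx₀).2
  set Z := interior (D ∩ f ⁻¹' {y}) with hZ
  have hZ₀ : x₀ ∈ Z := by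
    obtain ⟨r, hr, hball⟩ := Metric.isOpen_iff.1 h.domain.1 x₀ (hKD hx₀).1
    refine mem_interior.2 ⟨ball x₀ r, fun z hz => ⟨hball hz, ?_⟩, isOpen_ball, mem_ball_self hr⟩
    exact (h.eq_on_ball_of_continuum hK.2.isPreconnected (hfib x₀ hx₀y ▸ hKD) hx₀ hx₁
      (Ne.symm hne) hr hball z hz).trans hx₀y
  have hDZ : D ⊆ Z := by
    refine h.domain.2.isPreconnected.subset_of_closure_inter_subset isOpen_interior
      ⟨x₀, (hKD hx₀).1, hZ₀⟩ ?_
    rintro x ⟨hx, hxD⟩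
    obtain ⟨r, hr, hball⟩ := Metric.isOpen_iff.1 h.domain.1 x hxD
    obtain ⟨z, hzZ, hzx⟩ := Metric.mem_closure_iff.1 hx (r / 2) (half_pos hr)
    have hsub : ball z (r / 2) ⊆ D := (ball_subset_ball' (by
      rw [dist_comm] at hzx; linarith)).trans hball
    obtain ⟨s, hs, hsZ⟩ := Metric.nhds_basis_closedBall.mem_iff.1 (isOpen_interior.mem_nhds hzZ)
    obtain ⟨z', hz'⟩ := NormedSpace.sphere_nonempty (x := z) (r := s) |>.2 hs.le
    have hzy : f z = y := (interior_subset hzZ).2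
    have hz'z : z' ≠ z := by
      rintro rfl
      rw [mem_sphere, dist_self] at hz'
      exact hs.ne hz'
    have hconst := h.eq_on_ball_of_continuum (convex_closedBall z s).isPreconnected
      (hfib z hzy ▸ hsZ.trans interior_subset) (mem_closedBall_self hs.le)
      (sphere_subset_closedBall hz') hz'z (half_pos hr) hsub
    exact mem_interior.2 ⟨ball z (r / 2), fun w hw => ⟨hsub hw, (hconst w hw).trans hzy⟩,
      isOpen_ball, hzx⟩
  obtain ⟨x, hx, z, hz, hxz⟩ := h.nonconst
  exact hxz ((interior_subset (hDZ hx)).2.trans (interior_subset (hDZ hz)).2.symm)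

/-- Points that `f` maps close to a boundary point of `D'` lie in connected open sets that `f` maps
close to this point, that are not relatively compact in `D` and meet a fixed compact set. -/
theorem exists_isPreconnected (h : IsPoletskyLimit Q D D' fm f) {y₀ : RnBar n}
    (hy₀ : y₀ ∈ extBoundary D') {N : Set (RnBar n)} (hN : N ∈ 𝓝 y₀) :
    ∃ V ∈ 𝓝 y₀, ∃ K : Set (Rn n), IsCompact K ∧ K ⊆ D ∧ ∀ x ∈ D, (f x : RnBar n) ∈ V →
      ∃ C : Set (Rn n), IsOpen C ∧ IsPreconnected C ∧ C ⊆ D ∧ x ∈ C ∧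
        (∀ w ∈ C, (f w : RnBar n) ∈ N) ∧ (C ∩ K).Nonempty ∧
        ∀ L, IsCompact L → L ⊆ D → ¬ C ⊆ L := by
  obtain ⟨A, hA, hAN, hAc⟩ := local_compact_nhds (interior_mem_nhds.2 hN)
  obtain ⟨V, hV, 𝒩, h𝒩fin, h𝒩, hcover⟩ :=
    h.finitelyConnected.exists_finite_cover h.isOpen_target hy₀ hA
  obtain ⟨B, hB, hBV, hBc⟩ := local_compact_nhds (interior_mem_nhds.2 hV)
  obtain ⟨m, hm₁, hm₂⟩ := ((h.tendsto.eventually_mem hBc isOpen_interior hBV).and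
    (h.tendsto.eventually_mem hAc isOpen_interior hAN)).exists
  have hne : ∀ M : Set (Rn n), M ∈ 𝒩 → M.Nonempty := fun M hM => by
    have := closure_nonempty_iff.1 ⟨y₀, (h𝒩 M hM).2.2.2.2⟩
    exact this.of_image
  choose! a ha using hne
  -- The fixed compact set is the preimage of one chosen point in each of the finitely many pieces;
  -- a component of the preimage of a piece is mapped onto it and so meets this set.
  refine ⟨B, hB, D ∩ fm m ⁻¹' (a '' 𝒩), h.isCompact_preimage m (h𝒩fin.image a).isCompact ?_,
    inter_subset_left, fun x hx hxB => ?_⟩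
  · rintro _ ⟨M, hM, rfl⟩
    exact (h𝒩 M hM).2.2.1 (ha M hM)
  obtain ⟨M, hM, hxM⟩ := hcover _ (h.mem_target m hx) (interior_subset ((hm₁ x hx).1 hxB))
  obtain ⟨hMo, hMpre, hMD, hMA, hMy⟩ := h𝒩 M hM
  have hsub := connectedComponentIn_subset (D ∩ fm m ⁻¹' M) x
  have himage := image_connectedComponentIn_eq h.domain.1 (h.cont m) (h.isOpenOn m)
    (fun K hK hKD => h.isCompact_preimage m hK hKD) hMo hMpre hMD hx hxM
  refine ⟨connectedComponentIn (D ∩ fm m ⁻¹' M) x,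
    ((h.cont m).isOpen_inter_preimage h.domain.1 hMo).connectedComponentIn,
    isPreconnected_connectedComponentIn, fun w hw => (hsub hw).1,
    mem_connectedComponentIn ⟨hx, hxM⟩,
    fun w hw => interior_subset ((hm₂ w (hsub hw).1).2 (hMA _ (hsub hw).2)), ?_,
    fun L hL hLD hCL => ?_⟩
  · obtain ⟨w, hw, hwa⟩ : a M ∈ fm m '' connectedComponentIn (D ∩ fm m ⁻¹' M) x := by
      rw [himage]; exact ha M hM
    exact ⟨w, hw, (hsub hw).1, M, hM, hwa.symm⟩
  · have hcl : IsClosed (toExt (fm m '' L)) :=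
      ((hL.image_of_continuousOn ((h.cont m).mono hLD)).image OnePoint.continuous_coe).isClosed
    have hy : y₀ ∈ toExt (fm m '' L) := by
      refine closure_minimal (image_mono ?_) hcl hMy
      rw [← himage]; exact image_mono hCL
    rw [extBoundary_eq h.isOpen_target] at hy₀
    refine hy₀.2 (image_mono ?_ hy)
    rintro _ ⟨w, hw, rfl⟩
    exact h.mem_target m (hLD hw)

/-- At a boundary value the connected set from `exists_isPreconnected` is not relatively compact in
`D`, whereas `exists_nhds_subset_ball`, applicable because `f` is light, confines it to a small
ball. -/
theorem mapsTo (h : IsPoletskyLimit Q D D' fm f) : MapsTo f D D' := by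
  have := nontrivial_Rn h.two_le
  intro x₀ hx₀
  by_contra hcon
  have hy₀ : (f x₀ : RnBar n) ∈ extBoundary D' := by
    rw [extBoundary_eq h.isOpen_target]
    exact ⟨h.coe_mem_extClosure hx₀, fun hmem => hcon (coe_mem_toExt.1 hmem)⟩
  obtain ⟨r, hr, hball⟩ := Metric.nhds_basis_closedBall.mem_iff.1 (h.domain.1.mem_nhds hx₀)
  obtain ⟨z, hz, hfz⟩ : ∃ z ∈ ball x₀ r, f z ≠ f x₀ := by
    by_contra! hall
    obtain ⟨z, hz⟩ := NormedSpace.sphere_nonempty (x := x₀) (r := r / 2) |>.2 (half_pos hr).le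
    have hsub := h.isLightOn (f x₀) (closedBall x₀ (r / 2))
      ⟨isCompact_closedBall _ _, (convex_closedBall x₀ (r / 2)).isConnected
        ⟨x₀, mem_closedBall_self (half_pos hr).le⟩⟩
      (fun w hw => ⟨hball (closedBall_subset_closedBall (by linarith) hw),
        hall w (closedBall_subset_ball (by linarith) hw)⟩)
    have := hsub (sphere_subset_closedBall hz) (mem_closedBall_self (half_pos hr).le)
    rw [this, mem_sphere, dist_self] at hz
    linarith
  obtain ⟨N, hN, hsmall⟩ := h.exists_nhds_subset_ball hr le_rfl (ball_subset_closedBall.trans hball)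
    hz hfz
  obtain ⟨V, hV, _, -, -, hex⟩ := h.exists_isPreconnected hy₀ hN
  obtain ⟨C, hCo, hC, hCD, hxC, hCN, -, hCL⟩ := hex x₀ hx₀ (mem_of_mem_nhds hV)
  exact hCL _ (isCompact_closedBall x₀ r) hball
    ((hsmall C hCo hC hCD hxC hCN).trans ball_subset_closedBall)

/-- `f` is proper. -/
theorem exists_compact_preimage (h : IsPoletskyLimit Q D D' fm f) {K : Set (Rn n)}
    (hK : IsCompact K) (hKD : K ⊆ D') :
    ∃ K₀, IsCompact K₀ ∧ K₀ ⊆ D ∧ ∀ x ∈ D, f x ∈ K → x ∈ K₀ := by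
  obtain ⟨K', hK', hKK', hK'D⟩ := exists_compact_between hK h.isOpen_target hKD
  obtain ⟨m, hm⟩ := (h.tendsto.eventually_mem (hK.image OnePoint.continuous_coe)
    (isOpen_toExt isOpen_interior) (image_mono hKK')).exists
  refine ⟨D ∩ fm m ⁻¹' K', h.isCompact_preimage m hK' hK'D, inter_subset_left, fun x hx hfx => ?_⟩
  have hfm : fm m x ∈ interior K' := coe_mem_toExt.1 ((hm x hx).1 (mem_image_of_mem _ hfx))
  exact ⟨hx, mem_preimage.2 (interior_subset hfm)⟩

/-- If `y` were omitted, then near `y` all values of `f` would lie in the compact set `f '' K₀`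
missing `y`; a point that `fm m` maps to `y` has its `f`-value near `y` but off `f '' K₀`. -/
theorem image_eq (h : IsPoletskyLimit Q D D' fm f) : f '' D = D' := by
  refine h.mapsTo.image_subset.antisymm fun y hy => ?_
  by_contra hcon
  obtain ⟨K, hK, hyK, hKD⟩ := exists_compact_between (isCompact_singleton (x := y)) h.isOpen_target
    (singleton_subset_iff.2 hy)
  obtain ⟨K₀, hK₀, hK₀D, hmem⟩ := h.exists_compact_preimage hK hKD
  have hO : IsOpen (interior K \ f '' K₀) := isOpen_interior.sdiff
    (hK₀.image_of_continuousOn (h.continuousOn.mono hK₀D)).isClosed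
  obtain ⟨m, hm⟩ := (h.tendsto.eventually_mem (isCompact_singleton (x := (y : RnBar n)))
    (isOpen_toExt hO) (singleton_subset_iff.2 (coe_mem_toExt.2
      ⟨hyK rfl, fun hy' => hcon (image_mono hK₀D hy')⟩))).exists
  obtain ⟨x, hx, hxy⟩ := (h.isClosedOnto m).1.symm ▸ hy
  have hfx := coe_mem_toExt.1 ((hm x hx).2 (by rw [hxy]; rfl))
  exact hfx.2 (mem_image_of_mem f (hmem x hx (interior_subset hfx.1)))

/-- Closedness is local in `D'`, and by properness the image of `D ∩ C` near a point is contained in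
the compact image of `K₀ ∩ C`. -/
theorem isClosedOnto_limit (h : IsPoletskyLimit Q D D' fm f) : IsClosedOnto f D D' := by
  refine ⟨h.image_eq, fun C hC => ⟨closure (f '' (D ∩ C)), isClosed_closure, ?_⟩⟩
  refine subset_antisymm (fun y hy => ⟨h.image_eq ▸ image_mono inter_subset_left hy,
    subset_closure hy⟩) ?_
  rintro y ⟨hy, hycl⟩
  obtain ⟨K, hK, hyK, hKD⟩ := exists_compact_between (isCompact_singleton (x := y)) h.isOpen_target
    (singleton_subset_iff.2 hy)
  obtain ⟨K₀, hK₀, hK₀D, hmem⟩ := h.exists_compact_preimage hK hKD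
  have hcl : IsClosed (f '' (K₀ ∩ C)) := ((hK₀.inter_right hC).image_of_continuousOn
    (h.continuousOn.mono (inter_subset_left.trans hK₀D))).isClosed
  have hsub : interior K ∩ f '' (D ∩ C) ⊆ f '' (K₀ ∩ C) := by
    rintro _ ⟨hw, x, hx, rfl⟩
    exact ⟨x, ⟨hmem x hx.1 (interior_subset hw), hx.2⟩, rfl⟩
  have := closure_minimal hsub hcl (isOpen_interior.inter_closure ⟨hyK rfl, hycl⟩)
  exact image_mono (inter_subset_inter_left C hK₀D) this

end IsPoletskyLimit

/-! ### Boundary behaviour of the limit -/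

theorem exists_mem_of_mem_extClosure {D : Set (Rn n)} {z : RnBar n} (hz : z ∈ extClosure D)
    {V : Set (RnBar n)} (hV : V ∈ 𝓝 z) : ∃ w ∈ D, (w : RnBar n) ∈ V := by
  obtain ⟨_, hwV, w, hw, rfl⟩ := mem_closure_iff_nhds.1 hz V hV
  exact ⟨w, hw, hwV⟩

/-- If a subset `S` of `D` is locally connected, relative to `D`, at the points of a connected set
`K` of the closure of `D`, then points of `D` near any two points of `K` can be joined in `S`. -/
theorem exists_mem_connectedComponentIn {D S : Set (Rn n)} {K : Set (RnBar n)}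
    (hK : IsPreconnected K) (hKD : K ⊆ extClosure D)
    (hloc : ∀ z ∈ K, ∃ V ∈ 𝓝 z, ∀ v ∈ D, ∀ w ∈ D, (v : RnBar n) ∈ V → (w : RnBar n) ∈ V →
      w ∈ connectedComponentIn S v)
    {x₀ x₁ : RnBar n} (hx₀ : x₀ ∈ K) (hx₁ : x₁ ∈ K) {V₀ V₁ : Set (RnBar n)} (hV₀ : V₀ ∈ 𝓝 x₀)
    (hV₁ : V₁ ∈ 𝓝 x₁) :
    ∃ p ∈ D, ∃ q ∈ D, (p : RnBar n) ∈ V₀ ∧ (q : RnBar n) ∈ V₁ ∧ q ∈ connectedComponentIn S p := by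
  obtain ⟨A, hA, hAloc⟩ := hloc x₀ hx₀
  obtain ⟨p, hp, hpA, hpV⟩ := exists_mem_of_mem_extClosure (hKD hx₀) (inter_mem hA hV₀)
  by_contra! hcon
  -- Near each point of `K` the points of `D` lie all inside or all outside the component of `p`.
  -- These alternatives define two open sets covering `K`; a common point of them in `K` is
  -- impossible, being a limit of points of `D`.
  set O₁ : Set (RnBar n) :=
    {z | ∀ᶠ u in 𝓝 z, ∀ v ∈ D, (v : RnBar n) = u → v ∈ connectedComponentIn S p} with hO₁
  set O₂ : Set (RnBar n) :=
    {z | ∀ᶠ u in 𝓝 z, ∀ v ∈ D, (v : RnBar n) = u → v ∉ connectedComponentIn S p} with hO₂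
  have h₁ : IsOpen O₁ := isOpen_iff_mem_nhds.2 fun z hz => eventually_eventually_nhds.2 hz
  have h₂ : IsOpen O₂ := isOpen_iff_mem_nhds.2 fun z hz => eventually_eventually_nhds.2 hz
  have hcov : K ⊆ O₁ ∪ O₂ := fun z hz => by
    obtain ⟨V, hV, hVloc⟩ := hloc z hz
    by_cases hex : ∃ v ∈ D, (v : RnBar n) ∈ V ∧ v ∈ connectedComponentIn S p
    · obtain ⟨v, hv, hvV, hvp⟩ := hex
      refine Or.inl (mem_of_superset hV ?_)
      rintro _ hu w hw rfl
      rw [connectedComponentIn_eq hvp]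
      exact hVloc v hv w hw hvV hu
    · push Not at hex
      refine Or.inr (mem_of_superset hV ?_)
      rintro _ hu w hw rfl
      exact hex w hw hu
  have hx₀O : x₀ ∈ O₁ := by
    refine mem_of_superset hA ?_
    rintro _ hu w hw rfl
    exact hAloc p hp w hw hpA hu
  have hx₁O : x₁ ∈ O₂ := by
    refine mem_of_superset hV₁ ?_
    rintro _ hu w hw rfl
    exact hcon p hp w hw hpV hu
  obtain ⟨z, hzK, hz₁, hz₂⟩ := hK O₁ O₂ h₁ h₂ hcov ⟨x₀, hx₀, hx₀O⟩ ⟨x₁, hx₁, hx₁O⟩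
  obtain ⟨w, hw, hwz⟩ := exists_mem_of_mem_extClosure (hKD hzK) (inter_mem hz₁ hz₂)
  exact hwz.2 w hw rfl (hwz.1 w hw rfl)

namespace IsPoletskyLimit

variable {Q : Rn n → ℝ≥0∞} {D D' : Set (Rn n)} {fm : ℕ → Rn n → Rn n} {f : Rn n → Rn n}

/-- Cluster values at boundary points are boundary points. -/
theorem mem_extBoundary_of_clusterPt (h : IsPoletskyLimit Q D D' fm f) {x₀ y : RnBar n}
    (hx₀ : x₀ ∈ extBoundary D) (hy : MapClusterPt y (𝓝[toExt D] x₀) (OnePoint.map f)) :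
    y ∈ extBoundary D' := by
  rw [extBoundary_eq h.domain.1] at hx₀
  rw [extBoundary_eq h.isOpen_target]
  refine ⟨mem_closure_iff_nhds.2 fun V hV => ?_, ?_⟩
  · obtain ⟨_, hV', x, hx, rfl⟩ := ((hy.frequently hV).and_eventually self_mem_nhdsWithin).exists
    exact ⟨_, hV', coe_mem_toExt.2 (h.mapsTo hx)⟩
  · rintro ⟨w, hw, rfl⟩
    obtain ⟨K, hK, hwK, hKD⟩ := exists_compact_between (isCompact_singleton (x := w))
      h.isOpen_target (singleton_subset_iff.2 hw)
    obtain ⟨K₀, hK₀, hK₀D, hmem⟩ := h.exists_compact_preimage hK hKD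
    have hfar : (toExt K₀)ᶜ ∈ 𝓝[toExt D] x₀ := mem_nhdsWithin_of_mem_nhds
      ((hK₀.image OnePoint.continuous_coe).isClosed.isOpen_compl.mem_nhds
        fun hx => hx₀.2 (image_mono hK₀D hx))
    obtain ⟨_, ⟨hV, hx'⟩, x, hx, rfl⟩ := (((hy.frequently ((isOpen_toExt isOpen_interior).mem_nhds
      (coe_mem_toExt.2 (hwK rfl)))).and_eventually hfar).and_eventually self_mem_nhdsWithin).exists
    have hfx : f x ∈ interior K := coe_mem_toExt.1 hV
    exact hx' (coe_mem_toExt.2 (hmem x hx (interior_subset hfx)))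

/-- The cluster value at a boundary point is unique. -/
theorem eq_of_mapClusterPt (h : IsPoletskyLimit Q D D' fm f) {x₀ y y' : RnBar n}
    (hx₀ : x₀ ∈ extBoundary D) (hy : MapClusterPt y (𝓝[toExt D] x₀) (OnePoint.map f))
    (hy' : MapClusterPt y' (𝓝[toExt D] x₀) (OnePoint.map f)) : y = y' := by
  by_contra hne
  have hyb := h.mem_extBoundary_of_clusterPt hx₀ hy
  have hyb' := h.mem_extBoundary_of_clusterPt hx₀ hy'
  obtain ⟨A, B, hA, hB, hdisj⟩ := t2_separation_nhds hne
  obtain ⟨N, hN, -, -, hmod⟩ := h.exists_nhds_modulus_le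
    (extBoundary_eq h.isOpen_target ▸ hyb : y ∈ extClosure D' \ toExt D').1 hA one_ne_zero
  obtain ⟨V, hV, K, hK, hKD, hex⟩ := h.exists_isPreconnected hyb hN
  obtain ⟨V', hV', K', hK', hKD', hex'⟩ := h.exists_isPreconnected hyb' hB
  have hx₀D : x₀ ∉ toExt D := (extBoundary_eq h.domain.1 ▸ hx₀ : x₀ ∈ extClosure D \ toExt D).2
  -- The continua built below start near `x₀` and end in `K` or `K'`, so both leave this
  -- neighbourhood and weak flatness gives modulus above one. Their images lie near the distinct
  -- values `y` and `y'`, so the modulus is also at most one.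
  have hU : (toExt (K ∪ K'))ᶜ ∈ 𝓝 x₀ :=
    ((hK.union hK').image OnePoint.continuous_coe).isClosed.isOpen_compl.mem_nhds
      fun hx => hx₀D (image_mono (union_subset hKD hKD') hx)
  obtain ⟨W, hW, -, hflat⟩ := h.flat.exists_lt_modulus hx₀ one_pos hU
  have key : ∀ {z : RnBar n} {N V : Set (RnBar n)} {K₁ : Set (Rn n)},
      MapClusterPt z (𝓝[toExt D] x₀) (OnePoint.map f) → V ∈ 𝓝 z → K₁ ⊆ K ∪ K' →
      (∀ x ∈ D, (f x : RnBar n) ∈ V → ∃ C : Set (Rn n), IsOpen C ∧ IsPreconnected C ∧ C ⊆ D ∧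
        x ∈ C ∧ (∀ w ∈ C, (f w : RnBar n) ∈ N) ∧ (C ∩ K₁).Nonempty ∧
        ∀ L, IsCompact L → L ⊆ D → ¬ C ⊆ L) →
      ∃ E : Set (Rn n), IsContinuumSet E ∧ E ⊆ D ∧ (∃ x ∈ E, (x : RnBar n) ∈ W) ∧
        (∃ x ∈ E, (x : RnBar n) ∉ (toExt (K ∪ K'))ᶜ) ∧ ∀ x ∈ E, (f x : RnBar n) ∈ N := by
    intro z N V K₁ hz hV hK₁ hex
    obtain ⟨_, ⟨hxV, hxW⟩, x, hx, rfl⟩ := (((hz.frequently hV).and_eventually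
      (mem_nhdsWithin_of_mem_nhds hW)).and_eventually self_mem_nhdsWithin).exists
    obtain ⟨C, hCo, hC, hCD, hxC, hCN, ⟨w, hwC, hwK⟩, -⟩ := hex x hx hxV
    obtain ⟨p, hp, hp0, hp1, hpC, hcon⟩ := exists_path_continuum hCo hC hxC hwC
    exact ⟨_, hcon, hpC.trans hCD, ⟨x, ⟨0, ⟨le_rfl, zero_le_one⟩, hp0⟩, hxW⟩,
      ⟨w, ⟨1, ⟨zero_le_one, le_rfl⟩, hp1⟩, not_not.2 (coe_mem_toExt.2 (hK₁ hwK))⟩,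
      fun x hx => hCN x (hpC hx)⟩
  obtain ⟨E, hE, hED, hEW, hEU, hEN⟩ := key hy hV subset_union_left hex
  obtain ⟨F, hF, hFD, hFW, hFU, hFN⟩ := key hy' hV' subset_union_right hex'
  have h1 := hflat E F hE hF hED hFD hEW hEU hFW hFU
  rw [ENNReal.ofReal_one] at h1
  exact absurd (hmod E F hED hFD hF.2.nonempty hEN
    (fun x hx hxA => disjoint_left.1 hdisj hxA (hFN x hx))) (not_le.2 h1)

theorem tendsto_coe (h : IsPoletskyLimit Q D D' fm f) {x : Rn n} (hx : x ∈ D) :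
    Tendsto (OnePoint.map f) (𝓝[toExt D] (x : RnBar n)) (𝓝 (f x : RnBar n)) := by
  rw [(isOpen_toExt h.domain.1).nhdsWithin_eq (coe_mem_toExt.2 hx), OnePoint.nhds_coe_eq,
    tendsto_map'_iff]
  exact (OnePoint.continuous_coe.tendsto _).comp
    (h.continuousOn.continuousAt (h.domain.1.mem_nhds hx))

/-- `f` has a continuous extension to the closure of `D`. -/
theorem exists_extension (h : IsPoletskyLimit Q D D' fm f) :
    ∃ fbar : RnBar n → RnBar n, ContinuousOn fbar (extClosure D) ∧
      (∀ x ∈ D, fbar (x : RnBar n) = (f x : RnBar n)) ∧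
      MapsTo fbar (extBoundary D) (extBoundary D') := by
  have hlim : ∀ x₀ ∈ extBoundary D, ∃ y ∈ extBoundary D',
      Tendsto (OnePoint.map f) (𝓝[toExt D] x₀) (𝓝 y) := by
    intro x₀ hx₀
    have hne : (𝓝[toExt D] x₀).NeBot := mem_closure_iff_nhdsWithin_neBot.1
      (extBoundary_eq h.domain.1 ▸ hx₀ : x₀ ∈ extClosure D \ toExt D).1
    -- Compactness of the extended space supplies a cluster value, and its uniqueness makes it the
    -- limit. The value of `OnePoint.map f` at infinity plays no role within `toExt D`.
    obtain ⟨y, hy⟩ := exists_clusterPt_of_compactSpace (map (OnePoint.map f) (𝓝[toExt D] x₀))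
    exact ⟨y, h.mem_extBoundary_of_clusterPt hx₀ hy,
      le_nhds_of_unique_clusterPt fun z hz => h.eq_of_mapClusterPt hx₀ hz hy⟩
  refine ⟨extendFrom (toExt D) (OnePoint.map f), continuousOn_extendFrom Subset.rfl fun x hx => ?_,
    fun x hx => extendFrom_eq (subset_closure (coe_mem_toExt.2 hx)) (h.tendsto_coe hx),
    fun x hx => ?_⟩
  · by_cases hxD : x ∈ toExt D
    · obtain ⟨w, hw, rfl⟩ := hxD
      exact ⟨_, h.tendsto_coe hw⟩
    · obtain ⟨y, -, hy⟩ := hlim x (extBoundary_eq h.domain.1 ▸ ⟨hx, hxD⟩)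
      exact ⟨y, hy⟩
  · obtain ⟨y, hyb, hy⟩ := hlim x hx
    rw [extendFrom_eq (extBoundary_eq h.domain.1 ▸ hx : x ∈ extClosure D \ toExt D).1 hy]
    exact hyb

theorem image_extension (h : IsPoletskyLimit Q D D' fm f) {fbar : RnBar n → RnBar n}
    (hc : ContinuousOn fbar (extClosure D))
    (heq : ∀ x ∈ D, fbar (x : RnBar n) = (f x : RnBar n)) :
    fbar '' extClosure D = extClosure D' := by
  have himage : fbar '' toExt D = toExt D' := by
    rw [← h.image_eq, toExt, toExt, image_image, image_image]
    exact image_congr heq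
  refine subset_antisymm ?_ (closure_minimal ?_
    (isClosed_closure.isCompact.image_of_continuousOn hc).isClosed)
  · rw [extClosure, extClosure, ← himage]
    exact hc.image_closure
  · rw [← himage]
    exact image_mono subset_closure

/-- A continuum on which the extension is constant and which lies in the boundary is a point. -/
theorem subsingleton_of_subset_extBoundary (h : IsPoletskyLimit Q D D' fm f)
    {fbar : RnBar n → RnBar n} (hc : ContinuousOn fbar (extClosure D))
    (heq : ∀ x ∈ D, fbar (x : RnBar n) = (f x : RnBar n))
    (hmaps : MapsTo fbar (extBoundary D) (extBoundary D')) {K : Set (RnBar n)}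
    (hK : IsPreconnected K) (hKb : K ⊆ extBoundary D) {y : RnBar n} (hKy : ∀ z ∈ K, fbar z = y) :
    K.Subsingleton := by
  intro x₀ hx₀ x₁ hx₁
  by_contra hne
  have hbd : ∀ z ∈ K, z ∈ extClosure D \ toExt D := fun z hz => by
    rw [← extBoundary_eq h.domain.1]; exact hKb hz
  have hyb : y ∈ extClosure D' \ toExt D' := by
    rw [← extBoundary_eq h.isOpen_target, ← hKy x₀ hx₀]; exact hmaps (hKb hx₀)
  obtain ⟨A, B, hA, hB, hdisj⟩ := t2_separation_nhds hne
  obtain ⟨W, hW, -, hflat⟩ := h.flat.exists_lt_modulus (hKb hx₀) one_pos hA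
  obtain ⟨a, ha, haW⟩ := exists_mem_of_mem_extClosure (hbd x₀ hx₀).1 hW
  obtain ⟨b, hb, hbB⟩ := exists_mem_of_mem_extClosure (hbd x₁ hx₁).1 hB
  obtain ⟨p, hp, hp0, hp1, hpD, hpcon⟩ :=
    exists_path_continuum h.domain.1 h.domain.2.isPreconnected ha hb
  -- The reference path `p` joins points near `x₀` and `x₁`; its image is compact in `D'`, hence
  -- avoids a neighbourhood of the boundary point `y`. A second path `e`, running along `K` inside
  -- `S`, is mapped near `y`, and the two paths contradict weak flatness at `x₀`.
  have hN : (toExt (f '' (p '' Icc 0 1)))ᶜ ∈ 𝓝 y :=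
    ((hpcon.1.image_of_continuousOn (h.continuousOn.mono hpD)).image
      OnePoint.continuous_coe).isClosed.isOpen_compl.mem_nhds fun hy =>
        hyb.2 (image_mono ((image_mono hpD).trans h.image_eq.subset) hy)
  obtain ⟨N, hNy, hNo, -, hmod⟩ := h.exists_nhds_modulus_le hyb.1 hN one_ne_zero
  set S : Set (Rn n) := D ∩ f ⁻¹' ((fun y : Rn n => (y : RnBar n)) ⁻¹' N) with hS
  have hSo : IsOpen S := h.continuousOn.isOpen_inter_preimage h.domain.1
    (hNo.preimage OnePoint.continuous_coe)
  have hloc : ∀ z ∈ K, ∃ V ∈ 𝓝 z, ∀ v ∈ D, ∀ w ∈ D, (v : RnBar n) ∈ V → (w : RnBar n) ∈ V →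
      w ∈ connectedComponentIn S v := by
    intro z hz
    have hzN : fbar ⁻¹' N ∈ 𝓝[extClosure D] z := hc z (hbd z hz).1 (by rw [hKy z hz]; exact hNy)
    obtain ⟨U, hU, hUN⟩ := mem_nhdsWithin_iff_exists_mem_nhds_inter.1 hzN
    obtain ⟨V, hV, -, hVloc⟩ := h.flat.locallyConnected h.two_le h.domain (hKb hz) hU
    refine ⟨V, hV, fun v hv w hw hvV hwV =>
      connectedComponentIn_mono v (show {u ∈ D | (u : RnBar n) ∈ U} ⊆ S from fun u hu =>
        ⟨hu.1, ?_⟩) (hVloc v hv w hw hvV hwV)⟩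
    have := hUN ⟨hu.2, subset_closure (coe_mem_toExt.2 hu.1)⟩
    rwa [mem_preimage, heq u hu.1] at this
  obtain ⟨u, hu, v, hv, huW, hvB, hvu⟩ := exists_mem_connectedComponentIn hK
    (fun z hz => (hbd z hz).1) hloc hx₀ hx₁ hW hB
  have hne' : (connectedComponentIn S u).Nonempty := ⟨v, hvu⟩
  obtain ⟨e, he, he0, he1, heS, hecon⟩ := exists_path_continuum hSo.connectedComponentIn
    isPreconnected_connectedComponentIn
    (mem_connectedComponentIn (connectedComponentIn_nonempty_iff.1 hne')) hvu
  have heS' : e '' Icc 0 1 ⊆ S := heS.trans (connectedComponentIn_subset _ _)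
  have h0 : (0 : ℝ) ∈ Icc (0 : ℝ) 1 := ⟨le_rfl, zero_le_one⟩
  have h1 : (1 : ℝ) ∈ Icc (0 : ℝ) 1 := ⟨zero_le_one, le_rfl⟩
  have hgt := hflat (e '' Icc 0 1) (p '' Icc 0 1) hecon hpcon (heS'.trans inter_subset_left) hpD
    ⟨u, ⟨0, h0, he0⟩, huW⟩ ⟨v, ⟨1, h1, he1⟩, fun hvA => disjoint_left.1 hdisj hvA hvB⟩
    ⟨a, ⟨0, h0, hp0⟩, haW⟩ ⟨b, ⟨1, h1, hp1⟩, fun hbA => disjoint_left.1 hdisj hbA hbB⟩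
  rw [ENNReal.ofReal_one] at hgt
  exact absurd (hmod _ _ (heS'.trans inter_subset_left) hpD hpcon.2.nonempty
    (fun x hx => (heS' hx).2) (fun x hx => not_not.2 (coe_mem_toExt.2 (mem_image_of_mem f hx))))
    (not_le.2 hgt)

/-- Boundary points go to the boundary of `D'` and points of `D` go into `D'`, so a fibre never
mixes the two and its continua fall under one of the cases already treated. -/
theorem isLightOn_extension (h : IsPoletskyLimit Q D D' fm f) {fbar : RnBar n → RnBar n}
    (hc : ContinuousOn fbar (extClosure D))
    (heq : ∀ x ∈ D, fbar (x : RnBar n) = (f x : RnBar n))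
    (hmaps : MapsTo fbar (extBoundary D) (extBoundary D')) :
    IsLightOn fbar (extClosure D) := by
  intro y K hK hKD
  by_cases hKb : K ⊆ extBoundary D
  · exact h.subsingleton_of_subset_extBoundary hc heq hmaps hK.2.isPreconnected hKb
      fun z hz => (hKD hz).2
  rw [extBoundary_eq h.domain.1] at hKb
  obtain ⟨z, hzK, hz⟩ := not_subset.1 hKb
  obtain ⟨w, hw, rfl⟩ : z ∈ toExt D := by
    by_contra hzD
    exact hz ⟨(hKD hzK).1, hzD⟩
  have hy : y = (f w : RnBar n) := by rw [← heq w hw]; exact (hKD hzK).2.symm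
  have hKsub : K ⊆ toExt D := fun z hz => by
    by_contra hzD
    have hzb : fbar z ∈ extBoundary D' := hmaps (extBoundary_eq h.domain.1 ▸ ⟨(hKD hz).1, hzD⟩)
    rw [extBoundary_eq h.isOpen_target, (hKD hz).2, hy] at hzb
    exact hzb.2 (coe_mem_toExt.2 (h.mapsTo hw))
  obtain ⟨K₁, hK₁D, rfl⟩ := subset_image_iff.1 hKsub
  have hind := (OnePoint.isOpenEmbedding_coe (X := Rn n)).isInducing
  refine (h.isLightOn (f w) K₁ ⟨hind.isCompact_iff.2 hK.1, hK.2.nonempty.of_image,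
    hind.isPreconnected_image.1 hK.2.isPreconnected⟩ fun v hv => ⟨hK₁D hv, ?_⟩).image _
  have := (hKD (mem_image_of_mem _ hv)).2
  rw [mem_preimage, heq v (hK₁D hv), hy] at this
  exact OnePoint.coe_injective this

end IsPoletskyLimit

end InverseModulus

/-! ### The main theorem -/

theorem mainTheorem1 (n : ℕ) (hn : 2 ≤ n)
    (D D' : Set (InverseModulus.Rn n))
    (hD : InverseModulus.IsDomainSet D) (hD' : InverseModulus.IsDomainSet D')
    (hflat : InverseModulus.WeaklyFlatBoundary D)
    (hfin : InverseModulus.FinitelyConnectedAtBoundary D')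
    (Q : InverseModulus.Rn n → ℝ≥0∞) (hQ : AEMeasurable Q volume)
    (hQ0 : ∀ y, y ∉ D' → Q y = 0)
    (fm : ℕ → InverseModulus.Rn n → InverseModulus.Rn n)
    (hcont : ∀ m, ContinuousOn (fm m) D)
    (hopen : ∀ m, InverseModulus.IsOpenOn (fm m) D)
    (hdiscrete : ∀ m, InverseModulus.IsDiscreteOn (fm m) D)
    (hclosed : ∀ m, InverseModulus.IsClosedOnto (fm m) D D')
    (hPoletsky : ∀ m, ∀ y₀ ∈ InverseModulus.extClosure D',
      InverseModulus.InversePoletskyAt (fm m) D Q y₀)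
    (f : InverseModulus.Rn n → InverseModulus.Rn n)
    (hlim : InverseModulus.ChordalTendstoUniformlyOn fm f D)
    (hnonconst : ∃ x ∈ D, ∃ z ∈ D, f x ≠ f z)
    (hcond : (∀ y₀ ∈ InverseModulus.extClosure D', InverseModulus.FMOAt Q y₀) ∨
      (∀ y₀ ∈ InverseModulus.extClosure D', InverseModulus.DivergenceAt Q y₀)) :
    InverseModulus.IsLightOn f D ∧
    InverseModulus.IsClosedOnto f D D' ∧
    ∃ fbar : InverseModulus.RnBar n → InverseModulus.RnBar n,
      ContinuousOn fbar (InverseModulus.extClosure D) ∧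
      (∀ x ∈ D, fbar (x : InverseModulus.RnBar n) = (f x : InverseModulus.RnBar n)) ∧
      fbar '' InverseModulus.extClosure D = InverseModulus.extClosure D' ∧
      InverseModulus.IsLightOn fbar (InverseModulus.extClosure D) := by
  -- The two alternative conditions on `Q` enter only through this common consequence; at infinity
  -- it is obtained for `Q` composed with the inversion.
  have hvan : ∀ y₀ ∈ InverseModulus.extClosure D', InverseModulus.RingIntegralsVanishAt Q y₀ := by
    have hQinv := InverseModulus.aemeasurable_comp_invert hn hQ
    rcases hcond with hc | hc
    · exact fun y₀ hy₀ => ⟨fun y hy => InverseModulus.ringIntegralsVanish_of_fmo hn hQ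
        ((hc y₀ hy₀).1 y hy), fun hy => InverseModulus.ringIntegralsVanish_of_fmo hn hQinv
        ((hc y₀ hy₀).2 hy)⟩
    · exact fun y₀ hy₀ => ⟨fun y hy => InverseModulus.ringIntegralsVanish_of_divergence hn hQ
        ((hc y₀ hy₀).1 y hy), fun hy => InverseModulus.ringIntegralsVanish_of_divergence hn hQinv
        ((hc y₀ hy₀).2 hy)⟩
  have h : InverseModulus.IsPoletskyLimit Q D D' fm f :=
    ⟨hn, hD, hD'.1, hflat, hfin, hvan, hcont, hopen, hclosed, hPoletsky, hlim, hnonconst⟩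
  obtain ⟨fbar, hc, heq, hmaps⟩ := h.exists_extension
  exact ⟨h.isLightOn, h.isClosedOnto_limit, fbar, hc, heq, h.image_extension hc heq,
    h.isLightOn_extension hc heq hmaps⟩
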